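/- Let $A$ and $B$ be Boolean matrices of dimensions $d_1\times d_3$ and $d_3\times d_2$ with $d_1,d_2,d_3\ge 1$, and let $C=AB$ be their Boolean product, $C_{ij}=\bigvee_k (A_{ik}\wedge B_{kj})$. Put $\psi_1=d_1+d_2+d_3$, $\psi_2=d_1d_2+d_1d_3+d_2d_3$ and $\psi_3=d_1d_2d_3$. For an integer $s\ge 0$, the opportunistic algorithm with parameter $s$ (and base case of size $b=1$) is the following. Index matrices of dimension $m=2^s$ by $\{0,1\}^s$. Draw independent uniformly random functions $f_i:\{0,1\}^s\to\{1,\dots,d_i\}$ $(i=1,2,3)$ and a uniformly random $m\times m$ binary matrix $D$. Put $\bar A_{xz}=A_{f_1(x)f_3(z)}$ and $\bar B_{zy}=B_{f_3(z)f_2(y)}D_{zy}$, and compute over $GF(2)$ the pseudo-product $\bar C_{xy}=\sum_z \bar A_{xz}\bar B_{zy}$, where the sum is over those $z$ for which the coordinatewise disjunction $x\vee y\vee z$ is the all-ones vector. Return the matrix $\tilde C_{ij}=\bigvee_{f_1(x)=i,\ f_2(y)=j}\bar C_{xy}$. Theorem. For every real $c$ there are a constant $K$, a choice of the parameter $s=s(d_1,d_2,d_3)$,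 and a single randomized program such that, for all $d_1,d_2,d_3\ge 1$ with $\psi_3^{0.350}\ge\psi_1$ and $\psi_3^{0.694}\ge\psi_2$ and all $A,B$ as above, the program on input $(d_1,d_2,d_3,A,B)$ always halts after at most $$K\,(\psi_3\log\psi_3)^{\frac{\log 6}{\log 7}}$$ bit operations; its output has the same distribution as the matrix $\tilde C$ returned by the opportunistic algorithm with parameter $s(d_1,d_2,d_3)$; and this output equals $C$ with probability at least $1-\psi_3^{-c}$. Here bit operations are counted on a random access machine with logarithmic cost: every step is charged according to the binary lengths of the numbers and addresses it handles (schoolbook cost for arithmetic), and a uniformly random number below a given bound $n$ can be drawn at the cost of the length of $n$. -/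

import Mathlib

/-! ## A random access machine with logarithmic cost

Programs are built from finitely many instructions; the machine has registers and arrays holding
natural numbers.  Every step is charged for the lengths, in bits, of the numbers it handles, so
that the accumulated time is a count of bit operations. -/

namespace BitRAM

/-- Binary operations on the contents of registers. -/
inductive Op where
  | add | sub | mul | div | mod | lt

/-- The value of a binary operation; subtraction is truncated, a comparison gives `1` or `0`. -/
def Op.eval : Op → ℕ → ℕ → ℕ
  | .add, a, b => a + b
  | .sub, a, b => a - b
  | .mul, a, b => a * b
  | .div, a, b => a / b
  | .mod, a, b => a % b
  | .lt, a, b => if a < b then 1 else 0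

/-- Commands. Registers, arrays and procedures are named by fixed numbers in the program text. -/
inductive Cmd where
  /-- do nothing -/
  | skip
  /-- `reg r := n` -/
  | const (r n : ℕ)
  /-- `reg r := reg a ∘ reg b` -/
  | op (o : Op) (r a b : ℕ)
  /-- `reg r := array k [reg a]` -/
  | load (r k a : ℕ)
  /-- `array k [reg a] := reg b` -/
  | store (k a b : ℕ)
  /-- `reg r :=` a fresh uniformly random number in `{0, …, reg a - 1}` -/
  | rand (r a : ℕ)
  /-- first `p`, then `q` -/
  | seq (p q : Cmd)
  /-- if `reg r ≠ 0` then `p`, else `q` -/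
  | ite (r : ℕ) (p q : Cmd)
  /-- while `reg r ≠ 0` do `p` -/
  | loop (r : ℕ) (p : Cmd)
  /-- call the `i`-th procedure (possibly recursively; all data are passed in the memory) -/
  | call (i : ℕ)

/-- A program: a finite list of procedures and a main command. -/
structure Program where
  procs : List Cmd
  main : Cmd

/-- The contents of the registers and of the arrays. -/
structure State where
  reg : ℕ → ℕ
  mem : ℕ → ℕ → ℕ

/-- Write the number `v` to register `r`. -/
def State.setReg (σ : State) (r v : ℕ) : State :=
  { σ with reg := Function.update σ.reg r v }

/-- Write the number `v` to cell `i` of array `k`. -/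
def State.setMem (σ : State) (k i v : ℕ) : State :=
  { σ with mem := Function.update σ.mem k (Function.update (σ.mem k) i v) }

/-- A configuration: the stack of commands still to be executed, the memory, and the time spent. -/
structure Config where
  stack : List Cmd
  state : State
  time : ℕ

/-- The uniform distribution on `{0, …, n - 1}` (and the constant `0` if `n = 0`). -/
noncomputable def uniformBelow : ℕ → PMF ℕ
  | 0 => PMF.pure 0
  | n + 1 => (PMF.uniformOfFintype (Fin (n + 1))).map Fin.val

/-- One step of the machine. `Nat.size n` is the length of `n` in binary. Arithmetic operations are
charged at the cost of the schoolbook methods, an access to an array at the lengths of the address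
and of the number transferred, a random draw at the length of its bound. -/
noncomputable def step (P : Program) : Config → PMF Config
  | ⟨[], σ, t⟩ => PMF.pure ⟨[], σ, t⟩
  | ⟨.skip :: K, σ, t⟩ => PMF.pure ⟨K, σ, t + 1⟩
  | ⟨.const r n :: K, σ, t⟩ => PMF.pure ⟨K, σ.setReg r n, t + (1 + n.size)⟩
  | ⟨.op o r a b :: K, σ, t⟩ =>
      PMF.pure ⟨K, σ.setReg r (o.eval (σ.reg a) (σ.reg b)),
        t + (1 + (σ.reg a).size) * (1 + (σ.reg b).size)⟩
  | ⟨.load r k a :: K, σ, t⟩ =>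
      PMF.pure ⟨K, σ.setReg r (σ.mem k (σ.reg a)),
        t + (1 + (σ.reg a).size + (σ.mem k (σ.reg a)).size)⟩
  | ⟨.store k a b :: K, σ, t⟩ =>
      PMF.pure ⟨K, σ.setMem k (σ.reg a) (σ.reg b), t + (1 + (σ.reg a).size + (σ.reg b).size)⟩
  | ⟨.rand r a :: K, σ, t⟩ =>
      (uniformBelow (σ.reg a)).map fun v => ⟨K, σ.setReg r v, t + (1 + (σ.reg a).size)⟩
  | ⟨.seq p q :: K, σ, t⟩ => PMF.pure ⟨p :: q :: K, σ, t + 1⟩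
  | ⟨.ite r p q :: K, σ, t⟩ =>
      PMF.pure ⟨(if σ.reg r ≠ 0 then p else q) :: K, σ, t + (1 + (σ.reg r).size)⟩
  | ⟨.loop r p :: K, σ, t⟩ =>
      PMF.pure ⟨if σ.reg r ≠ 0 then p :: .loop r p :: K else K, σ, t + (1 + (σ.reg r).size)⟩
  | ⟨.call i :: K, σ, t⟩ => PMF.pure ⟨P.procs.getD i .skip :: K, σ, t + 1⟩

/-- The distribution of the configuration after `n` steps (halted machines stay as they are). -/
noncomputable def run (P : Program) : ℕ → Config → PMF Config
  | 0, c => PMF.pure c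
  | n + 1, c => (step P c).bind (run P n)

open Classical in
/-- A matrix in row-major order, followed by zeros. -/
noncomputable def encode {p q : ℕ} (M : Matrix (Fin p) (Fin q) Bool) (t : ℕ) : ℕ :=
  if ∃ i j, t = i.val * q + j.val ∧ M i j = true then 1 else 0

/-- The initial configuration: registers `0, 1, 2` hold `d₁, d₂, d₃`, arrays `0, 1` hold `A, B`,
and the rest of the memory is zero. -/
noncomputable def start (P : Program) {d₁ d₂ d₃ : ℕ} (A : Matrix (Fin d₁) (Fin d₃) Bool)
    (B : Matrix (Fin d₃) (Fin d₂) Bool) : Config where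
  stack := [P.main]
  state :=
    { reg := fun r => if r = 0 then d₁ else if r = 1 then d₂ else if r = 2 then d₃ else 0
      mem := fun k => if k = 0 then encode A else if k = 1 then encode B else fun _ => 0 }
  time := 0

/-- The output: the `d₁ × d₂` matrix held, in row-major order, by array `2`. -/
def output (d₁ d₂ : ℕ) (c : Config) : Matrix (Fin d₁) (Fin d₂) Bool :=
  fun i j => decide (c.state.mem 2 (i.val * d₂ + j.val) ≠ 0)

end BitRAM

/-! ## Boolean matrix multiplication by opportunistic multiplication -/

namespace BMM

/-- The Boolean product `C i j = ⋁ k, A i k ∧ B k j`. -/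
def boolMul {d₁ d₂ d₃ : ℕ} (A : Matrix (Fin d₁) (Fin d₃) Bool)
    (B : Matrix (Fin d₃) (Fin d₂) Bool) : Matrix (Fin d₁) (Fin d₂) Bool :=
  fun i j => decide (∃ k, A i k = true ∧ B k j = true)

/-- Bit vectors of length `s`; they index matrices of dimension `2 ^ s`. -/
abbrev Bits (s : ℕ) : Type := Fin s → Bool

/-- The pseudo-product of matrices of dimension `2 ^ s`: the sum of `A x z * B z y` over those `z`
for which the coordinatewise disjunction of `x`, `y`, `z` is the all-ones vector. -/
def pseudoMul {R : Type*} [NonUnitalNonAssocSemiring R] {s : ℕ}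
    (A B : Matrix (Bits s) (Bits s) R) : Matrix (Bits s) (Bits s) R :=
  fun x y => ∑ z with ∀ i, (x i || y i || z i) = true, A x z * B z y

/-- The random choices: the functions `f₁, f₂, f₃` and the matrix `D` over `GF(2)`. -/
abbrev Sample (s d₁ d₂ d₃ : ℕ) : Type :=
  (Bits s → Fin d₁) × (Bits s → Fin d₂) × (Bits s → Fin d₃) ×
    (Bits s → Bits s → ZMod 2)

open Classical in
/-- The matrix returned by the opportunistic algorithm with base case of size one: blow up `A` and
`B` along random functions, thin out `B` by a random binary matrix, form the pseudo-product over
`GF(2)`, and take disjunctions over the preimages of each pair of indices. -/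
noncomputable def estimate {s d₁ d₂ d₃ : ℕ} (A : Matrix (Fin d₁) (Fin d₃) Bool)
    (B : Matrix (Fin d₃) (Fin d₂) Bool) (ω : Sample s d₁ d₂ d₃) :
    Matrix (Fin d₁) (Fin d₂) Bool :=
  let (f₁, f₂, f₃, D) := ω
  let A' : Matrix (Bits s) (Bits s) (ZMod 2) :=
    fun x z => if A (f₁ x) (f₃ z) = true then 1 else 0
  let B' : Matrix (Bits s) (Bits s) (ZMod 2) :=
    fun z y => (if B (f₃ z) (f₂ y) = true then 1 else 0) * D z y
  fun i j => decide (∃ x y, f₁ x = i ∧ f₂ y = j ∧ pseudoMul A' B' x y = 1)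

/-- The distribution of the returned matrix when all the random choices are uniform. -/
noncomputable def estimateLaw (s : ℕ) {d₁ d₂ d₃ : ℕ} [NeZero d₁] [NeZero d₂] [NeZero d₃]
    (A : Matrix (Fin d₁) (Fin d₃) Bool) (B : Matrix (Fin d₃) (Fin d₂) Bool) :
    PMF (Matrix (Fin d₁) (Fin d₂) Bool) :=
  (PMF.uniformOfFintype (Sample s d₁ d₂ d₃)).map (estimate A B)

/-- The sum of the three dimensions. -/
def psi1 (d₁ d₂ d₃ : ℕ) : ℕ := d₁ + d₂ + d₃

/-- The sum of the pairwise products of the dimensions. -/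
def psi2 (d₁ d₂ d₃ : ℕ) : ℕ := d₁ * d₂ + d₁ * d₃ + d₂ * d₃

/-- The product of the three dimensions. -/
def psi3 (d₁ d₂ d₃ : ℕ) : ℕ := d₁ * d₂ * d₃

end BMM

namespace BitRAM

/-! ## Reasoning about programs -/

/-! The algorithm lives on the gap between two counts. In one coordinate there are seven triples of
bits with x ∨ y ∨ z = 1, yet over GF(2) the corresponding block product needs only six
multiplications (`pseudoMul_eq_six`). In the s-th tensor power, 6^s multiplications evaluate a sum
over 7^s index triples. With 7^s of order ψ₃ log ψ₃, every triple (i, j, k) of original indices is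
expected to be hit a large multiple of log ψ₃ times, while 6^s = (7^s)^(log 6 / log 7) is the
claimed time.

Errors are one-sided. Suppose A_ik = B_kj = 1. If (x, y, z) is mapped to (i, j, k), then entry (x,
y) of the pseudo-product is a nonzero linear form in column y of D, hence a fair bit. One such entry
chosen in each column gives independent bits, since the forms read disjoint columns of D
(`card_missed_mul_le`). So it suffices to bound the probability that no triple is mapped to (i, j,
k) while the bit of its column is 1. A single triple succeeds with probability 1/(2ψ₃), and triples
depend on each other only if they share x, y or z. Janson's inequality (`janson`), obtained from FKG
and a differential inequality for the Laplace transform, bounds the failure by exp(-μ/(2δ)), where μ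
is the expected number of successes and δ bounds the conditional expectation of the successes
overlapping a given one.

To bound δ only typical triples are counted: each vector has at most 23s/40 ones and each union of
two at most 429s/500, slightly more than the means 4s/7 and 6s/7, so that at least half of the
triples remain for large s (`eventually_card_typical`). A typical triple shares a vector of weight w
with at most 4^w 3^(s-w) triples, and two vectors whose union has weight w with at most 2^w. The
exponents 0.350 and 0.694 lie just below 1 - (4 log 4 + 3 log 3)/(7 log 7) and 1 - 6 log 2/(7 log
7). This is what makes every overlap term exponentially smaller than 7^s (`sum_overlap_le`): δ is at
most 1 plus an exponentially small multiple of μ. The failure probability is then an arbitrarily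
high negative power of ψ₃, which survives a union bound over the entries.

For the machine, a matrix of dimension M is kept at the addresses from M² to 2M². The levels of the
recursion thus occupy disjoint ranges, no stack of data is needed, and the bookkeeping at a level
costs 4^s times a quadratic in s. The recurrence with six calls then gives O(6^s) (`mulTime_le`).
Execution is verified by compositional rules for `Exec` that carry the exact law of the final state
along with a time bound. -/

theorem pmf_bind_congr {α β : Type*} (p : PMF α) {f g : α → PMF β}
    (h : ∀ a ∈ p.support, f a = g a) : p.bind f = p.bind g := by
  ext b
  simp only [PMF.bind_apply]
  refine tsum_congr fun a => ?_
  by_cases ha : p a = 0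
  · simp [ha]
  · rw [h a ((PMF.mem_support_iff _ _).2 ha)]

theorem run_add (P : Program) (m n : ℕ) (c : Config) :
    run P (m + n) c = (run P m c).bind (run P n) := by
  induction m generalizing c with
  | zero => simp [run]
  | succ m ih =>
    rw [Nat.succ_add, run, run, PMF.bind_bind]
    exact congrArg _ (funext fun c' => ih c')

theorem run_halted (P : Program) (n : ℕ) (c : Config) (h : c.stack = []) :
    run P n c = PMF.pure c := by
  obtain ⟨K, σ, t⟩ := c
  obtain rfl : K = [] := h
  induction n with
  | zero => rfl
  | succ n ih => rw [run, step, PMF.pure_bind, ih]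

/-- From the configuration `c`, the program halts with total time at most `T`, and the value of
`f` at the final state has the law `ν`. -/
def Reaches {α : Type} (P : Program) (f : State → α) (c : Config) (T : ℕ) (ν : PMF α) : Prop :=
  ∃ n, (∀ x ∈ (run P n c).support, x.stack = [] ∧ x.time ≤ T) ∧
    (run P n c).map (fun x => f x.state) = ν

/-- Halted configurations are fixed points of the step, so running longer changes nothing. This lets
branches of different lengths be compared at a common number of steps. -/
theorem Reaches.eventually {α : Type} {P : Program} {f : State → α} {c : Config} {T : ℕ}
    {ν : PMF α} (h : Reaches P f c T ν) : ∃ n₀, ∀ n ≥ n₀,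
      (∀ x ∈ (run P n c).support, x.stack = [] ∧ x.time ≤ T) ∧
        (run P n c).map (fun x => f x.state) = ν := by
  obtain ⟨n₀, h₁, h₂⟩ := h
  refine ⟨n₀, fun n hn => ?_⟩
  obtain ⟨k, rfl⟩ := Nat.exists_eq_add_of_le hn
  have : run P (n₀ + k) c = run P n₀ c := by
    rw [run_add]
    conv_rhs => rw [← PMF.bind_pure (run P n₀ c)]
    exact pmf_bind_congr _ fun x hx => run_halted P k x (h₁ x hx).1
  rw [this]
  exact ⟨h₁, h₂⟩

theorem Reaches.step_pure {α : Type} {P : Program} {f : State → α} {c c' : Config} {T : ℕ}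
    {ν : PMF α} (hs : step P c = PMF.pure c') (h : Reaches P f c' T ν) : Reaches P f c T ν := by
  obtain ⟨n, h⟩ := h
  refine ⟨n + 1, ?_⟩
  rwa [run, hs, PMF.pure_bind]

theorem uniformBelow_support_finite (n : ℕ) : (uniformBelow n).support.Finite := by
  cases n with
  | zero => simp [uniformBelow]
  | succ n =>
    rw [uniformBelow, PMF.support_map]
    exact (Set.toFinite _).image _

/-- The outcomes of the draw may need different numbers of steps; as there are finitely many, the
maximum serves for all. -/
theorem Reaches.step_rand {α : Type} {P : Program} {f : State → α} {c : Config} {T : ℕ} {b : ℕ}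
    {g : ℕ → Config} {ν : ℕ → PMF α} (hs : step P c = (uniformBelow b).map g)
    (h : ∀ v ∈ (uniformBelow b).support, Reaches P f (g v) T (ν v)) :
    Reaches P f c T ((uniformBelow b).bind ν) := by
  have h' : ∀ v, ∃ n₀, v ∈ (uniformBelow b).support → ∀ n ≥ n₀,
      (∀ x ∈ (run P n (g v)).support, x.stack = [] ∧ x.time ≤ T) ∧
        (run P n (g v)).map (fun x => f x.state) = ν v := fun v => by
    by_cases hv : v ∈ (uniformBelow b).support
    · obtain ⟨n₀, h₀⟩ := (h v hv).eventually
      exact ⟨n₀, fun _ => h₀⟩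
    · exact ⟨0, fun h => absurd h hv⟩
  choose n₀ h₀ using h'
  obtain ⟨N, hN⟩ := ((uniformBelow_support_finite b).image n₀).bddAbove
  have hN' : ∀ v ∈ (uniformBelow b).support, n₀ v ≤ N := fun v hv => hN ⟨v, hv, rfl⟩
  refine ⟨N + 1, ?_, ?_⟩
  · intro x hx
    rw [run, hs, PMF.bind_map, PMF.mem_support_bind_iff] at hx
    obtain ⟨v, hv, hx⟩ := hx
    exact (h₀ v hv N (hN' v hv)).1 x hx
  · rw [run, hs, PMF.bind_map, PMF.map_bind]
    exact pmf_bind_congr _ fun v hv => (h₀ v hv N (hN' v hv)).2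

theorem Reaches.halted {α : Type} {P : Program} {f : State → α} {σ : State} {t T : ℕ}
    (h : t ≤ T) : Reaches P f ⟨[], σ, t⟩ T (PMF.pure (f σ)) := by
  refine ⟨0, ?_, ?_⟩
  · intro x hx
    rw [run, PMF.support_pure, Set.mem_singleton_iff] at hx
    subst hx
    exact ⟨rfl, h⟩
  · rw [run, PMF.pure_map]

/-- Executed in the state `σ`, the command `p` takes time at most `T` and ends in a random state
with law `μ`. -/
def Exec (P : Program) (p : Cmd) (σ : State) (μ : PMF State) (T : ℕ) : Prop :=
  ∀ (α : Type) (f : State → α) (K : List Cmd) (t T' : ℕ) (ν : State → PMF α),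
    (∀ σ' ∈ μ.support, ∀ t' ≤ t + T, Reaches P f ⟨K, σ', t'⟩ T' (ν σ')) →
      Reaches P f ⟨p :: K, σ, t⟩ T' (μ.bind ν)

/-- Executed in the state `σ`, the command `p` takes time at most `T` and ends in `σ'`. -/
abbrev DExec (P : Program) (p : Cmd) (σ σ' : State) (T : ℕ) : Prop :=
  Exec P p σ (PMF.pure σ') T

theorem Exec.mono {P : Program} {p : Cmd} {σ : State} {μ : PMF State} {T T' : ℕ}
    (h : Exec P p σ μ T) (hT : T ≤ T') : Exec P p σ μ T' :=
  fun α f K t U ν hν => h α f K t U ν fun σ' hσ t' ht => hν σ' hσ t' (by omega)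

theorem DExec.of_step {P : Program} {p : Cmd} {σ σ' : State} {T : ℕ}
    (h : ∀ K t, step P ⟨p :: K, σ, t⟩ = PMF.pure ⟨K, σ', t + T⟩) : DExec P p σ σ' T := by
  intro α f K t T' ν hν
  rw [PMF.pure_bind]
  exact Reaches.step_pure (h K t) (hν σ' (by simp) _ le_rfl)

theorem exec_skip (P : Program) (σ : State) : DExec P .skip σ σ 1 :=
  DExec.of_step fun _ _ => rfl

theorem exec_const (P : Program) (σ : State) (r n : ℕ) :
    DExec P (.const r n) σ (σ.setReg r n) (1 + n.size) :=
  DExec.of_step fun _ _ => rfl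

theorem exec_op (P : Program) (σ : State) (o : Op) (r a b : ℕ) :
    DExec P (.op o r a b) σ (σ.setReg r (o.eval (σ.reg a) (σ.reg b)))
      ((1 + (σ.reg a).size) * (1 + (σ.reg b).size)) :=
  DExec.of_step fun _ _ => rfl

theorem exec_load (P : Program) (σ : State) (r k a : ℕ) :
    DExec P (.load r k a) σ (σ.setReg r (σ.mem k (σ.reg a)))
      (1 + (σ.reg a).size + (σ.mem k (σ.reg a)).size) :=
  DExec.of_step fun _ _ => rfl

theorem exec_store (P : Program) (σ : State) (k a b : ℕ) :
    DExec P (.store k a b) σ (σ.setMem k (σ.reg a) (σ.reg b))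
      (1 + (σ.reg a).size + (σ.reg b).size) :=
  DExec.of_step fun _ _ => rfl

theorem exec_rand (P : Program) (σ : State) (r a : ℕ) :
    Exec P (.rand r a) σ ((uniformBelow (σ.reg a)).map fun v => σ.setReg r v)
      (1 + (σ.reg a).size) := by
  intro α f K t T' ν hν
  rw [PMF.bind_map]
  refine Reaches.step_rand (g := fun v => ⟨K, σ.setReg r v, t + (1 + (σ.reg a).size)⟩) rfl ?_
  intro v hv
  refine hν _ ?_ _ le_rfl
  rw [PMF.support_map]
  exact ⟨v, hv, rfl⟩

/-- `Exec` quantifies over all stacks of pending commands and all observables, so composition is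
immediate: `q :: K` is the stack for `p`. No step counts have to be added. -/
theorem Exec.seq {P : Program} {p q : Cmd} {σ : State} {μ : PMF State} {ν : State → PMF State}
    {T₁ T₂ T : ℕ} (hp : Exec P p σ μ T₁) (hq : ∀ σ' ∈ μ.support, Exec P q σ' (ν σ') T₂)
    (hT : 1 + T₁ + T₂ ≤ T) : Exec P (.seq p q) σ (μ.bind ν) T := by
  intro α f K t T' ξ hξ
  rw [PMF.bind_bind]
  refine Reaches.step_pure (c' := ⟨p :: q :: K, σ, t + 1⟩) rfl ?_
  refine hp α f (q :: K) (t + 1) T' _ fun σ' hσ' t' ht' => ?_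
  refine hq σ' hσ' α f K t' T' ξ fun σ'' hσ'' t'' ht'' => ?_
  refine hξ σ'' ?_ t'' (by omega)
  rw [PMF.mem_support_bind_iff]
  exact ⟨σ', hσ', hσ''⟩

theorem DExec.then {P : Program} {p q : Cmd} {σ σ' : State} {μ : PMF State}
    {T₁ T₂ T : ℕ} (hp : DExec P p σ σ' T₁) (hq : Exec P q σ' μ T₂)
    (hT : 1 + T₁ + T₂ ≤ T) : Exec P (.seq p q) σ μ T := by
  have := Exec.seq (ν := fun _ => μ) hp (q := q) (T₂ := T₂) (T := T) (fun τ hτ => by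
    rw [PMF.support_pure, Set.mem_singleton_iff] at hτ
    rwa [hτ]) hT
  rwa [PMF.pure_bind] at this

theorem exec_ite_true {P : Program} {r : ℕ} {p q : Cmd} {σ : State} {μ : PMF State} {T U : ℕ}
    (hr : σ.reg r ≠ 0) (hp : Exec P p σ μ T) (hT : 1 + (σ.reg r).size + T ≤ U) :
    Exec P (.ite r p q) σ μ U := by
  intro α f K t T' ξ hξ
  refine Reaches.step_pure (c' := ⟨p :: K, σ, t + (1 + (σ.reg r).size)⟩) ?_ ?_
  · simp [step, hr]
  · exact hp α f K _ T' ξ fun σ' hσ' t' ht' => hξ σ' hσ' t' (by omega)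

theorem exec_ite_false {P : Program} {r : ℕ} {p q : Cmd} {σ : State} {μ : PMF State} {T U : ℕ}
    (hr : σ.reg r = 0) (hq : Exec P q σ μ T) (hT : 1 + T ≤ U) :
    Exec P (.ite r p q) σ μ U := by
  intro α f K t T' ξ hξ
  refine Reaches.step_pure (c' := ⟨q :: K, σ, t + (1 + (σ.reg r).size)⟩) ?_ ?_
  · simp [step, hr]
  · refine hq α f K _ T' ξ fun σ' hσ' t' ht' => hξ σ' hσ' t' ?_
    rw [hr, Nat.size_zero] at ht'
    omega

theorem exec_loop_stop {P : Program} {r : ℕ} {p : Cmd} {σ : State} (hr : σ.reg r = 0) :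
    DExec P (.loop r p) σ σ 1 :=
  DExec.of_step fun K t => by simp [step, hr]

theorem exec_loop_step {P : Program} {r : ℕ} {p : Cmd} {σ : State} {μ : PMF State}
    {ν : State → PMF State} {T₁ T₂ T : ℕ} (hr : σ.reg r ≠ 0) (hp : Exec P p σ μ T₁)
    (hq : ∀ σ' ∈ μ.support, Exec P (.loop r p) σ' (ν σ') T₂)
    (hT : 1 + (σ.reg r).size + T₁ + T₂ ≤ T) : Exec P (.loop r p) σ (μ.bind ν) T := by
  intro α f K t T' ξ hξ
  rw [PMF.bind_bind]
  refine Reaches.step_pure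
    (c' := ⟨p :: .loop r p :: K, σ, t + (1 + (σ.reg r).size)⟩) (by simp [step, hr]) ?_
  refine hp α f _ _ T' _ fun σ' hσ' t' ht' => ?_
  refine hq σ' hσ' α f K t' T' ξ fun σ'' hσ'' t'' ht'' => ?_
  refine hξ σ'' ?_ t'' (by omega)
  rw [PMF.mem_support_bind_iff]
  exact ⟨σ', hσ', hσ''⟩

theorem exec_call {P : Program} {i : ℕ} {σ : State} {μ : PMF State} {T U : ℕ}
    (h : Exec P (P.procs.getD i .skip) σ μ T) (hT : 1 + T ≤ U) : Exec P (.call i) σ μ U := by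
  intro α f K t T' ξ hξ
  refine Reaches.step_pure (c' := ⟨P.procs.getD i .skip :: K, σ, t + 1⟩) rfl ?_
  exact h α f K _ T' ξ fun σ' hσ' t' ht' => hξ σ' hσ' t' (by omega)

/-- A loop that passes deterministically through the states `F 0, …, F n`. -/
theorem exec_loop {P : Program} {r : ℕ} {p : Cmd} {T L : ℕ} (n : ℕ) (F : ℕ → State)
    (hF : ∀ k < n, (F k).reg r ≠ 0 ∧ ((F k).reg r).size ≤ L ∧ DExec P p (F k) (F (k + 1)) T)
    (hn : (F n).reg r = 0) : DExec P (.loop r p) (F 0) (F n) (1 + n * (1 + L + T)) := by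
  induction n generalizing F with
  | zero => exact (exec_loop_stop hn).mono (by omega)
  | succ n ih =>
    have h₀ := hF 0 (Nat.succ_pos n)
    have h₁ := ih (fun k => F (k + 1)) (fun k hk => hF (k + 1) (by omega)) hn
    have := exec_loop_step (ν := fun _ => PMF.pure (F (n + 1))) (T₂ := 1 + n * (1 + L + T))
      (T := 1 + (n + 1) * (1 + L + T)) h₀.1 h₀.2.2 (fun τ hτ => by
        rw [PMF.support_pure, Set.mem_singleton_iff] at hτ
        rw [hτ]
        exact h₁) (by have := h₀.2.1; ring_nf; omega)
    rwa [PMF.pure_bind] at this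

/-! ### Expressions -/

/-- Arithmetic expressions over registers and arrays. -/
inductive Ex where
  | reg (r : ℕ)
  | lit (n : ℕ)
  | bin (o : Op) (e₁ e₂ : Ex)
  | get (k : ℕ) (e : Ex)

namespace Ex

/-- The value of an expression. -/
def ev : Ex → State → ℕ
  | .reg r, σ => σ.reg r
  | .lit n, _ => n
  | .bin o e₁ e₂, σ => o.eval (e₁.ev σ) (e₂.ev σ)
  | .get k e, σ => σ.mem k (e.ev σ)

/-- The number of nodes. -/
def nodes : Ex → ℕ
  | .reg _ => 1
  | .lit _ => 1
  | .bin _ e₁ e₂ => e₁.nodes + e₂.nodes + 1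
  | .get _ e => e.nodes + 1

/-- All registers that occur are below `20`; the others serve as scratch space. -/
def Wf : Ex → Prop
  | .reg r => r < 20
  | .lit _ => True
  | .bin _ e₁ e₂ => e₁.Wf ∧ e₂.Wf
  | .get _ e => e.Wf

/-- All values met in the evaluation have at most `L` binary digits. -/
def Fits : Ex → State → ℕ → Prop
  | .reg r, σ, L => σ.reg r < 2 ^ L
  | .lit n, _, L => n < 2 ^ L
  | .bin o e₁ e₂, σ, L => e₁.Fits σ L ∧ e₂.Fits σ L ∧ o.eval (e₁.ev σ) (e₂.ev σ) < 2 ^ L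
  | .get k e, σ, L => e.Fits σ L ∧ σ.mem k (e.ev σ) < 2 ^ L

theorem Fits.lt {e : Ex} {σ : State} {L : ℕ} (h : e.Fits σ L) : e.ev σ < 2 ^ L := by
  cases e with
  | reg r => exact h
  | lit n => exact h
  | bin o e₁ e₂ => exact h.2.2
  | get k e => exact h.2

theorem ev_setReg {e : Ex} (he : e.Wf) (σ : State) {t : ℕ} (ht : 20 ≤ t) (v : ℕ) :
    e.ev (σ.setReg t v) = e.ev σ := by
  induction e with
  | reg r =>
    have : r ≠ t := by have : r < 20 := he; omega
    simp [ev, State.setReg, this]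
  | lit n => rfl
  | bin o e₁ e₂ ih₁ ih₂ => simp [ev, ih₁ he.1, ih₂ he.2]
  | get k e ih => rw [ev, ih he, ev]; rfl

theorem fits_setReg {e : Ex} (he : e.Wf) {σ : State} {L t : ℕ} (ht : 20 ≤ t) (v : ℕ) :
    e.Fits (σ.setReg t v) L ↔ e.Fits σ L := by
  induction e with
  | reg r =>
    have : r ≠ t := by have : r < 20 := he; omega
    simp [Fits, State.setReg, this]
  | lit n => rfl
  | bin o e₁ e₂ ih₁ ih₂ =>
    simp only [Fits, ih₁ he.1, ih₂ he.2, ev_setReg he.1 _ ht, ev_setReg he.2 _ ht]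
  | get k e ih =>
    rw [Fits, Fits, ih he, ev_setReg (e := e) he σ ht]
    rfl

/-- Code that leaves the value of an expression in register `t`. -/
def code : Ex → ℕ → Cmd
  | .reg r, t => .seq (.const t 0) (.op .add t r t)
  | .lit n, t => .const t n
  | .bin o e₁ e₂, t =>
      .seq (e₁.code t) (.seq (e₂.code (t + 1)) (.seq (.op o t t (t + 1)) (.const (t + 1) 0)))
  | .get k e, t => .seq (e.code t) (.load t k t)

end Ex

/-- The scratch registers hold zeros. -/
def Clean (σ : State) : Prop := ∀ j, 20 ≤ j → σ.reg j = 0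

theorem one_add_mul_le {a b L : ℕ} (ha : a ≤ L) (hb : b ≤ L) :
    (1 + a) * (1 + b) ≤ (1 + L) ^ 2 := by
  rw [sq]
  exact Nat.mul_le_mul (by omega) (by omega)

theorem size_le_of_lt {n L : ℕ} (h : n < 2 ^ L) : n.size ≤ L := Nat.size_le.2 h

/-- The registers from `t` on act as an evaluation stack. The second operand is erased after use, so
the final state is exactly `σ` with register `t` changed; such equalities of states are what make
the later rules compose. The square of the word length is the schoolbook cost per node. -/
theorem Ex.exec_code (P : Program) (e : Ex) (he : e.Wf) (L : ℕ) :
    ∀ (t : ℕ) (_ : 20 ≤ t) (σ : State) (_ : ∀ j, t < j → σ.reg j = 0) (_ : e.Fits σ L),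
      DExec P (e.code t) σ (σ.setReg t (e.ev σ)) (6 * e.nodes * (1 + L) ^ 2) := by
  have hL : 1 + L ≤ (1 + L) ^ 2 := by nlinarith
  induction e with
  | reg r =>
    intro t ht σ hσ hf
    have hr : r ≠ t := by have : r < 20 := he; omega
    have h := (exec_const P σ t 0).then (exec_op P (σ.setReg t 0) .add t r t) le_rfl
    have hs : (σ.setReg t 0).setReg t (Op.add.eval ((σ.setReg t 0).reg r) ((σ.setReg t 0).reg t)) =
        σ.setReg t ((Ex.reg r).ev σ) := by
      simp [State.setReg, Op.eval, Ex.ev, hr]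
    rw [hs] at h
    refine h.mono ?_
    have : (σ.reg r).size ≤ L := size_le_of_lt hf
    simp only [State.setReg, Function.update_self, ne_eq, hr, not_false_eq_true,
      Function.update_of_ne, Nat.size_zero, Ex.nodes]
    omega
  | lit n =>
    intro t ht σ hσ hf
    refine (exec_const P σ t n).mono ?_
    have : n.size ≤ L := size_le_of_lt hf
    simp only [Ex.nodes]
    omega
  | bin o e₁ e₂ ih₁ ih₂ =>
    intro t ht σ hσ hf
    obtain ⟨hf₁, hf₂, hf₃⟩ := hf
    have h₁ := ih₁ he.1 t ht σ hσ hf₁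
    have h₂ := ih₂ he.2 (t + 1) (by omega) (σ.setReg t (e₁.ev σ)) (fun j hj => by
      simp only [State.setReg]
      rw [Function.update_of_ne (by omega)]
      exact hσ j (by omega)) ((Ex.fits_setReg he.2 ht _).2 hf₂)
    rw [Ex.ev_setReg he.2 _ ht] at h₂
    have h₃ := h₁.then (h₂.then ((exec_op P _ o t t (t + 1)).then
      (exec_const P _ (t + 1) 0) le_rfl) le_rfl) le_rfl
    have hs : ∀ v, (((σ.setReg t (e₁.ev σ)).setReg (t + 1) (e₂.ev σ)).setReg t v).setReg (t + 1) 0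
        = σ.setReg t v := by
      intro v
      simp only [State.setReg, State.mk.injEq, and_true]
      funext j
      have := hσ (t + 1) (by omega)
      by_cases h1 : j = t + 1
      · subst h1; simp [this]
      · by_cases h2 : j = t
        · subst h2; simp
        · simp [h1, h2]
    rw [hs] at h₃
    simp only [State.setReg, Function.update_self, ne_eq, Nat.left_eq_add, one_ne_zero,
      not_false_eq_true, Function.update_of_ne, Nat.size_zero] at h₃
    refine h₃.mono ?_
    have := one_add_mul_le (size_le_of_lt hf₁.lt) (size_le_of_lt hf₂.lt)
    simp only [Ex.nodes]
    nlinarith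
  | get k e ih =>
    intro t ht σ hσ hf
    have h₁ := ih he t ht σ hσ hf.1
    have h₂ := h₁.then (exec_load P _ t k t) le_rfl
    simp only [State.setReg, Function.update_self, Function.update_idem] at h₂
    refine Exec.mono h₂ ?_
    have h₃ := size_le_of_lt hf.1.lt
    have h₄ := size_le_of_lt hf.2
    simp only [Ex.nodes]
    nlinarith

/-- `reg r := e` -/
def assign (r : ℕ) (e : Ex) : Cmd :=
  .seq (e.code 20) (.seq (.const r 0) (.seq (.op .add r r 20) (.const 20 0)))

/-- `array k [e₁] := e₂` -/
def put (k : ℕ) (e₁ e₂ : Ex) : Cmd :=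
  .seq (e₁.code 20) (.seq (e₂.code 21) (.seq (.store k 20 21) (.seq (.const 20 0) (.const 21 0))))

/-- The value is complete in scratch register 20 before `r` is cleared, so `e` may mention `r`, as
it does when a counter is decreased. -/
theorem exec_assign (P : Program) {r L : ℕ} {e : Ex} {σ : State} (hr : r < 20) (he : e.Wf)
    (hσ : Clean σ) (hf : e.Fits σ L) :
    DExec P (assign r e) σ (σ.setReg r (e.ev σ)) (6 * (e.nodes + 1) * (1 + L) ^ 2) := by
  have h₁ := Ex.exec_code P e he L 20 le_rfl σ (fun j hj => hσ j (by omega)) hf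
  have h₂ := h₁.then ((exec_const P _ r 0).then ((exec_op P _ .add r r 20).then
    (exec_const P _ 20 0) le_rfl) le_rfl) le_rfl
  have h20 : (20 : ℕ) ≠ r := by omega
  have hs : ∀ v, (((σ.setReg 20 v).setReg r 0).setReg r v).setReg 20 0 = σ.setReg r v := by
    intro v
    simp only [State.setReg, State.mk.injEq, and_true]
    funext j
    by_cases h1 : j = 20
    · subst h1; simp [h20, hσ 20 le_rfl]
    · by_cases h2 : j = r
      · subst h2; simp [h20.symm]
      · simp [h1, h2]
  simp only [Op.eval] at h₂
  have hv : ((σ.setReg 20 (e.ev σ)).setReg r 0).reg r + ((σ.setReg 20 (e.ev σ)).setReg r 0).reg 20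
      = e.ev σ := by
    simp [State.setReg, h20]
  rw [hv, hs] at h₂
  refine h₂.mono ?_
  have := size_le_of_lt hf.lt
  simp [State.setReg, h20]
  nlinarith

theorem exec_put (P : Program) {k L : ℕ} {e₁ e₂ : Ex} {σ : State} (he₁ : e₁.Wf) (he₂ : e₂.Wf)
    (hσ : Clean σ) (hf₁ : e₁.Fits σ L) (hf₂ : e₂.Fits σ L) :
    DExec P (put k e₁ e₂) σ (σ.setMem k (e₁.ev σ) (e₂.ev σ))
      (6 * (e₁.nodes + e₂.nodes + 2) * (1 + L) ^ 2) := by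
  have h₁ := Ex.exec_code P e₁ he₁ L 20 le_rfl σ (fun j hj => hσ j (by omega)) hf₁
  have h₂ := Ex.exec_code P e₂ he₂ L 21 (by omega) (σ.setReg 20 (e₁.ev σ)) (fun j hj => by
      simp only [State.setReg]
      rw [Function.update_of_ne (by omega)]
      exact hσ j (by omega)) ((Ex.fits_setReg he₂ le_rfl _).2 hf₂)
  rw [Ex.ev_setReg he₂ _ le_rfl] at h₂
  have h₃ := h₁.then (h₂.then ((exec_store P _ k 20 21).then
    ((exec_const P _ 20 0).then (exec_const P _ 21 0) le_rfl) le_rfl) le_rfl) le_rfl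
  have hs : ∀ v w, ((((σ.setReg 20 v).setReg 21 w).setMem k v w).setReg 20 0).setReg 21 0 =
      σ.setMem k v w := by
    intro v w
    simp only [State.setReg, State.setMem, State.mk.injEq, and_true]
    funext j
    by_cases h1 : j = 20
    · subst h1; simp [hσ 20 le_rfl]
    · by_cases h2 : j = 21
      · subst h2; simp [hσ 21 (by omega)]
      · simp [h1, h2]
  have hv : ∀ v w, ((σ.setReg 20 v).setReg 21 w).reg 20 = v := by intros; simp [State.setReg]
  have hw : ∀ v w, ((σ.setReg 20 v).setReg 21 w).reg 21 = w := by intros; simp [State.setReg]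
  rw [hv, hw, hs] at h₃
  refine h₃.mono ?_
  have := size_le_of_lt hf₁.lt
  have := size_le_of_lt hf₂.lt
  simp only [Nat.size_zero]
  nlinarith

end BitRAM

namespace BitRAM

/-! ### Loops over arrays -/

/-- Replace the contents of array `k`. -/
def State.withMem (σ : State) (k : ℕ) (g : ℕ → ℕ) : State :=
  { σ with mem := Function.update σ.mem k g }

/-- Execute `p` for `i = n - 1, …, 0`, where `n` is the value of `e`. -/
def down (i : ℕ) (e : Ex) (p : Cmd) : Cmd :=
  .seq (assign i e) (.loop i (.seq (assign i (.bin .sub (.reg i) (.lit 1))) p))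

/-- Set `array k [ea] := ee` for `i = n - 1, …, 0`, where `n` is the value of `e`. -/
def sweep (i : ℕ) (e : Ex) (k : ℕ) (ea ee : Ex) : Cmd := down i e (put k ea ee)

/-- The constant in the cost of a sweep. -/
def sweepCost (e ea ee : Ex) : ℕ := 6 * (e.nodes + ea.nodes + ee.nodes + 8)

theorem Clean.setReg {σ : State} (h : Clean σ) {r : ℕ} (hr : r < 20) (v : ℕ) :
    Clean (σ.setReg r v) := fun j hj => by
  simp only [State.setReg]
  rw [Function.update_of_ne (by omega)]
  exact h j hj

theorem Clean.withMem {σ : State} (h : Clean σ) (k : ℕ) (g : ℕ → ℕ) : Clean (σ.withMem k g) := h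

theorem Clean.of_reg_eq {σ τ : State} (h : Clean σ) (hr : τ.reg = σ.reg) : Clean τ :=
  fun j hj => by rw [hr]; exact h j hj

theorem exec_decr (P : Program) {i L n : ℕ} {σ : State} (hi : i < 20) (hσ : Clean σ)
    (hn : σ.reg i = n + 1) (hL : n + 1 < 2 ^ L) :
    DExec P (assign i (.bin .sub (.reg i) (.lit 1))) σ (σ.setReg i n) (24 * (1 + L) ^ 2) := by
  have h := exec_assign P (e := .bin .sub (.reg i) (.lit 1)) (L := L) hi ⟨hi, trivial⟩ hσ
    ⟨by simpa [Ex.Fits, hn] using hL, by simp only [Ex.Fits]; omega, by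
      simp only [Ex.ev, Op.eval, hn]; omega⟩
  simpa [Ex.ev, Op.eval, hn, Ex.nodes] using h

/-- The invariant rule for a downward loop: `Inv j g` describes the contents `g` of the array once
the indices from `j` on have been treated. Counting down returns the counter to 0, so the final
state differs from `σ` in one array only. -/
theorem exec_sweep (P : Program) {i k L : ℕ} {e ea ee : Ex} {σ : State} (hi : i < 20)
    (he : e.Wf) (hea : ea.Wf) (hee : ee.Wf) (hσ : Clean σ) (h0 : σ.reg i = 0) (hf : e.Fits σ L)
    (Inv : ℕ → (ℕ → ℕ) → Prop) (hInv : Inv (e.ev σ) (σ.mem k))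
    (hstep : ∀ j < e.ev σ, ∀ g, Inv (j + 1) g →
      ea.Fits ((σ.setReg i j).withMem k g) L ∧ ee.Fits ((σ.setReg i j).withMem k g) L ∧
      Inv j (Function.update g (ea.ev ((σ.setReg i j).withMem k g))
        (ee.ev ((σ.setReg i j).withMem k g)))) :
    ∃ g, Inv 0 g ∧ DExec P (sweep i e k ea ee) σ (σ.withMem k g)
      (sweepCost e ea ee * (e.ev σ + 1) * (1 + L) ^ 2) := by
  have hL : 1 + L ≤ (1 + L) ^ 2 := by nlinarith
  have key : ∀ n ≤ e.ev σ, ∀ g, Inv n g → ∃ g', Inv 0 g' ∧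
      DExec P (.loop i (.seq (assign i (.bin .sub (.reg i) (.lit 1))) (put k ea ee)))
        ((σ.setReg i n).withMem k g) (σ.withMem k g')
        (1 + n * (6 * (ea.nodes + ee.nodes + 7) * (1 + L) ^ 2)) := by
    intro n
    induction n with
    | zero =>
      intro _ g hg
      refine ⟨g, hg, ?_⟩
      have : σ.setReg i 0 = σ := by
        simp [State.setReg, ← h0]
      rw [this]
      exact (exec_loop_stop (by simpa [State.withMem] using h0)).mono (by omega)
    | succ n ih =>
      intro hn g hg
      obtain ⟨hf₁, hf₂, hI⟩ := hstep n (by omega) g hg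
      obtain ⟨g', hg', h'⟩ := ih (by omega) _ hI
      refine ⟨g', hg', ?_⟩
      have hlt : n + 1 < 2 ^ L := lt_of_le_of_lt hn hf.lt
      have h₁ := exec_decr P (σ := (σ.setReg i (n + 1)).withMem k g) (n := n) hi
        ((hσ.setReg hi _).withMem k g) (by simp [State.withMem, State.setReg]) hlt
      have hs : ((σ.setReg i (n + 1)).withMem k g).setReg i n = (σ.setReg i n).withMem k g := by
        simp [State.withMem, State.setReg]
      rw [hs] at h₁
      have h₂ := exec_put P (k := k) hea hee ((hσ.setReg hi n).withMem k g) hf₁ hf₂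
      have hs₂ : ∀ a v, ((σ.setReg i n).withMem k g).setMem k a v =
          (σ.setReg i n).withMem k (Function.update g a v) := by
        intro a v
        simp [State.withMem, State.setMem]
      rw [hs₂] at h₂
      have h₃ := exec_loop_step (r := i) (ν := fun _ => PMF.pure (σ.withMem k g'))
        (T₂ := 1 + n * (6 * (ea.nodes + ee.nodes + 7) * (1 + L) ^ 2))
        (T := 1 + (n + 1) * (6 * (ea.nodes + ee.nodes + 7) * (1 + L) ^ 2))
        (by simp [State.withMem, State.setReg]) (h₁.then h₂ le_rfl) (fun τ hτ => by
          rw [PMF.support_pure, Set.mem_singleton_iff] at hτ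
          rw [hτ]
          exact h') (by
        have : (n + 1).size ≤ L := size_le_of_lt hlt
        simp only [State.withMem, State.setReg, Function.update_self]
        nlinarith)
      rwa [PMF.pure_bind] at h₃
  obtain ⟨g, hg, h⟩ := key _ le_rfl _ hInv
  refine ⟨g, hg, ?_⟩
  have h₁ := exec_assign P hi he hσ hf
  have hs : (σ.setReg i (e.ev σ)).withMem k (σ.mem k) = σ.setReg i (e.ev σ) := by
    simp [State.withMem, State.setReg]
  rw [hs] at h
  refine h₁.then h ?_
  simp only [sweepCost]
  nlinarith [Nat.zero_le (e.nodes * (e.ev σ) * (1 + L) ^ 2),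
    Nat.zero_le ((e.ev σ) * (1 + L) ^ 2),
    Nat.zero_le (ea.nodes * (1 + L) ^ 2), Nat.zero_le (ee.nodes * (1 + L) ^ 2)]

/-- A sweep whose addresses are distinct, and whose values do not depend on the cells written. -/
theorem exec_fill (P : Program) {i k L n : ℕ} {e ea ee : Ex} {σ : State} (hi : i < 20)
    (he : e.Wf) (hea : ea.Wf) (hee : ee.Wf) (hσ : Clean σ) (h0 : σ.reg i = 0) (hf : e.Fits σ L)
    (hn : e.ev σ = n) (A v : ℕ → ℕ) (hA : ∀ j < n, ∀ j' < n, A j = A j' → j = j')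
    (hstep : ∀ j < n, ∀ g : ℕ → ℕ, (∀ a, (∀ j' < n, A j' ≠ a) → g a = σ.mem k a) →
      ea.Fits ((σ.setReg i j).withMem k g) L ∧ ee.Fits ((σ.setReg i j).withMem k g) L ∧
      ea.ev ((σ.setReg i j).withMem k g) = A j ∧ ee.ev ((σ.setReg i j).withMem k g) = v j) :
    ∃ σ', DExec P (sweep i e k ea ee) σ σ' (sweepCost e ea ee * (n + 1) * (1 + L) ^ 2) ∧
      σ'.reg = σ.reg ∧ (∀ k' ≠ k, σ'.mem k' = σ.mem k') ∧
      (∀ j < n, σ'.mem k (A j) = v j) ∧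
      (∀ a, (∀ j < n, A j ≠ a) → σ'.mem k a = σ.mem k a) := by
  subst hn
  obtain ⟨g, hg, h⟩ := exec_sweep P (k := k) hi he hea hee hσ h0 hf
    -- The second clause, that cells off the range of `A` are untouched, is exactly what `hstep` may
    -- assume when the expressions read from the array being written.
    (fun j g => (∀ j', j ≤ j' → j' < e.ev σ → g (A j') = v j') ∧
      ∀ a, (∀ j' < e.ev σ, A j' ≠ a) → g a = σ.mem k a)
    ⟨fun j' h₁ h₂ => by omega, fun a _ => rfl⟩ (by
      intro j hj g hg
      obtain ⟨h₁, h₂, h₃, h₄⟩ := hstep j hj g hg.2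
      refine ⟨h₁, h₂, ?_, ?_⟩
      · intro j' hj' hj''
        rw [h₃, h₄]
        rcases eq_or_ne j' j with rfl | hne
        · simp
        · rw [Function.update_of_ne (fun h => hne (hA j' hj'' j hj h))]
          exact hg.1 j' (by omega) hj''
      · intro a ha
        rw [h₃, Function.update_of_ne (ha j hj).symm]
        exact hg.2 a ha)
  refine ⟨_, h, rfl, ?_, ?_, ?_⟩
  · intro k' hk'
    simp [State.withMem, hk']
  · intro j hj
    simpa [State.withMem] using hg.1 j (Nat.zero_le _) hj
  · intro a ha
    simpa [State.withMem] using hg.2 a ha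

/-! ### Random arrays -/

theorem uniform_bind_map {α β γ : Type*} [Fintype α] [Nonempty α] [Fintype β] [Nonempty β]
    (g : α → β → γ) :
    ((PMF.uniformOfFintype α).bind fun a => (PMF.uniformOfFintype β).map (g a)) =
      (PMF.uniformOfFintype (α × β)).map fun p => g p.1 p.2 := by
  classical
  ext c
  simp only [PMF.bind_apply, PMF.map_apply, PMF.uniformOfFintype_apply, tsum_fintype,
    Fintype.sum_prod_type, Finset.mul_sum, Fintype.card_prod]
  refine Finset.sum_congr rfl fun a _ => Finset.sum_congr rfl fun b _ => ?_
  split_ifs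
  · rw [Nat.cast_mul, ENNReal.mul_inv (by simp) (by simp)]
  · simp

theorem uniform_map_equiv {α β γ : Type*} [Fintype α] [Nonempty α] [Fintype β] [Nonempty β]
    (e : α ≃ β) (f : β → γ) :
    (PMF.uniformOfFintype α).map (fun a => f (e a)) = (PMF.uniformOfFintype β).map f := by
  classical
  ext c
  simp only [PMF.map_apply, PMF.uniformOfFintype_apply, tsum_fintype, Fintype.card_congr e]
  exact Equiv.sum_comp e fun b => if c = f b then ((Fintype.card β : ENNReal))⁻¹ else 0

theorem uniformBelow_eq (d : ℕ) [NeZero d] :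
    uniformBelow d = (PMF.uniformOfFintype (Fin d)).map Fin.val := by
  cases d with
  | zero => exact absurd rfl (NeZero.ne 0)
  | succ d => rfl

/-- Fill `array k` with random numbers below `reg b`, for `i = n - 1, …, 0`, where `n` is the value
of `e`. -/
def randFill (i : ℕ) (e : Ex) (r k b : ℕ) : Cmd :=
  down i e (.seq (.rand r b) (.seq (put k (.reg i) (.reg r)) (.const r 0)))

/-- The contents of an array after its first `n` cells have been replaced. -/
def overlay {n d : ℕ} (v : Fin n → Fin d) (g : ℕ → ℕ) : ℕ → ℕ :=
  fun a => if h : a < n then v ⟨a, h⟩ else g a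

/-- Induction on the number of cells still to be filled. The last cell is drawn first, and
`Fin.snocEquiv` turns an independent pair (last value, remaining values) into a uniform function.
Clearing `r` after each draw keeps the drawn number from leaving a trace outside the array. -/
theorem exec_randFill (P : Program) {i r k b L d n : ℕ} [NeZero d] {e : Ex} {σ : State}
    (hi : i < 20) (hr : r < 20) (hir : i ≠ r) (hbi : b ≠ i)
    (he : e.Wf) (hσ : Clean σ) (h0 : σ.reg i = 0) (hr0 : σ.reg r = 0) (hb : σ.reg b = d)
    (hd : d < 2 ^ L) (hf : e.Fits σ L) (hn : e.ev σ = n) :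
    Exec P (randFill i e r k b) σ ((PMF.uniformOfFintype (Fin n → Fin d)).map fun v =>
      σ.withMem k (overlay v (σ.mem k))) ((6 * (e.nodes + 12)) * (n + 1) * (1 + L) ^ 2) := by
  subst hn
  have hL : 1 + L ≤ (1 + L) ^ 2 := by nlinarith
  have key : ∀ n ≤ e.ev σ, ∀ g,
      Exec P (.loop i (.seq (assign i (.bin .sub (.reg i) (.lit 1)))
        (.seq (.rand r b) (.seq (put k (.reg i) (.reg r)) (.const r 0)))))
        ((σ.setReg i n).withMem k g)
        ((PMF.uniformOfFintype (Fin n → Fin d)).map fun v => σ.withMem k (overlay v g))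
        (1 + n * (66 * (1 + L) ^ 2)) := by
    intro n
    induction n with
    | zero =>
      intro _ g
      have h₁ : σ.setReg i 0 = σ := by simp [State.setReg, ← h0]
      have h₂ : ∀ v : Fin 0 → Fin d, overlay v g = g := fun v => by
        funext a
        simp [overlay]
      simp only [h₁, h₂]
      rw [show (fun _ : Fin 0 → Fin d => σ.withMem k g) = Function.const _ (σ.withMem k g) from rfl,
        PMF.map_const]
      exact (exec_loop_stop (by simpa [State.withMem] using h0)).mono (by omega)
    | succ n ih =>
      intro hn g
      have hlt : n + 1 < 2 ^ L := lt_of_le_of_lt hn hf.lt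
      have h₁ := exec_decr P (σ := (σ.setReg i (n + 1)).withMem k g) (n := n) hi
        ((hσ.setReg hi _).withMem k g) (by simp [State.withMem, State.setReg]) hlt
      have hs : ((σ.setReg i (n + 1)).withMem k g).setReg i n = (σ.setReg i n).withMem k g := by
        simp [State.withMem, State.setReg]
      rw [hs] at h₁
      have h₂ := exec_rand P ((σ.setReg i n).withMem k g) r b
      have hbv : ((σ.setReg i n).withMem k g).reg b = d := by
        simp [State.withMem, State.setReg, hbi, hb]
      rw [hbv] at h₂
      have h₃ := Exec.seq (q := .seq (put k (.reg i) (.reg r)) (.const r 0))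
        (ν := fun τ => PMF.pure ((τ.setMem k (τ.reg i) (τ.reg r)).setReg r 0))
        (T₂ := 1 + 24 * (1 + L) ^ 2 + (1 + L)) h₂ (by
          intro τ hτ
          rw [PMF.support_map] at hτ
          obtain ⟨v, hv, rfl⟩ := hτ
          have hv : v < d := by
            rw [uniformBelow_eq, PMF.support_map] at hv
            obtain ⟨w, _, rfl⟩ := hv
            exact w.2
          have hfi : Ex.Fits (.reg i) ((((σ.setReg i n).withMem k g)).setReg r v) L := by
            simp only [Ex.Fits, State.setReg, State.withMem]
            rw [Function.update_of_ne hir, Function.update_self]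
            omega
          have hfr : Ex.Fits (.reg r) ((((σ.setReg i n).withMem k g)).setReg r v) L := by
            simp only [Ex.Fits, State.setReg, State.withMem]
            rw [Function.update_self]
            omega
          exact (exec_put P (k := k) (e₁ := .reg i) (e₂ := .reg r) hi hr
            (((hσ.setReg hi n).withMem k g).setReg hr v) hfi hfr).then
              (exec_const P _ r 0) (by simp only [Ex.nodes, Nat.size_zero]; omega)) le_rfl
      have h₄ := exec_loop_step (r := i)
        (ν := fun τ => (PMF.uniformOfFintype (Fin n → Fin d)).map fun v =>
          σ.withMem k (overlay v (τ.mem k)))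
        (T₂ := 1 + n * (66 * (1 + L) ^ 2)) (T := 1 + (n + 1) * (66 * (1 + L) ^ 2))
        (by simp [State.withMem, State.setReg]) (h₁.then h₃ le_rfl) (fun τ hτ => by
          rw [PMF.bind_map, PMF.mem_support_bind_iff] at hτ
          obtain ⟨v, _, hv⟩ := hτ
          simp only [Function.comp_apply, PMF.support_pure, Set.mem_singleton_iff] at hv
          have hτ' : τ = (σ.setReg i n).withMem k (Function.update g n v) := by
            rw [hv]
            simp only [State.withMem, State.setReg, State.setMem, State.mk.injEq]
            constructor
            · funext j
              by_cases hj : j = r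
              · subst hj; simp [hir.symm, hr0]
              · simp [hj]
            · simp [hir]
          have hm : τ.mem k = Function.update g n v := by
            rw [hτ']; simp [State.withMem]
          simp only [hm]
          rw [hτ']
          exact ih (by omega) _) (by
        have h5 : (n + 1).size ≤ L := size_le_of_lt hlt
        have h6 : d.size ≤ L := size_le_of_lt hd
        simp only [State.withMem, State.setReg, Function.update_self]
        nlinarith)
      refine (Eq.subst (motive := fun μ => Exec P _ _ μ _) ?_ h₄)
      rw [PMF.bind_map, PMF.bind_bind, uniformBelow_eq, PMF.bind_map]
      simp only [Function.comp_def, PMF.pure_bind]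
      rw [uniform_bind_map (α := Fin d) (β := Fin n → Fin d),
        ← uniform_map_equiv (Fin.snocEquiv fun _ : Fin (n + 1) => Fin d)]
      congr 1
      funext p
      obtain ⟨v, w⟩ := p
      simp only [State.withMem, State.setReg, State.setMem]
      congr 2
      funext a
      simp only [overlay, Function.update_self, Fin.snocEquiv]
      rcases lt_trichotomy a n with h | h | h
      · have h' : a < n + 1 := by omega
        simp [h, h', Fin.snoc]
      · subst h
        simp [Fin.snoc, hir]
      · have h1 : ¬ a < n + 1 := by omega
        have h2 : ¬ a < n := by omega
        have h3 : a ≠ n := by omega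
        simp [h1, h2, h3, hir]
  have h₁ := exec_assign P hi he hσ hf
  have h₂ := key _ le_rfl (σ.mem k)
  have hs : (σ.setReg i (e.ev σ)).withMem k (σ.mem k) = σ.setReg i (e.ev σ) := by
    simp [State.withMem, State.setReg]
  rw [hs] at h₂
  refine h₁.then h₂ ?_
  nlinarith [Nat.zero_le (e.nodes * (e.ev σ) * (1 + L) ^ 2),
    Nat.zero_le ((e.ev σ) * (1 + L) ^ 2)]

end BitRAM

namespace BMM

/-! ## The recursion for the pseudo-product -/

/-- The number with a given binary expansion, leading digit first. -/
def bval : ∀ {s : ℕ}, Bits s → ℕ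
  | 0, _ => 0
  | s + 1, x => (x 0).toNat * 2 ^ s + bval (Fin.tail x)

theorem bval_cons {s : ℕ} (a : Bool) (x : Bits s) :
    bval (Fin.cons a x : Bits (s + 1)) = a.toNat * 2 ^ s + bval x := by
  simp [bval, Fin.tail_cons]

theorem bval_lt {s : ℕ} (x : Bits s) : bval x < 2 ^ s := by
  induction s with
  | zero => simp [bval]
  | succ s ih =>
    have h₁ := ih (Fin.tail x)
    have h₂ : (x 0).toNat * 2 ^ s ≤ 1 * 2 ^ s := Nat.mul_le_mul_right _ (Bool.toNat_le _)
    rw [bval, pow_succ]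
    omega

theorem bval_injective {s : ℕ} : Function.Injective (bval (s := s)) := by
  induction s with
  | zero => exact fun x y _ => Subsingleton.elim x y
  | succ s ih =>
    intro x y h
    rw [bval, bval] at h
    have hx := bval_lt (Fin.tail x)
    have hy := bval_lt (Fin.tail y)
    have h₀ : x 0 = y 0 := by
      rcases hx0 : x 0 <;> rcases hy0 : y 0 <;> simp [hx0, hy0] at h ⊢ <;> omega
    rw [h₀] at h
    have h₁ : Fin.tail x = Fin.tail y := ih (by omega)
    rw [← Fin.cons_self_tail x, ← Fin.cons_self_tail y, h₀, h₁]

/-- Bit vectors are numbers below `2 ^ s`. -/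
noncomputable def bitsEquiv (s : ℕ) : Bits s ≃ Fin (2 ^ s) :=
  Equiv.ofBijective (fun x => ⟨bval x, bval_lt x⟩)
    ((Fintype.bijective_iff_injective_and_card _).2
      ⟨fun x y h => bval_injective (by simpa using h), by simp⟩)

theorem bitsEquiv_val {s : ℕ} (x : Bits s) : (bitsEquiv s x : ℕ) = bval x := rfl

theorem exists_bval_eq {s n : ℕ} (h : n < 2 ^ s) : ∃ x : Bits s, bval x = n :=
  ⟨(bitsEquiv s).symm ⟨n, h⟩, by rw [← bitsEquiv_val, Equiv.apply_symm_apply]⟩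

/-- The bits of a number. -/
noncomputable def bitsOf (s n : ℕ) : Bits s :=
  (bitsEquiv s).symm ⟨n % 2 ^ s, Nat.mod_lt _ (by positivity)⟩

theorem bval_bitsOf {s n : ℕ} (h : n < 2 ^ s) : bval (bitsOf s n) = n := by
  rw [bitsOf, ← bitsEquiv_val, Equiv.apply_symm_apply]
  exact Nat.mod_eq_of_lt h

theorem bitsOf_bval {s : ℕ} (x : Bits s) : bitsOf s (bval x) = x :=
  bval_injective (bval_bitsOf (bval_lt x))

/-- A quadrant of a matrix. -/
def quad {R : Type*} {s : ℕ} (A : Matrix (Bits (s + 1)) (Bits (s + 1)) R) (a b : Bool) :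
    Matrix (Bits s) (Bits s) R :=
  fun x z => A (Fin.cons a x) (Fin.cons b z)

theorem pseudoMul_cons {R : Type*} [NonUnitalNonAssocSemiring R] {s : ℕ}
    (A B : Matrix (Bits (s + 1)) (Bits (s + 1)) R) (a b : Bool) (x y : Bits s) :
    pseudoMul A B (Fin.cons a x) (Fin.cons b y) =
      ∑ q : Bool, if (a || b || q) = true then pseudoMul (quad A a q) (quad B q b) x y else 0 := by
  simp only [pseudoMul, Finset.sum_filter]
  rw [← (Fin.consEquiv fun _ : Fin (s + 1) => Bool).sum_comp, Fintype.sum_prod_type]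
  refine Finset.sum_congr rfl fun q _ => ?_
  split_ifs with h
  · refine Finset.sum_congr rfl fun z _ => ?_
    have : (∀ i, ((Fin.cons a x : Bits (s + 1)) i || (Fin.cons b y : Bits (s + 1)) i ||
        (Fin.cons q z : Bits (s + 1)) i) = true) ↔ ∀ i, (x i || y i || z i) = true := by
      rw [Fin.forall_fin_succ]
      simp only [Fin.cons_zero, Fin.cons_succ, h, true_and]
    simp only [Fin.consEquiv, Equiv.coe_fn_mk, this]
    rfl
  · refine Finset.sum_eq_zero fun z _ => if_neg fun h' => h ?_
    simpa [Fin.consEquiv] using h' 0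

/-- The linear combination of the quadrants with given coefficients. -/
def combine {s : ℕ} (u : Bool → Bool → ℕ) (A : Matrix (Bits (s + 1)) (Bits (s + 1)) (ZMod 2)) :
    Matrix (Bits s) (Bits s) (ZMod 2) :=
  fun x z => ∑ a : Bool, ∑ b : Bool, (u a b : ZMod 2) * quad A a b x z

theorem pseudoMul_combine {s : ℕ} (u v : Bool → Bool → ℕ)
    (A B : Matrix (Bits (s + 1)) (Bits (s + 1)) (ZMod 2)) (x y : Bits s) :
    pseudoMul (combine u A) (combine v B) x y =
      ∑ a : Bool, ∑ b : Bool, ∑ a' : Bool, ∑ b' : Bool, (u a b : ZMod 2) * (v a' b' : ZMod 2) *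
        pseudoMul (quad A a b) (quad B a' b') x y := by
  simp only [pseudoMul, combine, Finset.mul_sum, Fintype.sum_bool]
  simp only [← Finset.sum_add_distrib]
  refine Finset.sum_congr rfl fun z _ => ?_
  ring

/-- The coefficients of the left factors. -/
def coefA : ℕ → Bool → Bool → ℕ
  | 0, a, b => if !a && b then 1 else 0
  | 1, _, _ => 1
  | 2, a, b => if a && !b then 1 else 0
  | 3, a, _ => if a then 1 else 0
  | 4, a, b => if a || b then 1 else 0
  | _, _, b => if b then 1 else 0

/-- The coefficients of the right factors. -/
def coefB : ℕ → Bool → Bool → ℕ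
  | 0, a, b => if a && !b then 1 else 0
  | 1, a, b => if !a && b then 1 else 0
  | 2, _, _ => 1
  | 3, a, _ => if a then 1 else 0
  | 4, a, b => if a || b then 1 else 0
  | _, _, b => if b then 1 else 0

/-- The coefficients of the polynomials in the block indices with which the products enter the
result: constant term, first index, second index, product of the indices. -/
def coefC : ℕ → ℕ × ℕ × ℕ × ℕ
  | 0 => (1, 0, 0, 0)
  | 1 => (0, 0, 1, 1)
  | 2 => (0, 1, 0, 1)
  | 3 => (0, 0, 1, 0)
  | 4 => (0, 1, 1, 1)
  | _ => (0, 1, 0, 0)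

/-- The coefficient of the `j`-th product in block `(a, b)`. -/
def outCoef (j a b : ℕ) : ℕ :=
  (coefC j).1 + (coefC j).2.1 * a + (coefC j).2.2.1 * b + (coefC j).2.2.2 * (a * b)

/-- Block (0,0) is A₀₁B₁₀ alone, and the other three blocks are full two-term products: seven
multiplications if done directly. Modulo 2 the six products A₀₁B₁₀, (ΣA)B₀₁, A₁₀(ΣB),
(A₁₀+A₁₁)(B₁₀+B₁₁), (A₀₁+A₁₀+A₁₁)(B₀₁+B₁₀+B₁₁) and (A₀₁+A₁₁)(B₀₁+B₁₁) suffice. The output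
coefficients are polynomials in the block indices so that the machine evaluates them without
branching; only their parity matters. -/
theorem pseudoMul_eq_six {s : ℕ} (A B : Matrix (Bits (s + 1)) (Bits (s + 1)) (ZMod 2))
    (a b : Bool) (x y : Bits s) :
    pseudoMul A B (Fin.cons a x) (Fin.cons b y) =
      ∑ j ∈ Finset.range 6, (outCoef j a.toNat b.toNat : ZMod 2) *
        pseudoMul (combine (coefA j) A) (combine (coefB j) B) x y := by
  rw [pseudoMul_cons]
  simp only [pseudoMul_combine, Finset.sum_range_succ, Finset.sum_range_zero, Fintype.sum_bool]
  rcases a with _ | _ <;> rcases b with _ | _ <;>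
    simp only [coefA, coefB, outCoef, coefC] <;> simp <;> rw [← sub_eq_zero] <;> ring_nf <;>
    reduce_mod_char

end BMM

namespace BitRAM

instance : Add Ex := ⟨Ex.bin .add⟩
instance : Mul Ex := ⟨Ex.bin .mul⟩
instance : Div Ex := ⟨Ex.bin .div⟩
instance : Mod Ex := ⟨Ex.bin .mod⟩

namespace Ex

theorem ev_reg (r : ℕ) (σ : State) : (Ex.reg r).ev σ = σ.reg r := rfl
theorem ev_lit (n : ℕ) (σ : State) : (Ex.lit n).ev σ = n := rfl
theorem ev_get (k : ℕ) (e : Ex) (σ : State) : (Ex.get k e).ev σ = σ.mem k (e.ev σ) := rfl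
theorem ev_add (e f : Ex) (σ : State) : (e + f).ev σ = e.ev σ + f.ev σ := rfl
theorem ev_mul (e f : Ex) (σ : State) : (e * f).ev σ = e.ev σ * f.ev σ := rfl
theorem ev_div (e f : Ex) (σ : State) : (e / f).ev σ = e.ev σ / f.ev σ := rfl
theorem ev_mod (e f : Ex) (σ : State) : (e % f).ev σ = e.ev σ % f.ev σ := rfl

theorem fits_reg {r : ℕ} {σ : State} {L : ℕ} : (Ex.reg r).Fits σ L ↔ σ.reg r < 2 ^ L := Iff.rfl
theorem fits_lit {n : ℕ} {σ : State} {L : ℕ} : (Ex.lit n).Fits σ L ↔ n < 2 ^ L := Iff.rfl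
theorem fits_get {k : ℕ} {e : Ex} {σ : State} {L : ℕ} :
    (Ex.get k e).Fits σ L ↔ e.Fits σ L ∧ σ.mem k (e.ev σ) < 2 ^ L := Iff.rfl
theorem fits_add {e f : Ex} {σ : State} {L : ℕ} :
    (e + f).Fits σ L ↔ e.Fits σ L ∧ f.Fits σ L ∧ e.ev σ + f.ev σ < 2 ^ L := Iff.rfl
theorem fits_mul {e f : Ex} {σ : State} {L : ℕ} :
    (e * f).Fits σ L ↔ e.Fits σ L ∧ f.Fits σ L ∧ e.ev σ * f.ev σ < 2 ^ L := Iff.rfl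

theorem fits_div {e f : Ex} {σ : State} {L : ℕ} :
    (e / f).Fits σ L ↔ e.Fits σ L ∧ f.Fits σ L := by
  refine ⟨fun h => ⟨h.1, h.2.1⟩, fun h => ⟨h.1, h.2, ?_⟩⟩
  exact lt_of_le_of_lt (Nat.div_le_self _ _) h.1.lt

theorem fits_mod {e f : Ex} {σ : State} {L : ℕ} :
    (e % f).Fits σ L ↔ e.Fits σ L ∧ f.Fits σ L := by
  refine ⟨fun h => ⟨h.1, h.2.1⟩, fun h => ⟨h.1, h.2, ?_⟩⟩
  exact lt_of_le_of_lt (Nat.mod_le _ _) h.1.lt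

theorem wf_reg {r : ℕ} : (Ex.reg r).Wf ↔ r < 20 := Iff.rfl
theorem wf_lit {n : ℕ} : (Ex.lit n).Wf ↔ True := Iff.rfl
theorem wf_get {k : ℕ} {e : Ex} : (Ex.get k e).Wf ↔ e.Wf := Iff.rfl
theorem wf_add {e f : Ex} : (e + f).Wf ↔ e.Wf ∧ f.Wf := Iff.rfl
theorem wf_mul {e f : Ex} : (e * f).Wf ↔ e.Wf ∧ f.Wf := Iff.rfl
theorem wf_div {e f : Ex} : (e / f).Wf ↔ e.Wf ∧ f.Wf := Iff.rfl
theorem wf_mod {e f : Ex} : (e % f).Wf ↔ e.Wf ∧ f.Wf := Iff.rfl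

theorem nodes_reg {r : ℕ} : (Ex.reg r).nodes = 1 := rfl
theorem nodes_lit {n : ℕ} : (Ex.lit n).nodes = 1 := rfl
theorem nodes_get {k : ℕ} {e : Ex} : (Ex.get k e).nodes = e.nodes + 1 := rfl
theorem nodes_add {e f : Ex} : (e + f).nodes = e.nodes + f.nodes + 1 := rfl
theorem nodes_mul {e f : Ex} : (e * f).nodes = e.nodes + f.nodes + 1 := rfl
theorem nodes_div {e f : Ex} : (e / f).nodes = e.nodes + f.nodes + 1 := rfl
theorem nodes_mod {e f : Ex} : (e % f).nodes = e.nodes + f.nodes + 1 := rfl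

end Ex

open BMM

/-! ### The pseudo-product procedure -/

/-- The dimension, held in register 3. -/
def eM : Ex := .reg 3

/-- The loop counter, held in register 4. -/
def eI : Ex := .reg 4

/-- The address of an entry of a quadrant in the matrix of twice the current dimension. -/
def quadAddr (a b : Bool) : Ex :=
  .lit 4 * (eM * eM) + ((.lit a.toNat * eM + eI / eM) * (.lit 2 * eM) +
    (.lit b.toNat * eM + eI % eM))

/-- The linear combination of the quadrants of the matrix in array `k`. -/
def combineE (k : ℕ) (u : Bool → Bool → ℕ) : Ex :=
  (.lit (u true true) * .get k (quadAddr true true) +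
    .lit (u true false) * .get k (quadAddr true false) +
    (.lit (u false true) * .get k (quadAddr false true) +
    .lit (u false false) * .get k (quadAddr false false))) % .lit 2

/-- One product of combinations of quadrants. -/
def prodCmd (j : ℕ) : Cmd :=
  .seq (sweep 4 (eM * eM) 3 (eM * eM + eI) (combineE 3 (coefA j)))
    (.seq (sweep 4 (eM * eM) 4 (eM * eM + eI) (combineE 4 (coefB j)))
      (.seq (.call 0) (sweep 4 (eM * eM) (10 + j) (eM * eM + eI) (.get 5 (eM * eM + eI)))))

/-- The first `n` products. -/
def prodsCmd : ℕ → Cmd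
  | 0 => .skip
  | n + 1 => .seq (prodsCmd n) (prodCmd n)

/-- The row index of the block that contains a cell of the matrix of twice the current dimension. -/
def rowBit : Ex := eI / (.lit 2 * eM) / eM

/-- The column index of the block. -/
def colBit : Ex := eI % (.lit 2 * eM) / eM

/-- The address of an entry of a product, in terms of the address in the large matrix. -/
def prodAddr : Ex := eM * eM + (eI / (.lit 2 * eM) % eM * eM + eI % (.lit 2 * eM) % eM)

/-- The contribution of one product. -/
def gatherTerm (j : ℕ) : Ex :=
  (.lit (coefC j).1 + .lit (coefC j).2.1 * rowBit + .lit (coefC j).2.2.1 * colBit +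
    .lit (coefC j).2.2.2 * (rowBit * colBit)) * .get (10 + j) prodAddr

/-- An entry of the result, computed from the six products. -/
def gatherE : Ex :=
  (gatherTerm 0 + gatherTerm 1 + gatherTerm 2 + gatherTerm 3 + gatherTerm 4 + gatherTerm 5) %
    .lit 2

/-- The recursive case. -/
def recCmd : Cmd :=
  .seq (assign 3 (eM / .lit 2)) (.seq (prodsCmd 6)
    (.seq (sweep 4 (.lit 4 * (eM * eM)) 5 (.lit 4 * (eM * eM) + eI) gatherE)
      (assign 3 (eM * .lit 2))))

/-- The recursive procedure for the pseudo-product of the matrices in arrays `3` and `4`. -/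
def mulCmd : Cmd :=
  .seq (assign 5 (.bin .lt (.lit 1) eM))
    (.ite 5 (.seq (assign 5 (.lit 0)) recCmd)
      (put 5 (.lit 1) (.get 3 (.lit 1) * .get 4 (.lit 1))))

/-- Array `k` holds a matrix of dimension `2 ^ s`, stored from address `2 ^ s * 2 ^ s` on. -/
def Holds (σ : State) (k : ℕ) {s : ℕ} (A : Matrix (Bits s) (Bits s) (ZMod 2)) : Prop :=
  ∀ x z, σ.mem k (2 ^ s * 2 ^ s + (bval x * 2 ^ s + bval z)) = (A x z).val

theorem natCast_mod_two_val (n : ℕ) : n % 2 = ((n : ZMod 2)).val := (ZMod.val_natCast 2 n).symm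

theorem quadAddr_spec {σ : State} {s j L : ℕ} (hM : σ.reg 3 = 2 ^ s) (hI : σ.reg 4 = j)
    (hj : j < 2 ^ s * 2 ^ s) (hL : 64 * (2 ^ s * 2 ^ s) ≤ 2 ^ L) (a b : Bool) :
    (quadAddr a b).Fits σ L ∧ (quadAddr a b).ev σ =
      2 ^ (s + 1) * 2 ^ (s + 1) + (bval (Fin.cons a (bitsOf s (j / 2 ^ s)) : Bits (s + 1)) *
        2 ^ (s + 1) + bval (Fin.cons b (bitsOf s (j % 2 ^ s)) : Bits (s + 1))) ∧
      4 * (2 ^ s * 2 ^ s) ≤ (quadAddr a b).ev σ := by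
  have h1 : j / 2 ^ s < 2 ^ s := Nat.div_lt_of_lt_mul hj
  have h2 : j % 2 ^ s < 2 ^ s := Nat.mod_lt _ (by positivity)
  have h0 : 1 ≤ 2 ^ s := Nat.one_le_two_pow
  have ha : a.toNat ≤ 1 := Bool.toNat_le a
  have hb : b.toNat ≤ 1 := Bool.toNat_le b
  simp only [quadAddr, eM, eI, Ex.ev_add, Ex.ev_mul, Ex.ev_lit, Ex.ev_reg, Ex.ev_div, Ex.ev_mod,
    Ex.fits_add, Ex.fits_mul, Ex.fits_lit, Ex.fits_reg, Ex.fits_div, Ex.fits_mod, hM, hI,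
    bval_cons, bval_bitsOf h1, bval_bitsOf h2, pow_succ]
  generalize 2 ^ s = M at *
  generalize j / M = x at *
  generalize j % M = z at *
  generalize a.toNat = a at *
  generalize b.toNat = b at *
  have e1 : a * M ≤ M := by nlinarith
  have e2 : b * M ≤ M := by nlinarith
  have e3 : M ≤ M * M := by nlinarith
  have e4 : (a * M + x) * (2 * M) ≤ 4 * (M * M) := by nlinarith
  refine ⟨?_, ?_, ?_⟩
  · refine ⟨⟨?_, ⟨?_, ?_, ?_⟩, ?_⟩, ⟨⟨⟨⟨?_, ?_, ?_⟩, ⟨?_, ?_⟩, ?_⟩, ⟨?_, ?_, ?_⟩, ?_⟩,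
      ⟨⟨?_, ?_, ?_⟩, ⟨?_, ?_⟩, ?_⟩, ?_⟩, ?_⟩ <;> omega
  · ring
  · omega

theorem coefA_le (j : ℕ) (a b : Bool) : coefA j a b ≤ 1 := by
  unfold coefA; split <;> first | omega | (split_ifs <;> omega)

theorem coefB_le (j : ℕ) (a b : Bool) : coefB j a b ≤ 1 := by
  unfold coefB; split <;> first | omega | (split_ifs <;> omega)

theorem zmod_two_val_le (t : ZMod 2) : t.val ≤ 1 := Nat.lt_succ_iff.1 (ZMod.val_lt t)

theorem combineE_spec {σ : State} {s j L k : ℕ} {u : Bool → Bool → ℕ}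
    {A : Matrix (Bits (s + 1)) (Bits (s + 1)) (ZMod 2)} (hu : ∀ a b, u a b ≤ 1)
    (hM : σ.reg 3 = 2 ^ s) (hI : σ.reg 4 = j)
    (hj : j < 2 ^ s * 2 ^ s) (hL : 64 * (2 ^ s * 2 ^ s) ≤ 2 ^ L) (hA : Holds σ k A) :
    (combineE k u).Fits σ L ∧ (combineE k u).ev σ =
      (combine u A (bitsOf s (j / 2 ^ s)) (bitsOf s (j % 2 ^ s))).val := by
  have h0 : 1 ≤ 2 ^ s * 2 ^ s := Nat.one_le_iff_ne_zero.2 (by positivity)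
  have hq := fun a b => quadAddr_spec hM hI hj hL a b
  have hv : ∀ a b, σ.mem k ((quadAddr a b).ev σ) =
      (quad A a b (bitsOf s (j / 2 ^ s)) (bitsOf s (j % 2 ^ s))).val := fun a b => by
    rw [(hq a b).2.1, hA]; rfl
  constructor
  · have hm : ∀ a b, u a b * σ.mem k ((quadAddr a b).ev σ) ≤ 1 := fun a b => by
      rw [hv]
      exact Nat.mul_le_mul (hu a b) (zmod_two_val_le _)
    have hm' : ∀ a b, σ.mem k ((quadAddr a b).ev σ) ≤ 1 := fun a b => by
      rw [hv]
      exact zmod_two_val_le _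
    simp only [combineE, Ex.fits_add, Ex.fits_mul, Ex.fits_lit, Ex.fits_get, Ex.fits_mod,
      Ex.ev_add, Ex.ev_mul, Ex.ev_lit, Ex.ev_get]
    have h1 := fun a b => hu a b
    have m1 := hm true true
    have m2 := hm true false
    have m3 := hm false true
    have m4 := hm false false
    have m1' := hm' true true
    have m2' := hm' true false
    have m3' := hm' false true
    have m4' := hm' false false
    have u1 := hu true true
    have u2 := hu true false
    have u3 := hu false true
    have u4 := hu false false
    have f1 := (hq true true).1
    have f2 := (hq true false).1
    have f3 := (hq false true).1
    have f4 := (hq false false).1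
    refine ⟨⟨⟨⟨?_, ⟨f1, ?_⟩, ?_⟩, ⟨?_, ⟨f2, ?_⟩, ?_⟩, ?_⟩, ⟨⟨?_, ⟨f3, ?_⟩, ?_⟩,
      ⟨?_, ⟨f4, ?_⟩, ?_⟩, ?_⟩, ?_⟩, ?_⟩ <;> omega
  · simp only [combineE, Ex.ev_add, Ex.ev_mul, Ex.ev_lit, Ex.ev_get, Ex.ev_mod, hv, combine,
      Fintype.sum_bool, natCast_mod_two_val]
    push_cast
    simp only [ZMod.natCast_zmod_val]

theorem rows_lt {s : ℕ} (x z : Bits s) : bval x * 2 ^ s + bval z < 2 ^ s * 2 ^ s := by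
  have h1 := bval_lt x
  have h2 := bval_lt z
  nlinarith

theorem rows_div {s : ℕ} (x z : Bits s) : (bval x * 2 ^ s + bval z) / 2 ^ s = bval x := by
  rw [mul_comm, Nat.mul_add_div (by positivity), Nat.div_eq_of_lt (bval_lt z), add_zero]

theorem rows_mod {s : ℕ} (x z : Bits s) : (bval x * 2 ^ s + bval z) % 2 ^ s = bval z := by
  rw [mul_comm, Nat.mul_add_mod, Nat.mod_eq_of_lt (bval_lt z)]

theorem baseAddr_spec {σ : State} {s j L : ℕ} (hM : σ.reg 3 = 2 ^ s) (hI : σ.reg 4 = j)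
    (hj : j < 2 ^ s * 2 ^ s) (hL : 64 * (2 ^ s * 2 ^ s) ≤ 2 ^ L) :
    (eM * eM + eI).Fits σ L ∧ (eM * eM + eI).ev σ = 2 ^ s * 2 ^ s + j := by
  have h0 : 1 ≤ 2 ^ s := Nat.one_le_two_pow
  have e3 : 2 ^ s ≤ 2 ^ s * 2 ^ s := by nlinarith
  simp only [eM, eI, Ex.ev_add, Ex.ev_mul, Ex.ev_reg, Ex.fits_add, Ex.fits_mul, Ex.fits_reg, hM,
    hI, and_true]
  generalize 2 ^ s = M at *
  generalize M * M = N at *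
  omega

theorem size_spec {σ : State} {s L : ℕ} (hM : σ.reg 3 = 2 ^ s)
    (hL : 64 * (2 ^ s * 2 ^ s) ≤ 2 ^ L) :
    (eM * eM).Fits σ L ∧ (eM * eM).ev σ = 2 ^ s * 2 ^ s := by
  have h0 : 1 ≤ 2 ^ s := Nat.one_le_two_pow
  have e3 : 2 ^ s ≤ 2 ^ s * 2 ^ s := by nlinarith
  simp only [eM, Ex.ev_mul, Ex.ev_reg, Ex.fits_mul, Ex.fits_reg, hM, and_true]
  generalize 2 ^ s = M at *
  generalize M * M = N at *
  omega

/-- The combination can overwrite part of the array that holds the large matrix: the quadrants are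
read at addresses at least 4·4^s, and the result is written below 2·4^s. -/
theorem exec_combine (P : Program) {σ : State} {s L k : ℕ} {u : Bool → Bool → ℕ}
    {A : Matrix (Bits (s + 1)) (Bits (s + 1)) (ZMod 2)} (hu : ∀ a b, u a b ≤ 1) (hσ : Clean σ)
    (hM : σ.reg 3 = 2 ^ s) (hI : σ.reg 4 = 0) (hL : 64 * (2 ^ s * 2 ^ s) ≤ 2 ^ L)
    (hA : Holds σ k A) :
    ∃ σ', DExec P (sweep 4 (eM * eM) k (eM * eM + eI) (combineE k u)) σ σ'
        (800 * (2 ^ s * 2 ^ s + 1) * (1 + L) ^ 2) ∧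
      σ'.reg = σ.reg ∧ (∀ k' ≠ k, σ'.mem k' = σ.mem k') ∧ Holds σ' k (combine u A) ∧
      (∀ a, 2 * (2 ^ s * 2 ^ s) ≤ a → σ'.mem k a = σ.mem k a) := by
  have hsz := size_spec hM hL
  obtain ⟨σ', h1, h2, h3, h4, h5⟩ := exec_fill P (i := 4) (k := k) (e := eM * eM)
    (ea := eM * eM + eI) (ee := combineE k u) (by omega) (by simp [eM, Ex.wf_mul, Ex.wf_reg])
    (by simp [eM, eI, Ex.wf_mul, Ex.wf_add, Ex.wf_reg])
    (by simp [combineE, quadAddr, eM, eI, Ex.wf_mul, Ex.wf_add, Ex.wf_reg, Ex.wf_lit, Ex.wf_get,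
      Ex.wf_mod, Ex.wf_div]) hσ hI hsz.1 hsz.2 (fun j => 2 ^ s * 2 ^ s + j)
    (fun j => (combine u A (bitsOf s (j / 2 ^ s)) (bitsOf s (j % 2 ^ s))).val)
    (fun j _ j' _ h => by simpa using h) (by
      intro j hj g hg
      have hr3 : ((σ.setReg 4 j).withMem k g).reg 3 = 2 ^ s := by
        simp [State.withMem, State.setReg, hM]
      have hr4 : ((σ.setReg 4 j).withMem k g).reg 4 = j := by
        simp [State.withMem, State.setReg]
      have hb := baseAddr_spec hr3 hr4 hj hL
      have hc := combineE_spec (k := k) (A := A) hu hr3 hr4 hj hL (by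
        intro x z
        rw [← hA x z]
        simp only [State.withMem, Function.update_self]
        refine hg _ fun j' hj' => ?_
        rw [pow_succ]
        have : 2 ^ s * 2 * (2 ^ s * 2) = 4 * (2 ^ s * 2 ^ s) := by ring
        omega)
      exact ⟨hb.1, hc.1, hb.2, hc.2⟩)
  refine ⟨σ', h1.mono (Nat.mul_le_mul_right _ (Nat.mul_le_mul_right _ ?_)), h2, h3, ?_, ?_⟩
  · simp [sweepCost, combineE, quadAddr, eM, eI, Ex.nodes_mul, Ex.nodes_add, Ex.nodes_reg,
      Ex.nodes_lit, Ex.nodes_get, Ex.nodes_mod, Ex.nodes_div]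
  · intro x z
    rw [h4 _ (rows_lt x z), rows_div, rows_mod, bitsOf_bval, bitsOf_bval]
  · intro a ha
    exact h5 a fun j hj => by omega

/-- The memory is unchanged outside the workspace of the procedure at level `s`. -/
def Frame (s : ℕ) (σ σ' : State) : Prop :=
  ∀ k a, ¬ (3 ≤ k ∧ k ≤ 15 ∧ a < 2 ^ s * 2 ^ s) → ¬ (k = 5 ∧ a < 2 * (2 ^ s * 2 ^ s)) →
    σ'.mem k a = σ.mem k a

/-- The procedure `0` computes pseudo-products of dimension `2 ^ s` in time `T`. -/
def MulSpec (P : Program) (s T : ℕ) : Prop :=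
  ∀ (σ : State) (A B : Matrix (Bits s) (Bits s) (ZMod 2)), Clean σ → σ.reg 3 = 2 ^ s →
    σ.reg 4 = 0 → σ.reg 5 = 0 → Holds σ 3 A → Holds σ 4 B →
      ∃ σ', DExec P (.call 0) σ σ' T ∧ σ'.reg = σ.reg ∧ Holds σ' 5 (pseudoMul A B) ∧
        Frame s σ σ'

theorem exec_copy (P : Program) {σ : State} {s L k : ℕ} {C : Matrix (Bits s) (Bits s) (ZMod 2)}
    (hk : k ≠ 5) (hσ : Clean σ) (hM : σ.reg 3 = 2 ^ s) (hI : σ.reg 4 = 0)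
    (hL : 64 * (2 ^ s * 2 ^ s) ≤ 2 ^ L) (hC : Holds σ 5 C) :
    ∃ σ', DExec P (sweep 4 (eM * eM) k (eM * eM + eI) (.get 5 (eM * eM + eI))) σ σ'
        (800 * (2 ^ s * 2 ^ s + 1) * (1 + L) ^ 2) ∧
      σ'.reg = σ.reg ∧ (∀ k' ≠ k, σ'.mem k' = σ.mem k') ∧ Holds σ' k C ∧
      (∀ a, 2 * (2 ^ s * 2 ^ s) ≤ a → σ'.mem k a = σ.mem k a) := by
  have hsz := size_spec hM hL
  have h0 : 1 ≤ 2 ^ s * 2 ^ s := Nat.one_le_iff_ne_zero.2 (by positivity)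
  obtain ⟨σ', h1, h2, h3, h4, h5⟩ := exec_fill P (i := 4) (k := k) (e := eM * eM)
    (ea := eM * eM + eI) (ee := .get 5 (eM * eM + eI)) (by omega)
    (by simp [eM, Ex.wf_mul, Ex.wf_reg])
    (by simp [eM, eI, Ex.wf_mul, Ex.wf_add, Ex.wf_reg])
    (by simp [eM, eI, Ex.wf_mul, Ex.wf_add, Ex.wf_reg, Ex.wf_get])
    hσ hI hsz.1 hsz.2 (fun j => 2 ^ s * 2 ^ s + j) (fun j => σ.mem 5 (2 ^ s * 2 ^ s + j))
    (fun j _ j' _ h => by simpa using h) (by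
      intro j hj g hg
      have hr3 : ((σ.setReg 4 j).withMem k g).reg 3 = 2 ^ s := by
        simp [State.withMem, State.setReg, hM]
      have hr4 : ((σ.setReg 4 j).withMem k g).reg 4 = j := by
        simp [State.withMem, State.setReg]
      have hb := baseAddr_spec hr3 hr4 hj hL
      have hm : ((σ.setReg 4 j).withMem k g).mem 5 = σ.mem 5 := by
        simp [State.withMem, State.setReg, hk.symm]
      refine ⟨hb.1, ⟨hb.1, ?_⟩, hb.2, by rw [Ex.ev_get, hb.2, hm]⟩
      obtain ⟨x, hx⟩ := exists_bval_eq (s := s) (Nat.div_lt_of_lt_mul hj)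
      obtain ⟨z, hz⟩ := exists_bval_eq (s := s) (Nat.mod_lt j (by positivity : 0 < 2 ^ s))
      have hxz : j = bval x * 2 ^ s + bval z := by
        rw [hx, hz]; exact (Nat.div_add_mod' j (2 ^ s)).symm
      rw [hb.2, hm, hxz, hC]
      have := zmod_two_val_le (C x z)
      omega)
  refine ⟨σ', h1.mono (Nat.mul_le_mul_right _ (Nat.mul_le_mul_right _ ?_)), h2, h3, ?_, ?_⟩
  · simp [sweepCost, eM, eI, Ex.nodes_mul, Ex.nodes_add, Ex.nodes_reg, Ex.nodes_get]
  · intro x z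
    rw [h4 _ (rows_lt x z), hC]
  · intro a ha
    exact h5 a fun j hj => by omega

/-- The first of the two frame conditions protects the factors of the large product, stored from
4·4^s on, for the remaining products. The second protects the products already parked in the other
arrays: the recursive call writes below 4^s there, and they lie above. -/
theorem exec_prod {P : Program} {s T L : ℕ} (hP : MulSpec P s T) {j : ℕ} (hj : j < 6) {σ : State}
    {A B : Matrix (Bits (s + 1)) (Bits (s + 1)) (ZMod 2)} (hσ : Clean σ)
    (hM : σ.reg 3 = 2 ^ s) (hI : σ.reg 4 = 0) (h5 : σ.reg 5 = 0)
    (hL : 64 * (2 ^ s * 2 ^ s) ≤ 2 ^ L) (hA : Holds σ 3 A) (hB : Holds σ 4 B) :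
    ∃ σ', DExec P (prodCmd j) σ σ' (T + 2403 * (2 ^ s * 2 ^ s + 1) * (1 + L) ^ 2) ∧
      σ'.reg = σ.reg ∧
      Holds σ' (10 + j) (pseudoMul (combine (coefA j) A) (combine (coefB j) B)) ∧
      (∀ k a, ¬ (3 ≤ k ∧ k ≤ 15 ∧ a < 2 * (2 ^ s * 2 ^ s)) → σ'.mem k a = σ.mem k a) ∧
      (∀ k a, 10 ≤ k → k ≠ 10 + j → 2 ^ s * 2 ^ s ≤ a → σ'.mem k a = σ.mem k a) := by
  obtain ⟨σ₁, e₁, r₁, f₁, H₁, g₁⟩ := exec_combine P (coefA_le j) hσ hM hI hL hA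
  have hB₁ : Holds σ₁ 4 B := fun x z => by rw [f₁ 4 (by omega)]; exact hB x z
  obtain ⟨σ₂, e₂, r₂, f₂, H₂, g₂⟩ := exec_combine P (coefB_le j) (hσ.of_reg_eq r₁)
    (by rw [r₁]; exact hM) (by rw [r₁]; exact hI) hL hB₁
  have hA₂ : Holds σ₂ 3 (combine (coefA j) A) := fun x z => by
    rw [f₂ 3 (by omega)]; exact H₁ x z
  rw [r₁] at r₂
  obtain ⟨σ₃, e₃, r₃, H₃, f₃⟩ := hP σ₂ _ _ (hσ.of_reg_eq r₂) (by rw [r₂]; exact hM)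
    (by rw [r₂]; exact hI) (by rw [r₂]; exact h5) hA₂ H₂
  rw [r₂] at r₃
  obtain ⟨σ₄, e₄, r₄, f₄, H₄, g₄⟩ := exec_copy P (k := 10 + j) (by omega) (hσ.of_reg_eq r₃)
    (by rw [r₃]; exact hM) (by rw [r₃]; exact hI) hL H₃
  rw [r₃] at r₄
  refine ⟨σ₄, e₁.then (e₂.then (e₃.then e₄ le_rfl) le_rfl) ?_, r₄, H₄, ?_, ?_⟩
  · have : 1 ≤ (2 ^ s * 2 ^ s + 1) * (1 + L) ^ 2 := Nat.one_le_iff_ne_zero.2 (by positivity)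
    nlinarith
  · intro k a hka
    have h₄ : σ₄.mem k a = σ₃.mem k a := by
      rcases eq_or_ne k (10 + j) with rfl | h
      · exact g₄ a (by omega)
      · rw [f₄ k h]
    have h₂ : σ₂.mem k a = σ₁.mem k a := by
      rcases eq_or_ne k 4 with rfl | h
      · exact g₂ a (by omega)
      · rw [f₂ k h]
    have h₁ : σ₁.mem k a = σ.mem k a := by
      rcases eq_or_ne k 3 with rfl | h
      · exact g₁ a (by omega)
      · rw [f₁ k h]
    rw [h₄, f₃ k a (by omega) (by omega), h₂, h₁]
  · intro k a hk hkj ha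
    rw [f₄ k hkj, f₃ k a (by omega) (by omega), f₂ k (by omega), f₁ k (by omega)]

theorem exec_prods {P : Program} {s T L : ℕ} (hP : MulSpec P s T) {σ : State}
    {A B : Matrix (Bits (s + 1)) (Bits (s + 1)) (ZMod 2)} (hσ : Clean σ)
    (hM : σ.reg 3 = 2 ^ s) (hI : σ.reg 4 = 0) (h5 : σ.reg 5 = 0)
    (hL : 64 * (2 ^ s * 2 ^ s) ≤ 2 ^ L) (hA : Holds σ 3 A) (hB : Holds σ 4 B) (n : ℕ)
    (hn : n ≤ 6) :
    ∃ σ', DExec P (prodsCmd n) σ σ'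
        (1 + n * (T + 2404 * (2 ^ s * 2 ^ s + 1) * (1 + L) ^ 2)) ∧
      σ'.reg = σ.reg ∧
      (∀ j < n, Holds σ' (10 + j) (pseudoMul (combine (coefA j) A) (combine (coefB j) B))) ∧
      (∀ k a, ¬ (3 ≤ k ∧ k ≤ 15 ∧ a < 2 * (2 ^ s * 2 ^ s)) → σ'.mem k a = σ.mem k a) := by
  induction n with
  | zero => exact ⟨σ, (exec_skip P σ).mono (by omega), rfl, by omega, fun _ _ _ => rfl⟩
  | succ n ih =>
    obtain ⟨σ₁, e₁, r₁, H₁, f₁⟩ := ih (by omega)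
    have hsq : 2 ^ (s + 1) * 2 ^ (s + 1) = 4 * (2 ^ s * 2 ^ s) := by ring
    have hA₁ : Holds σ₁ 3 A := fun x z => by rw [f₁ _ _ (by omega)]; exact hA x z
    have hB₁ : Holds σ₁ 4 B := fun x z => by rw [f₁ _ _ (by omega)]; exact hB x z
    obtain ⟨σ₂, e₂, r₂, H₂, f₂, g₂⟩ := exec_prod hP (j := n) (by omega) (hσ.of_reg_eq r₁)
      (by rw [r₁]; exact hM) (by rw [r₁]; exact hI) (by rw [r₁]; exact h5) hL hA₁ hB₁
    refine ⟨σ₂, e₁.then e₂ ?_, r₂.trans r₁, ?_, ?_⟩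
    · have : 1 ≤ (2 ^ s * 2 ^ s + 1) * (1 + L) ^ 2 := Nat.one_le_iff_ne_zero.2 (by positivity)
      nlinarith
    · intro j hj
      rcases eq_or_ne j n with rfl | h
      · exact H₂
      · intro x z
        rw [g₂ _ _ (by omega) (by omega) (by omega)]
        exact H₁ j (by omega) x z
    · intro k a hka
      rw [f₂ k a hka, f₁ k a hka]

end BitRAM

/-! ### Recombining the six products, and the recursion on the dimension -/

namespace BitRAM
open BMM

theorem exists_cells {s j : ℕ} (hj : j < 2 ^ s * 2 ^ s) :
    ∃ x z : Bits s, j = bval x * 2 ^ s + bval z := by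
  obtain ⟨x, hx⟩ := exists_bval_eq (s := s) (Nat.div_lt_of_lt_mul hj)
  obtain ⟨z, hz⟩ := exists_bval_eq (s := s) (Nat.mod_lt j (by positivity : 0 < 2 ^ s))
  exact ⟨x, z, by rw [hx, hz]; exact (Nat.div_add_mod' j (2 ^ s)).symm⟩

theorem bval_cons_div {s : ℕ} (a : Bool) (x : Bits s) :
    bval (Fin.cons a x : Bits (s + 1)) / 2 ^ s = a.toNat := by
  rw [bval_cons, mul_comm, Nat.mul_add_div (by positivity), Nat.div_eq_of_lt (bval_lt x), add_zero]

theorem bval_cons_mod {s : ℕ} (a : Bool) (x : Bits s) :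
    bval (Fin.cons a x : Bits (s + 1)) % 2 ^ s = bval x := by
  rw [bval_cons, mul_comm, Nat.mul_add_mod, Nat.mod_eq_of_lt (bval_lt x)]

theorem coefC_le (j : ℕ) : (coefC j).1 ≤ 1 ∧ (coefC j).2.1 ≤ 1 ∧ (coefC j).2.2.1 ≤ 1 ∧
    (coefC j).2.2.2 ≤ 1 := by
  unfold coefC; split <;> simp

theorem gatherTerm_spec {σ : State} {s L i : ℕ} {a b : Bool} {x z : Bits s}
    {C : Matrix (Bits s) (Bits s) (ZMod 2)} (hM : σ.reg 3 = 2 ^ s)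
    (hI : σ.reg 4 = bval (Fin.cons a x : Bits (s + 1)) * 2 ^ (s + 1) +
      bval (Fin.cons b z : Bits (s + 1)))
    (hL : 64 * (2 ^ s * 2 ^ s) ≤ 2 ^ L) (hC : Holds σ (10 + i) C) :
    (gatherTerm i).Fits σ L ∧ (gatherTerm i).ev σ ≤ 4 ∧
      (gatherTerm i).ev σ = outCoef i a.toNat b.toNat * (C x z).val := by
  have hsucc : 2 * 2 ^ s = 2 ^ (s + 1) := by ring
  have hi : σ.reg 4 < 4 * (2 ^ s * 2 ^ s) := by
    have := rows_lt (Fin.cons a x : Bits (s + 1)) (Fin.cons b z : Bits (s + 1))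
    rw [hI]
    refine lt_of_lt_of_eq this (by ring)
  have hr : rowBit.ev σ = a.toNat := by
    simp only [rowBit, eM, eI, Ex.ev_div, Ex.ev_mul, Ex.ev_lit, Ex.ev_reg, hM, hI, hsucc,
      rows_div, bval_cons_div]
  have hc : colBit.ev σ = b.toNat := by
    simp only [colBit, eM, eI, Ex.ev_div, Ex.ev_mod, Ex.ev_mul, Ex.ev_lit, Ex.ev_reg, hM, hI,
      hsucc, rows_mod, bval_cons_div]
  have hp : prodAddr.ev σ = 2 ^ s * 2 ^ s + (bval x * 2 ^ s + bval z) := by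
    simp only [prodAddr, eM, eI, Ex.ev_add, Ex.ev_div, Ex.ev_mod, Ex.ev_mul, Ex.ev_lit, Ex.ev_reg,
      hM, hI, hsucc, rows_mod, rows_div, bval_cons_mod]
  have h0 : 1 ≤ 2 ^ s := Nat.one_le_two_pow
  have e3 : 2 ^ s ≤ 2 ^ s * 2 ^ s := by nlinarith
  have hfr : rowBit.Fits σ L := by
    simp only [rowBit, eM, eI, Ex.fits_div, Ex.fits_mul, Ex.fits_lit, Ex.fits_reg, Ex.ev_lit,
      Ex.ev_reg, hM]
    omega
  have hfc : colBit.Fits σ L := by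
    simp only [colBit, eM, eI, Ex.fits_div, Ex.fits_mod, Ex.fits_mul, Ex.fits_lit, Ex.fits_reg,
      Ex.ev_lit, Ex.ev_reg, hM]
    omega
  have hxz := rows_lt x z
  have hfp : prodAddr.Fits σ L := by
    simp only [prodAddr, eM, eI, Ex.fits_add, Ex.fits_div, Ex.fits_mod, Ex.fits_mul, Ex.fits_lit,
      Ex.fits_reg, Ex.ev_add, Ex.ev_div, Ex.ev_mod, Ex.ev_mul, Ex.ev_lit,
      Ex.ev_reg, hM, hI, hsucc, rows_mod, rows_div, bval_cons_mod]
    rw [← hI, ← hsucc]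
    generalize 2 ^ s = M at *
    generalize M * M = N at *
    omega
  have hv : (C x z).val ≤ 1 := zmod_two_val_le _
  have ha : a.toNat ≤ 1 := Bool.toNat_le a
  have hb : b.toNat ≤ 1 := Bool.toNat_le b
  obtain ⟨c1, c2, c3, c4⟩ := coefC_le i
  have hab : a.toNat * b.toNat ≤ 1 := Nat.mul_le_mul ha hb
  have m2 : (coefC i).2.1 * a.toNat ≤ 1 := Nat.mul_le_mul c2 ha
  have m3 : (coefC i).2.2.1 * b.toNat ≤ 1 := Nat.mul_le_mul c3 hb
  have m4 : (coefC i).2.2.2 * (a.toNat * b.toNat) ≤ 1 := Nat.mul_le_mul c4 hab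
  have hev : (gatherTerm i).ev σ = outCoef i a.toNat b.toNat * (C x z).val := by
    simp only [gatherTerm, Ex.ev_add, Ex.ev_mul, Ex.ev_lit, Ex.ev_get, hr, hc, hp, hC x z, outCoef]
  have hle : outCoef i a.toNat b.toNat * (C x z).val ≤ 4 := by
    have : outCoef i a.toNat b.toNat ≤ 4 := by
      simp only [outCoef]
      omega
    calc _ ≤ 4 * 1 := Nat.mul_le_mul this hv
      _ = 4 := rfl
  refine ⟨?_, hev ▸ hle, hev⟩
  simp only [outCoef] at hle
  simp only [gatherTerm, Ex.fits_add, Ex.fits_mul, Ex.fits_lit, Ex.fits_get, Ex.ev_add, Ex.ev_mul,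
    Ex.ev_lit, Ex.ev_get, hr, hc, hp, hC x z, hfr, hfc, hfp]
  generalize 2 ^ s = M at *
  generalize M * M = N at *
  generalize 2 ^ L = Q at *
  simp only [true_and]
  omega

theorem exec_gather (P : Program) {σ : State} {s L : ℕ}
    {A B : Matrix (Bits (s + 1)) (Bits (s + 1)) (ZMod 2)} (hσ : Clean σ)
    (hM : σ.reg 3 = 2 ^ s) (hI : σ.reg 4 = 0) (hL : 64 * (2 ^ s * 2 ^ s) ≤ 2 ^ L)
    (hC : ∀ j < 6, Holds σ (10 + j) (pseudoMul (combine (coefA j) A) (combine (coefB j) B))) :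
    ∃ σ', DExec P (sweep 4 (.lit 4 * (eM * eM)) 5 (.lit 4 * (eM * eM) + eI) gatherE) σ σ'
        (2400 * (4 * (2 ^ s * 2 ^ s) + 1) * (1 + L) ^ 2) ∧
      σ'.reg = σ.reg ∧ (∀ k' ≠ 5, σ'.mem k' = σ.mem k') ∧ Holds σ' 5 (pseudoMul A B) ∧
      (∀ a, 8 * (2 ^ s * 2 ^ s) ≤ a → σ'.mem 5 a = σ.mem 5 a) := by
  have h0 : 1 ≤ 2 ^ s := Nat.one_le_two_pow
  have e3 : 2 ^ s ≤ 2 ^ s * 2 ^ s := by nlinarith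
  have hsq : 4 * (2 ^ s * 2 ^ s) = 2 ^ (s + 1) * 2 ^ (s + 1) := by ring
  obtain ⟨σ', h1, h2, h3, h4, h5⟩ := exec_fill P (i := 4) (k := 5) (L := L)
    (n := 4 * (2 ^ s * 2 ^ s)) (e := .lit 4 * (eM * eM)) (σ := σ)
    (ea := .lit 4 * (eM * eM) + eI) (ee := gatherE) (by omega)
    (by simp [eM, Ex.wf_mul, Ex.wf_reg, Ex.wf_lit])
    (by simp [eM, eI, Ex.wf_mul, Ex.wf_add, Ex.wf_reg, Ex.wf_lit])
    (by simp [gatherE, gatherTerm, rowBit, colBit, prodAddr, eM, eI, Ex.wf_mul, Ex.wf_add,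
      Ex.wf_reg, Ex.wf_get, Ex.wf_lit, Ex.wf_div, Ex.wf_mod])
    hσ hI (by
      simp only [eM, Ex.fits_mul, Ex.fits_lit, Ex.fits_reg, Ex.ev_mul, Ex.ev_lit, Ex.ev_reg, hM]
      generalize 2 ^ s = M at *
      generalize M * M = N at *
      omega) (by simp only [eM, Ex.ev_mul, Ex.ev_lit, Ex.ev_reg, hM])
    (fun j => 4 * (2 ^ s * 2 ^ s) + j)
    (fun j => (pseudoMul A B (bitsOf (s + 1) (j / 2 ^ (s + 1)))
      (bitsOf (s + 1) (j % 2 ^ (s + 1)))).val)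
    (fun j _ j' _ h => by simpa using h) (by
      intro j hj g hg
      have hr3 : ((σ.setReg 4 j).withMem 5 g).reg 3 = 2 ^ s := by
        simp [State.withMem, State.setReg, hM]
      have hr4 : ((σ.setReg 4 j).withMem 5 g).reg 4 = j := by
        simp [State.withMem, State.setReg]
      have hC' : ∀ i < 6, Holds ((σ.setReg 4 j).withMem 5 g) (10 + i)
          (pseudoMul (combine (coefA i) A) (combine (coefB i) B)) := by
        intro i hi x z
        have : ((σ.setReg 4 j).withMem 5 g).mem (10 + i) = σ.mem (10 + i) := by
          simp only [State.withMem, State.setReg]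
          rw [Function.update_of_ne (by omega)]
        rw [this]
        exact hC i hi x z
      generalize (σ.setReg 4 j).withMem 5 g = τ at *
      obtain ⟨X, Z, hXZ⟩ := exists_cells (hsq ▸ hj)
      rw [hXZ, rows_div, rows_mod, bitsOf_bval, bitsOf_bval]
      rw [hXZ, ← Fin.cons_self_tail X, ← Fin.cons_self_tail Z] at hr4
      rw [← Fin.cons_self_tail X, ← Fin.cons_self_tail Z]
      have hg := fun i hi => gatherTerm_spec hr3 hr4 hL (hC' i hi)
      have ht : τ.reg 4 < 4 * (2 ^ s * 2 ^ s) := by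
        rw [hr4]
        exact lt_of_lt_of_eq (rows_lt _ _) hsq.symm
      refine ⟨?_, ?_, ?_, ?_⟩
      · simp only [eM, eI, Ex.fits_mul, Ex.fits_add, Ex.fits_lit, Ex.fits_reg, Ex.ev_mul,
          Ex.ev_lit, Ex.ev_reg, hr3]
        generalize 2 ^ s = M at *
        generalize M * M = N at *
        omega
      · have g0 := hg 0 (by omega)
        have g1 := hg 1 (by omega)
        have g2 := hg 2 (by omega)
        have g3 := hg 3 (by omega)
        have g4 := hg 4 (by omega)
        have g5 := hg 5 (by omega)
        have hb0 := g0.2.1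
        have hb1 := g1.2.1
        have hb2 := g2.2.1
        have hb3 := g3.2.1
        have hb4 := g4.2.1
        have hb5 := g5.2.1
        simp only [gatherE, Ex.fits_mod, Ex.fits_add, Ex.fits_lit, Ex.ev_add, g0.1, g1.1, g2.1,
          g3.1, g4.1, g5.1, true_and]
        have : 64 ≤ 2 ^ L := by
          generalize 2 ^ s = M at *
          generalize M * M = N at *
          omega
        omega
      · simp only [eM, eI, Ex.ev_add, Ex.ev_mul, Ex.ev_lit, Ex.ev_reg, hr3, hr4]
      · simp only [gatherE, Ex.ev_mod, Ex.ev_add, Ex.ev_lit, (hg 0 (by omega)).2.2,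
          (hg 1 (by omega)).2.2, (hg 2 (by omega)).2.2, (hg 3 (by omega)).2.2,
          (hg 4 (by omega)).2.2, (hg 5 (by omega)).2.2, natCast_mod_two_val, pseudoMul_eq_six,
          Finset.sum_range_succ, Finset.sum_range_zero, zero_add]
        push_cast
        simp only [ZMod.natCast_zmod_val])
  refine ⟨σ', h1.mono (Nat.mul_le_mul_right _ (Nat.mul_le_mul_right _ ?_)), h2, h3, ?_, ?_⟩
  · simp [sweepCost, gatherE, gatherTerm, rowBit, colBit, prodAddr, eM, eI, Ex.nodes_mul,
      Ex.nodes_add, Ex.nodes_reg, Ex.nodes_lit, Ex.nodes_get, Ex.nodes_mod, Ex.nodes_div]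
  · intro X Z
    rw [← hsq, h4 _ (lt_of_lt_of_eq (rows_lt X Z) hsq.symm), rows_div, rows_mod, bitsOf_bval,
      bitsOf_bval]
  · intro a ha
    exact h5 a fun j hj => by omega

/-- A bound for the time of the recursive procedure. -/
def mulTime : ℕ → ℕ
  | 0 => 1000
  | s + 1 => 6 * mulTime s + 50000 * (4 ^ s * (2 * s + 8) ^ 2)

theorem exec_rec {P : Program} {s T : ℕ} (hP : MulSpec P s T) {σ : State}
    {A B : Matrix (Bits (s + 1)) (Bits (s + 1)) (ZMod 2)} (hσ : Clean σ)
    (hM : σ.reg 3 = 2 ^ (s + 1)) (hI : σ.reg 4 = 0) (h5 : σ.reg 5 = 0)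
    (hA : Holds σ 3 A) (hB : Holds σ 4 B) :
    ∃ σ', DExec P recCmd σ σ' (6 * T + 49000 * (4 ^ s * (2 * s + 8) ^ 2)) ∧
      σ'.reg = σ.reg ∧ Holds σ' 5 (pseudoMul A B) ∧ Frame (s + 1) σ σ' := by
  -- Addresses at this level stay below 8·4^s, so 2s + 7 digits are ample; hence the factor (2s +
  -- 8)² in the cost.
  have hL : 64 * (2 ^ s * 2 ^ s) ≤ 2 ^ (2 * s + 7) := by
    rw [pow_add, two_mul, pow_add]
    omega
  have hsq : 2 ^ (s + 1) * 2 ^ (s + 1) = 4 * (2 ^ s * 2 ^ s) := by ring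
  have h0 : 1 ≤ 2 ^ s := Nat.one_le_two_pow
  have e3 : 2 ^ s ≤ 2 ^ s * 2 ^ s := by nlinarith
  have e₁ := exec_assign P (r := 3) (e := eM / .lit 2) (L := 2 * s + 7) (by omega)
    (by simp [eM, Ex.wf_div, Ex.wf_reg, Ex.wf_lit]) hσ (by
      simp only [eM, Ex.fits_div, Ex.fits_reg, Ex.fits_lit, hM, pow_succ 2 s]
      omega)
  have hv : (eM / Ex.lit 2).ev σ = 2 ^ s := by
    simp only [eM, Ex.ev_div, Ex.ev_reg, Ex.ev_lit, hM, pow_succ]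
    omega
  rw [hv] at e₁
  obtain ⟨σ₂, e₂, r₂, H₂, f₂⟩ := exec_prods hP (σ := σ.setReg 3 (2 ^ s)) (A := A) (B := B)
    (L := 2 * s + 7) (hσ.setReg (by omega) _) (by simp [State.setReg])
    (by simpa [State.setReg] using hI) (by simpa [State.setReg] using h5) hL hA hB 6 le_rfl
  obtain ⟨σ₃, e₃, r₃, f₃, H₃, g₃⟩ := exec_gather P (L := 2 * s + 7)
    ((hσ.setReg (by omega) _).of_reg_eq r₂) (by simp [r₂, State.setReg])
    (by simpa [r₂, State.setReg] using hI) hL H₂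
  rw [r₂] at r₃
  have h33 : σ₃.reg 3 = 2 ^ s := by simp [r₃, State.setReg]
  have e₄ := exec_assign P (σ := σ₃) (r := 3) (e := eM * .lit 2) (L := 2 * s + 7) (by omega)
    (by simp [eM, Ex.wf_mul, Ex.wf_reg, Ex.wf_lit]) ((hσ.setReg (by omega) _).of_reg_eq r₃) (by
      simp only [eM, Ex.fits_mul, Ex.fits_reg, Ex.fits_lit, Ex.ev_reg, Ex.ev_lit, h33]
      omega)
  have hv₄ : (eM * Ex.lit 2).ev σ₃ = 2 ^ (s + 1) := by
    simp only [eM, Ex.ev_mul, Ex.ev_reg, Ex.ev_lit, h33, pow_succ]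
  rw [hv₄] at e₄
  refine ⟨σ₃.setReg 3 (2 ^ (s + 1)), e₁.then (e₂.then (e₃.then e₄ le_rfl) le_rfl) ?_, ?_, H₃, ?_⟩
  · have h4 : (4 : ℕ) ^ s = 2 ^ s * 2 ^ s := by
      rw [← mul_pow]; norm_num
    have h1 : 1 ≤ (2 ^ s * 2 ^ s) := by omega
    simp only [Ex.nodes_div, Ex.nodes_mul, Ex.nodes_lit, Ex.nodes_reg, eM,
      show 1 + (2 * s + 7) = 2 * s + 8 by omega, h4]
    have h2 : 1 ≤ (2 * s + 8) ^ 2 := Nat.one_le_iff_ne_zero.2 (by positivity)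
    generalize 2 ^ s * 2 ^ s = N at *
    generalize (2 * s + 8) ^ 2 = W at *
    nlinarith [Nat.mul_le_mul h1 h2, Nat.mul_le_mul_right W h1]
  · simp [State.setReg, r₃, ← hM]
  · intro k a h₁ h₂
    rw [hsq] at h₁ h₂
    have e : (σ₃.setReg 3 (2 ^ (s + 1))).mem k a = σ₂.mem k a := by
      rcases eq_or_ne k 5 with rfl | h
      · exact g₃ a (by omega)
      · exact congrFun (f₃ k h) a
    rw [e, f₂ k a (by omega)]
    rfl

/-- Induction on `s`. For `s = 0` the only cell is at address 1, the condition on the disjunction is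
void, and the product is one of two bits. For larger `s` the test register is reset before the
recursive case, since the specification of the calls assumes it to be zero. -/
theorem mulSpec {P : Program} (hP : P.procs.getD 0 .skip = mulCmd) (s : ℕ) :
    MulSpec P s (mulTime s) := by
  induction s with
  | zero =>
    intro σ A B hσ hM hI h5 hA hB
    have e₁ := exec_assign P (r := 5) (e := .bin .lt (.lit 1) eM) (L := 1) (by omega)
      (by simp [eM, Ex.Wf]) hσ (by simp [eM, Ex.Fits, hM, Ex.ev, Op.eval])
    have hv : (Ex.bin .lt (.lit 1) eM).ev σ = 0 := by
      simp [eM, Ex.ev, Op.eval, hM]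
    have hs : σ.setReg 5 0 = σ := by
      simp [State.setReg, ← h5]
    rw [hv, hs] at e₁
    have hA' : σ.mem 3 1 = (A 0 0).val := by simpa [bval] using hA 0 0
    have hB' : σ.mem 4 1 = (B 0 0).val := by simpa [bval] using hB 0 0
    have hAle := zmod_two_val_le (A 0 0)
    have hBle := zmod_two_val_le (B 0 0)
    have hAB : (A 0 0).val * (B 0 0).val ≤ 1 := Nat.mul_le_mul hAle hBle
    have e₂ := exec_put P (k := 5) (e₁ := .lit 1) (e₂ := .get 3 (.lit 1) * .get 4 (.lit 1))
      (L := 1) (σ := σ) trivial (by simp [Ex.wf_mul, Ex.wf_get, Ex.wf_lit]) hσ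
      (by simp [Ex.fits_lit]) (by
        simp only [Ex.fits_mul, Ex.fits_get, Ex.fits_lit, Ex.ev_get, Ex.ev_lit, hA', hB']
        omega)
    refine ⟨_, exec_call (by
      rw [hP]
      exact e₁.then (exec_ite_false h5 e₂ le_rfl) le_rfl) ?_, ?_, ?_, ?_⟩
    · simp [Ex.nodes, eM, mulTime]
    · rfl
    · intro x z
      have hx : x = 0 := Subsingleton.elim _ _
      have hz : z = 0 := Subsingleton.elim _ _
      subst hx hz
      simp only [Ex.ev_mul, Ex.ev_get, Ex.ev_lit, hA', hB', State.setMem, bval, pow_zero,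
        mul_one, add_zero, Function.update_self, pseudoMul]
      have : ∀ u v : ZMod 2, u.val * v.val = (u * v).val := by decide
      rw [this]
      congr 1
      simp
      rfl
    · intro k a h₁ h₂
      simp only [State.setMem]
      rcases eq_or_ne k 5 with rfl | h
      · rw [Function.update_self, Function.update_of_ne]
        rw [Ex.ev_lit]
        simp at h₂
        omega
      · rw [Function.update_of_ne h]
  | succ s ih =>
    intro σ A B hσ hM hI h5 hA hB
    have hs0 : 1 ≤ 2 ^ s := Nat.one_le_two_pow
    have h64 : 2 ^ (2 * s + 7) = 128 * (2 ^ s * 2 ^ s) := by ring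
    have e₁ := exec_assign P (r := 5) (e := .bin .lt (.lit 1) eM) (L := 2 * s + 7) (by omega)
      (by simp [eM, Ex.Wf]) hσ (by
        have : 2 ^ s ≤ 2 ^ s * 2 ^ s := by nlinarith
        simp only [eM, Ex.Fits, hM, Ex.ev, Op.eval, pow_succ 2 s]
        rw [h64]
        generalize 2 ^ s = M at *
        generalize M * M = N at *
        refine ⟨by omega, by omega, ?_⟩
        split_ifs <;> omega)
    have hv : (Ex.bin .lt (.lit 1) eM).ev σ = 1 := by
      simp only [eM, Ex.ev, Op.eval, hM, pow_succ]
      rw [if_pos (by omega)]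
    rw [hv] at e₁
    have e₂ := exec_assign P (σ := σ.setReg 5 1) (r := 5) (e := .lit 0) (L := 2 * s + 7) (by omega)
      trivial (hσ.setReg (by omega) _) (by simp [Ex.fits_lit])
    have hs : (σ.setReg 5 1).setReg 5 ((Ex.lit 0).ev (σ.setReg 5 1)) = σ := by
      simp [State.setReg, Ex.ev_lit, ← h5]
    rw [hs] at e₂
    obtain ⟨σ', e₃, r₃, H₃, f₃⟩ := exec_rec ih hσ hM hI h5 hA hB
    refine ⟨σ', exec_call (by
      rw [hP]
      exact e₁.then (exec_ite_true (by simp [State.setReg]) (e₂.then e₃ le_rfl) le_rfl)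
        le_rfl) ?_, r₃, H₃, f₃⟩
    have h1 : (σ.setReg 5 1).reg 5 = 1 := by simp [State.setReg]
    have h2 : 1 ≤ 4 ^ s * (2 * s + 8) ^ 2 := Nat.one_le_iff_ne_zero.2 (by positivity)
    have h3 : 1 ≤ 4 ^ s := Nat.one_le_iff_ne_zero.2 (by positivity)
    have h4 : (2 * s + 8) ^ 2 ≤ 4 ^ s * (2 * s + 8) ^ 2 := Nat.le_mul_of_pos_left _ h3
    rw [h1]
    simp only [Ex.nodes, eM, mulTime, Nat.size_one, show 1 + (2 * s + 7) = 2 * s + 8 by omega]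
    omega

/-- The time of the recursive procedure is of order `6 ^ s`. -/
theorem mulTime_le (s : ℕ) : mulTime s ≤ 10 ^ 9 * 6 ^ s := by
  have h5 : ∀ s : ℕ, 4 ^ s * (2 * s + 8) ^ 2 ≤ 2000 * 5 ^ s := by
    intro s
    -- For small `s` the square alone grows by more than the factor 5/4; the added linear terms slow
    -- the relative growth enough for the induction to close.
    have key : ∀ s : ℕ, 4 ^ s * ((2 * s + 8) ^ 2 + 80 * s + 1000) ≤ 2000 * 5 ^ s := by
      intro s
      induction s with
      | zero => norm_num
      | succ s ih =>
        rw [pow_succ 5, pow_succ 4]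
        have h4 : 0 < 4 ^ s := by positivity
        have : 4 * ((2 * (s + 1) + 8) ^ 2 + 80 * (s + 1) + 1000) ≤
            5 * ((2 * s + 8) ^ 2 + 80 * s + 1000) := by nlinarith
        nlinarith [Nat.mul_le_mul_left (4 ^ s) this]
    exact (Nat.mul_le_mul_left _ (by omega)).trans (key s)
  -- The extra summand absorbs the inhomogeneous term, which is at most 50000·2000·5^s = 10⁸·5^s:
  -- indeed 10⁸·5^s + 10⁸·5^(s+1) = 6·10⁸·5^s.
  have key : ∀ s : ℕ, mulTime s + 10 ^ 8 * 5 ^ s ≤ 10 ^ 9 * 6 ^ s := by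
    intro s
    induction s with
    | zero => norm_num [mulTime]
    | succ s ih =>
      have := h5 s
      rw [mulTime, pow_succ 5, pow_succ 6]
      omega
  exact (Nat.le_add_right _ _).trans (key s)

end BitRAM

namespace BitRAM
open BMM

/-! ### The choice of the parameter -/

/-- Compute `2 ^ s` in register 3. -/
def prepCmd (C : ℕ) : Cmd :=
  .seq (assign 6 (.reg 0 * .reg 1 * .reg 2)) (.seq (assign 7 (.reg 6))
    (.seq (.loop 7 (.seq (assign 7 (.reg 7 / .lit 2)) (assign 8 (.reg 8 + .lit 1))))
      (.seq (assign 9 (.lit 1)) (.seq (assign 3 (.lit 1))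
        (.seq (assign 10 (.lit C * .reg 6 * .reg 8)) (.seq (assign 11 (.bin .lt (.reg 9) (.reg 10)))
          (.seq (.loop 11 (.seq (assign 9 (.reg 9 * .lit 7)) (.seq (assign 3 (.reg 3 * .lit 2))
            (assign 11 (.bin .lt (.reg 9) (.reg 10))))))
            (assign 12 (.lit 2)))))))))

theorem exec_size_loop (P : Program) {σ : State} {p L : ℕ} (hσ : Clean σ) (h7 : σ.reg 7 = p)
    (h8 : σ.reg 8 = 0) (hL : 2 * p < 2 ^ L) (hp : 1 ≤ p) :
    DExec P (.loop 7 (.seq (assign 7 (.reg 7 / .lit 2)) (assign 8 (.reg 8 + .lit 1)))) σ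
      ((σ.setReg 7 0).setReg 8 p.size) (1 + L * (1 + L + 49 * (1 + L) ^ 2)) := by
  have hsz : p.size ≤ L := size_le_of_lt (by omega)
  have hsp : p.size ≤ p := Nat.size_le.2 Nat.lt_two_pow_self
  have h := exec_loop (P := P) (r := 7)
    (p := .seq (assign 7 (.reg 7 / .lit 2)) (assign 8 (.reg 8 + .lit 1)))
    (T := 49 * (1 + L) ^ 2) (L := L) p.size
    (fun k => (σ.setReg 7 (p / 2 ^ k)).setReg 8 k) (by
      intro k hk
      have hk' : 2 ^ k ≤ p := Nat.lt_size.1 hk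
      have hpos : 0 < p / 2 ^ k := Nat.div_pos hk' (by positivity)
      have hle : p / 2 ^ k ≤ p := Nat.div_le_self _ _
      have hr7 : ((σ.setReg 7 (p / 2 ^ k)).setReg 8 k).reg 7 = p / 2 ^ k := by
        simp [State.setReg]
      have hc : Clean ((σ.setReg 7 (p / 2 ^ k)).setReg 8 k) :=
        (hσ.setReg (by omega) _).setReg (by omega) _
      rw [hr7]
      refine ⟨hpos.ne', size_le_of_lt (by omega), ?_⟩
      have e₁ := exec_assign P (r := 7) (e := .reg 7 / .lit 2) (L := L) (by omega)
        (by simp [Ex.wf_div, Ex.wf_reg, Ex.wf_lit]) hc (by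
          rw [Ex.fits_div, Ex.fits_reg, Ex.fits_lit, hr7]; omega)
      have e₂ := exec_assign P
        (σ := ((σ.setReg 7 (p / 2 ^ k)).setReg 8 k).setReg 7 (p / 2 ^ (k + 1)))
        (r := 8) (e := .reg 8 + .lit 1) (L := L) (by omega)
        (by simp [Ex.wf_add, Ex.wf_reg, Ex.wf_lit]) (hc.setReg (by omega) _) (by
          simp only [Ex.fits_add, Ex.fits_reg, Ex.fits_lit, Ex.ev_reg, Ex.ev_lit]
          simp [State.setReg]
          omega)
      rw [show (Ex.reg 7 / Ex.lit 2).ev ((σ.setReg 7 (p / 2 ^ k)).setReg 8 k) = p / 2 ^ (k + 1) by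
        rw [Ex.ev_div, Ex.ev_reg, Ex.ev_lit, hr7, pow_succ, Nat.div_div_eq_div_mul]] at e₁
      have hs : ∀ a v w : ℕ, (((σ.setReg 7 a).setReg 8 v).setReg 7 w).setReg 8 (v + 1) =
          (σ.setReg 7 w).setReg 8 (v + 1) := by
        intro a v w
        simp only [State.setReg, State.mk.injEq, and_true]
        funext j
        by_cases h1 : j = 8
        · subst h1; simp
        · by_cases h2 : j = 7
          · subst h2; simp
          · simp [h1, h2]
      have hv : (Ex.reg 8 + Ex.lit 1).ev
          (((σ.setReg 7 (p / 2 ^ k)).setReg 8 k).setReg 7 (p / 2 ^ (k + 1))) = k + 1 := by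
        rw [Ex.ev_add, Ex.ev_reg, Ex.ev_lit]
        simp [State.setReg]
      rw [hv, hs] at e₂
      refine e₁.then e₂ ?_
      simp only [Ex.nodes_div, Ex.nodes_add, Ex.nodes_lit, Ex.nodes_reg]
      nlinarith) (by
      have : p / 2 ^ p.size = 0 := Nat.div_eq_of_lt (Nat.lt_size_self p)
      simp [State.setReg, this])
  have h₀ : (σ.setReg 7 (p / 2 ^ 0)).setReg 8 0 = σ := by
    rw [pow_zero, Nat.div_one]
    simp [State.setReg, ← h7, ← h8]
  have h₁ : p / 2 ^ p.size = 0 := Nat.div_eq_of_lt (Nat.lt_size_self p)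
  rw [h₀, h₁] at h
  exact Exec.mono h (by
    have := Nat.mul_le_mul_right (1 + L + 49 * (1 + L) ^ 2) hsz
    omega)

/-- Powers of 7 and of 2 are raised in lockstep until the former reaches `Q`. The exponent itself is
never needed, only the dimension `2 ^ s`. -/
theorem exec_pow_loop (P : Program) {σ : State} {Q L : ℕ} (hσ : Clean σ) (h9 : σ.reg 9 = 1)
    (h3 : σ.reg 3 = 1) (h10 : σ.reg 10 = Q) (h11 : σ.reg 11 = if 1 < Q then 1 else 0)
    (hL : 7 * Q < 2 ^ L) (hQ : 1 ≤ Q) :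
    DExec P (.loop 11 (.seq (assign 9 (.reg 9 * .lit 7)) (.seq (assign 3 (.reg 3 * .lit 2))
            (assign 11 (.bin .lt (.reg 9) (.reg 10)))))) σ
      (((σ.setReg 9 (7 ^ Nat.clog 7 Q)).setReg 3 (2 ^ Nat.clog 7 Q)).setReg 11 0)
      (1 + L * (1 + L + 75 * (1 + L) ^ 2)) := by
  have hlt : ∀ k, k < Nat.clog 7 Q → 7 ^ k < Q := fun k hk =>
    (Nat.lt_clog_iff_pow_lt (by norm_num)).1 hk
  have hge : Q ≤ 7 ^ Nat.clog 7 Q := Nat.le_pow_clog (by norm_num) Q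
  have hp27 : ∀ k : ℕ, 2 ^ k ≤ 7 ^ k := fun k => Nat.pow_le_pow_left (by norm_num) k
  -- The number of rounds is at most `L` because 2^clog ≤ 7^clog < 7Q < 2^L.
  have hsL : Nat.clog 7 Q ≤ L := by
    rcases Nat.eq_zero_or_pos (Nat.clog 7 Q) with h | h
    · omega
    · have h1 := hlt (Nat.clog 7 Q - 1) (by omega)
      have h2 : 7 ^ Nat.clog 7 Q = 7 * 7 ^ (Nat.clog 7 Q - 1) := by
        rw [← pow_succ', Nat.sub_add_cancel h]
      have h4 := hp27 (Nat.clog 7 Q)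
      exact ((Nat.pow_lt_pow_iff_right (a := 2) (by norm_num)).1 (by omega)).le
  have h := exec_loop (P := P) (r := 11)
    (p := .seq (assign 9 (.reg 9 * .lit 7)) (.seq (assign 3 (.reg 3 * .lit 2))
            (assign 11 (.bin .lt (.reg 9) (.reg 10)))))
    (T := 75 * (1 + L) ^ 2) (L := L) (Nat.clog 7 Q)
    (fun k => ((σ.setReg 9 (7 ^ k)).setReg 3 (2 ^ k)).setReg 11 (if 7 ^ k < Q then 1 else 0)) (by
      intro k hk
      have hk' := hlt k hk
      have hk2 := hp27 k
      have hc : Clean (((σ.setReg 9 (7 ^ k)).setReg 3 (2 ^ k)).setReg 11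
          (if 7 ^ k < Q then 1 else 0)) :=
        ((hσ.setReg (by omega) _).setReg (by omega) _).setReg (by omega) _
      rw [if_pos hk'] at hc ⊢
      have h1L : 1 < 2 ^ L := by omega
      refine ⟨by simp [State.setReg], size_le_of_lt (by simpa [State.setReg] using h1L), ?_⟩
      generalize hτ : ((σ.setReg 9 (7 ^ k)).setReg 3 (2 ^ k)).setReg 11 1 = τ at hc
      have t9 : τ.reg 9 = 7 ^ k := by rw [← hτ]; simp [State.setReg]
      have t3 : τ.reg 3 = 2 ^ k := by rw [← hτ]; simp [State.setReg]
      have t10 : τ.reg 10 = Q := by rw [← hτ]; simp [State.setReg, h10]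
      have e₁ := exec_assign P (r := 9) (e := .reg 9 * .lit 7) (L := L) (by omega)
        (by simp [Ex.wf_mul, Ex.wf_reg, Ex.wf_lit]) hc (by
          rw [Ex.fits_mul, Ex.fits_reg, Ex.fits_lit, Ex.ev_reg, Ex.ev_lit, t9]; omega)
      rw [show (Ex.reg 9 * Ex.lit 7).ev τ = 7 ^ (k + 1) by
        rw [Ex.ev_mul, Ex.ev_reg, Ex.ev_lit, t9, pow_succ]] at e₁
      have e₂ := exec_assign P (σ := τ.setReg 9 (7 ^ (k + 1))) (r := 3) (e := .reg 3 * .lit 2)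
        (L := L) (by omega)
        (by simp [Ex.wf_mul, Ex.wf_reg, Ex.wf_lit]) (hc.setReg (by omega) _) (by
          have : (τ.setReg 9 (7 ^ (k + 1))).reg 3 = 2 ^ k := by simp [State.setReg, t3]
          rw [Ex.fits_mul, Ex.fits_reg, Ex.fits_lit, Ex.ev_reg, Ex.ev_lit, this]; omega)
      rw [show (Ex.reg 3 * Ex.lit 2).ev (τ.setReg 9 (7 ^ (k + 1))) = 2 ^ (k + 1) by
        simp [Ex.ev_mul, Ex.ev_reg, Ex.ev_lit, State.setReg, t3, pow_succ]] at e₂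
      generalize hυ : (τ.setReg 9 (7 ^ (k + 1))).setReg 3 (2 ^ (k + 1)) = υ at e₂
      have u9 : υ.reg 9 = 7 ^ (k + 1) := by rw [← hυ]; simp [State.setReg]
      have u10 : υ.reg 10 = Q := by rw [← hυ]; simp [State.setReg, t10]
      have e₃ := exec_assign P (σ := υ) (r := 11) (e := .bin .lt (.reg 9) (.reg 10))
        (L := L) (by omega) (by simp [Ex.Wf]) (by
          rw [← hυ]
          exact (hc.setReg (by omega) _).setReg (by omega) _) (by
          simp only [Ex.Fits, Ex.ev, Op.eval, u9, u10, pow_succ]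
          split_ifs <;> omega)
      rw [show (Ex.bin .lt (.reg 9) (.reg 10)).ev υ = if 7 ^ (k + 1) < Q then 1 else 0 by
        simp only [Ex.ev, Op.eval, u9, u10]] at e₃
      have hs : υ.setReg 11 (if 7 ^ (k + 1) < Q then 1 else 0) =
          ((σ.setReg 9 (7 ^ (k + 1))).setReg 3 (2 ^ (k + 1))).setReg 11
            (if 7 ^ (k + 1) < Q then 1 else 0) := by
        rw [← hυ, ← hτ]
        simp only [State.setReg, State.mk.injEq, and_true]
        funext j
        by_cases h1 : j = 11
        · subst h1; simp
        · by_cases h2 : j = 3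
          · subst h2; simp
          · by_cases h3 : j = 9
            · subst h3; simp
            · simp [h1, h2, h3]
      rw [hs] at e₃
      refine e₁.then (e₂.then e₃ le_rfl) ?_
      simp only [Ex.nodes]
      nlinarith) (by
      have : ¬ 7 ^ Nat.clog 7 Q < Q := by omega
      simp [State.setReg, this])
  have h₀ : ((σ.setReg 9 (7 ^ 0)).setReg 3 (2 ^ 0)).setReg 11 (if 7 ^ 0 < Q then 1 else 0) = σ := by
    rw [pow_zero, pow_zero, ← h11]
    simp only [State.setReg]
    have : Function.update σ.reg 9 1 = σ.reg := by rw [← h9]; simp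
    rw [this]
    have : Function.update σ.reg 3 1 = σ.reg := by rw [← h3]; simp
    rw [this]
    simp
  have h₁ : ¬ 7 ^ Nat.clog 7 Q < Q := by omega
  rw [h₀, if_neg h₁] at h
  exact Exec.mono h (by
    have := Nat.mul_le_mul_right (1 + L + 75 * (1 + L) ^ 2) hsL
    omega)

/-- The binary length of ψ₃ stands in for its logarithm: it is computable by repeated halving, and
positive even when ψ₃ = 1. The cubic cost comes from two loops of at most `L` rounds of arithmetic.
-/
theorem exec_prep (P : Program) {σ : State} {d₁ d₂ d₃ C L : ℕ} (hσ : Clean σ)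
    (h0 : σ.reg 0 = d₁) (h1 : σ.reg 1 = d₂) (h2 : σ.reg 2 = d₃) (h8 : σ.reg 8 = 0)
    (hd₁ : 1 ≤ d₁) (hd₂ : 1 ≤ d₂) (hd₃ : 1 ≤ d₃) (hC : 1 ≤ C)
    (hL : 7 * (C * (d₁ * d₂ * d₃) * (d₁ * d₂ * d₃).size) < 2 ^ L) :
    ∃ σ', DExec P (prepCmd C) σ σ' (500 * (1 + L) ^ 3) ∧ σ'.mem = σ.mem ∧ Clean σ' ∧
      σ'.reg 0 = d₁ ∧ σ'.reg 1 = d₂ ∧ σ'.reg 2 = d₃ ∧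
      σ'.reg 3 = 2 ^ Nat.clog 7 (C * (d₁ * d₂ * d₃) * (d₁ * d₂ * d₃).size) ∧
      σ'.reg 4 = σ.reg 4 ∧ σ'.reg 5 = σ.reg 5 ∧ σ'.reg 12 = 2 := by
  have hp : 1 ≤ d₁ * d₂ * d₃ := Nat.mul_pos (Nat.mul_pos hd₁ hd₂) hd₃
  have h12 : d₁ * d₂ ≤ d₁ * d₂ * d₃ := Nat.le_mul_of_pos_right _ hd₃
  have h12' : d₁ ≤ d₁ * d₂ := Nat.le_mul_of_pos_right _ hd₂
  have h12'' : d₂ ≤ d₁ * d₂ := Nat.le_mul_of_pos_left _ hd₁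
  have h13 : d₃ ≤ d₁ * d₂ * d₃ := Nat.le_mul_of_pos_left _ (Nat.mul_pos hd₁ hd₂)
  generalize hpe : d₁ * d₂ * d₃ = p at *
  have hsz : 1 ≤ p.size := Nat.size_pos.2 hp
  have hszp : p.size ≤ p := Nat.size_le.2 Nat.lt_two_pow_self
  have hCp : p ≤ C * p := Nat.le_mul_of_pos_left _ hC
  have hCC : C ≤ C * p := Nat.le_mul_of_pos_right _ hp
  have hQ : C * p ≤ C * p * p.size := Nat.le_mul_of_pos_right _ hsz
  generalize hQe : C * p * p.size = Q at *
  have e₁ := exec_assign P (r := 6) (e := .reg 0 * .reg 1 * .reg 2) (L := L) (by omega)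
    (by simp [Ex.wf_mul, Ex.wf_reg]) hσ (by
      simp only [Ex.fits_mul, Ex.fits_reg, Ex.ev_mul, Ex.ev_reg, h0, h1, h2, hpe]
      omega)
  rw [show (Ex.reg 0 * Ex.reg 1 * Ex.reg 2).ev σ = p by
    simp only [Ex.ev_mul, Ex.ev_reg, h0, h1, h2, hpe]] at e₁
  have c₁ := hσ.setReg (r := 6) (by omega) p
  have e₂ := exec_assign P (r := 7) (e := .reg 6) (L := L) (by omega) (by simp [Ex.wf_reg]) c₁ (by
    simp only [Ex.fits_reg, State.setReg, Function.update_self]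
    omega)
  rw [show (Ex.reg 6).ev (σ.setReg 6 p) = p by simp [Ex.ev_reg, State.setReg]] at e₂
  have c₂ := c₁.setReg (r := 7) (by omega) p
  have e₃ := exec_size_loop P (p := p) (L := L) c₂ (by simp [State.setReg])
    (by simpa [State.setReg] using h8) (by omega) hp
  have c₃ := (c₂.setReg (r := 7) (by omega) 0).setReg (r := 8) (by omega) p.size
  generalize hσ₃ : (((σ.setReg 6 p).setReg 7 p).setReg 7 0).setReg 8 p.size = σ₃ at e₃ c₃
  have r₃ : σ₃.mem = σ.mem ∧ σ₃.reg 0 = d₁ ∧ σ₃.reg 1 = d₂ ∧ σ₃.reg 2 = d₃ ∧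
      σ₃.reg 4 = σ.reg 4 ∧ σ₃.reg 5 = σ.reg 5 ∧ σ₃.reg 6 = p ∧ σ₃.reg 8 = p.size := by
    rw [← hσ₃]
    simp [State.setReg, h0, h1, h2]
  have e₄ := exec_assign P (r := 9) (e := .lit 1) (L := L) (by omega) trivial c₃ (by
    simp only [Ex.fits_lit]; omega)
  rw [Ex.ev_lit] at e₄
  have c₄ := c₃.setReg (r := 9) (by omega) 1
  have e₅ := exec_assign P (r := 3) (e := .lit 1) (L := L) (by omega) trivial c₄ (by
    simp only [Ex.fits_lit]; omega)
  rw [Ex.ev_lit] at e₅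
  have c₅ := c₄.setReg (r := 3) (by omega) 1
  have e₆ := exec_assign P (r := 10) (e := .lit C * .reg 6 * .reg 8) (L := L) (by omega)
    (by simp [Ex.wf_mul, Ex.wf_reg, Ex.wf_lit]) c₅ (by
      simp only [Ex.fits_mul, Ex.fits_reg, Ex.fits_lit, Ex.ev_mul, Ex.ev_reg, Ex.ev_lit]
      simp only [State.setReg]
      simp [r₃, hQe]
      omega)
  rw [show (Ex.lit C * Ex.reg 6 * Ex.reg 8).ev ((σ₃.setReg 9 1).setReg 3 1) = Q by
    simp only [Ex.ev_mul, Ex.ev_reg, Ex.ev_lit]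
    simp [State.setReg, r₃, hQe]] at e₆
  have c₆ := c₅.setReg (r := 10) (by omega) Q
  have e₇ := exec_assign P (r := 11) (e := .bin .lt (.reg 9) (.reg 10)) (L := L) (by omega)
    (by simp [Ex.Wf]) c₆ (by
      have q9 : (((σ₃.setReg 9 1).setReg 3 1).setReg 10 Q).reg 9 = 1 := by simp [State.setReg]
      have q10 : (((σ₃.setReg 9 1).setReg 3 1).setReg 10 Q).reg 10 = Q := by simp [State.setReg]
      simp only [Ex.Fits, Ex.ev, Op.eval, q9, q10]
      split_ifs <;> omega)
  rw [show (Ex.bin .lt (.reg 9) (.reg 10)).ev (((σ₃.setReg 9 1).setReg 3 1).setReg 10 Q) =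
      if 1 < Q then 1 else 0 by simp [Ex.ev, Op.eval, State.setReg]] at e₇
  have c₇ := c₆.setReg (r := 11) (by omega) (if 1 < Q then 1 else 0)
  have e₈ := exec_pow_loop P (Q := Q) (L := L) c₇ (by simp [State.setReg])
    (by simp [State.setReg]) (by simp [State.setReg]) (by simp [State.setReg]) (by omega)
    (by omega)
  have c₈ := ((c₇.setReg (r := 9) (by omega) (7 ^ Nat.clog 7 Q)).setReg (r := 3) (by omega)
    (2 ^ Nat.clog 7 Q)).setReg (r := 11) (by omega) 0
  have e₉ := exec_assign P (r := 12) (e := .lit 2) (L := L) (by omega) trivial c₈ (by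
    simp only [Ex.fits_lit]; omega)
  rw [Ex.ev_lit] at e₉
  refine ⟨_, e₁.then (e₂.then (e₃.then (e₄.then (e₅.then (e₆.then (e₇.then (e₈.then e₉ le_rfl)
    le_rfl) le_rfl) le_rfl) le_rfl) le_rfl) le_rfl) ?_, ?_, c₈.setReg (by omega) 2, ?_⟩
  · simp only [Ex.nodes]
    ring_nf
    nlinarith
  · exact r₃.1
  · simp [State.setReg, r₃]

end BitRAM

namespace BitRAM
open BMM

/-! ### The main program -/

/-- Blow up the first matrix. -/
def buildACmd : Cmd :=
  sweep 4 (eM * eM) 3 (eM * eM + eI) (.get 0 (.get 16 (eI / eM) * .reg 2 + .get 18 (eI % eM)))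

/-- Blow up the second matrix, and thin it out. -/
def buildBCmd : Cmd :=
  sweep 4 (eM * eM) 4 (eM * eM + eI)
    (.get 1 (.get 18 (eI / eM) * .reg 1 + .get 17 (eI % eM)) * .get 19 eI)

/-- The cell of the output to which an entry of the pseudo-product contributes. -/
def outAddr : Ex := .get 16 (eI / eM) * .reg 1 + .get 17 (eI % eM)

/-- Collect the entries of the pseudo-product. -/
def collectCmd : Cmd :=
  sweep 4 (eM * eM) 2 outAddr (.get 2 outAddr + .get 5 (eM * eM + eI))

/-- The deterministic part of the algorithm. -/
def estimateCmd : Cmd := .seq buildACmd (.seq buildBCmd (.seq (.call 0) collectCmd))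

theorem row_major_inj {q i i' j j' : ℕ} (hj : j < q) (hj' : j' < q)
    (h : i * q + j = i' * q + j') : i = i' ∧ j = j' := by
  have h1 : (i * q + j) / q = i := by
    rw [mul_comm, Nat.mul_add_div (by omega), Nat.div_eq_of_lt hj, add_zero]
  have h2 : (i' * q + j') / q = i' := by
    rw [mul_comm, Nat.mul_add_div (by omega), Nat.div_eq_of_lt hj', add_zero]
  have : i = i' := by rw [← h1, h, h2]
  subst this
  exact ⟨rfl, by omega⟩

theorem encode_apply {p q : ℕ} (M : Matrix (Fin p) (Fin q) Bool) (i : Fin p) (j : Fin q) :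
    encode M (i.val * q + j.val) = if M i j = true then 1 else 0 := by
  unfold encode
  congr 1
  refine propext ⟨?_, fun h => ⟨i, j, rfl, h⟩⟩
  rintro ⟨i', j', h, hM⟩
  obtain ⟨h1, h2⟩ := row_major_inj j.2 j'.2 h
  rwa [Fin.ext h1, Fin.ext h2]

theorem row_major_lt {p q i j : ℕ} (hi : i < p) (hj : j < q) : i * q + j < p * q := by
  nlinarith

/-- The state after the random choices. -/
structure Ready {s d₁ d₂ d₃ : ℕ} (σ : State) (A : Matrix (Fin d₁) (Fin d₃) Bool)
    (B : Matrix (Fin d₃) (Fin d₂) Bool) (ω : Sample s d₁ d₂ d₃) : Prop where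
  clean : Clean σ
  reg0 : σ.reg 0 = d₁
  reg1 : σ.reg 1 = d₂
  reg2 : σ.reg 2 = d₃
  reg3 : σ.reg 3 = 2 ^ s
  reg4 : σ.reg 4 = 0
  reg5 : σ.reg 5 = 0
  mem0 : σ.mem 0 = encode A
  mem1 : σ.mem 1 = encode B
  mem2 : σ.mem 2 = 0
  mem16 : ∀ x : Bits s, σ.mem 16 (bval x) = ω.1 x
  mem17 : ∀ x : Bits s, σ.mem 17 (bval x) = ω.2.1 x
  mem18 : ∀ x : Bits s, σ.mem 18 (bval x) = ω.2.2.1 x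
  mem19 : ∀ z y : Bits s, σ.mem 19 (bval z * 2 ^ s + bval y) = (ω.2.2.2 z y).val

/-- The first blown-up matrix. -/
def blowA {s d₁ d₂ d₃ : ℕ} (A : Matrix (Fin d₁) (Fin d₃) Bool) (ω : Sample s d₁ d₂ d₃) :
    Matrix (Bits s) (Bits s) (ZMod 2) :=
  fun x z => if A (ω.1 x) (ω.2.2.1 z) = true then 1 else 0

/-- The second blown-up matrix. -/
def blowB {s d₁ d₂ d₃ : ℕ} (B : Matrix (Fin d₃) (Fin d₂) Bool) (ω : Sample s d₁ d₂ d₃) :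
    Matrix (Bits s) (Bits s) (ZMod 2) :=
  fun z y => (if B (ω.2.2.1 z) (ω.2.1 y) = true then 1 else 0) * ω.2.2.2 z y

theorem estimate_iff {s d₁ d₂ d₃ : ℕ} (A : Matrix (Fin d₁) (Fin d₃) Bool)
    (B : Matrix (Fin d₃) (Fin d₂) Bool) (ω : Sample s d₁ d₂ d₃) (i : Fin d₁) (j : Fin d₂) :
    estimate A B ω i j = true ↔
      ∃ x y, ω.1 x = i ∧ ω.2.1 y = j ∧ pseudoMul (blowA A ω) (blowB B ω) x y = 1 := by
  obtain ⟨f₁, f₂, f₃, D⟩ := ω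
  simp only [estimate, decide_eq_true_eq]
  rfl

/-- The random choices are already in memory, so this part is deterministic: two fills, one
pseudo-product, one sweep. The procedure leaves arrays below 3 and above 15 alone, so the tables of
the random maps are still available when the output is collected. -/
theorem exec_estimate {P : Program} (hP : P.procs.getD 0 .skip = mulCmd) {s d₁ d₂ d₃ L : ℕ}
    {σ : State} {A : Matrix (Fin d₁) (Fin d₃) Bool} {B : Matrix (Fin d₃) (Fin d₂) Bool}
    {ω : Sample s d₁ d₂ d₃} (h : Ready σ A B ω) (hL : 64 * (2 ^ s * 2 ^ s) ≤ 2 ^ L)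
    (h12 : d₁ * d₂ < 2 ^ L) (h13 : d₁ * d₃ < 2 ^ L) (h32 : d₃ * d₂ < 2 ^ L) (hd₁ : 1 ≤ d₁)
    (hd₂ : 1 ≤ d₂) (hd₃ : 1 ≤ d₃) :
    ∃ σ', DExec P estimateCmd σ σ'
        (mulTime s + 1000 * (2 ^ s * 2 ^ s + 1) * (1 + L) ^ 2) ∧
      ∀ (i : Fin d₁) (j : Fin d₂), σ'.mem 2 (i.val * d₂ + j.val) ≠ 0 ↔
        estimate A B ω i j = true := by
  have l1 : d₁ < 2 ^ L := lt_of_le_of_lt (Nat.le_mul_of_pos_right _ hd₂) h12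
  have l2 : d₂ < 2 ^ L := lt_of_le_of_lt (Nat.le_mul_of_pos_left _ hd₁) h12
  have l3 : d₃ < 2 ^ L := lt_of_le_of_lt (Nat.le_mul_of_pos_left _ hd₁) h13
  have h0 : 1 ≤ 2 ^ s := Nat.one_le_two_pow
  have e3 : 2 ^ s ≤ 2 ^ s * 2 ^ s := by nlinarith
  have hML : 2 ^ s < 2 ^ L := by
    generalize 2 ^ s = M at *
    generalize M * M = N at *
    omega
  have hNL : 2 ^ s * 2 ^ s < 2 ^ L := by omega
  have h1L : 1 < 2 ^ L := by omega
  have hsz := size_spec h.reg3 hL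
  have hinj : ∀ j < 2 ^ s * 2 ^ s, ∀ j' < 2 ^ s * 2 ^ s,
      2 ^ s * 2 ^ s + j = 2 ^ s * 2 ^ s + j' → j = j' := fun _ _ _ _ h => by omega
  -- the first matrix
  obtain ⟨σ₁, e₁, r₁, f₁, v₁, _⟩ := exec_fill P (i := 4) (k := 3) (e := eM * eM)
    (ea := eM * eM + eI) (ee := .get 0 (.get 16 (eI / eM) * .reg 2 + .get 18 (eI % eM)))
    (by omega) (by simp [eM, Ex.wf_mul, Ex.wf_reg])
    (by simp [eM, eI, Ex.wf_mul, Ex.wf_add, Ex.wf_reg])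
    (by simp [eM, eI, Ex.wf_mul, Ex.wf_add, Ex.wf_reg, Ex.wf_get, Ex.wf_div, Ex.wf_mod])
    h.clean h.reg4 hsz.1 hsz.2 (fun j => 2 ^ s * 2 ^ s + j)
    (fun j => (blowA A ω (bitsOf s (j / 2 ^ s)) (bitsOf s (j % 2 ^ s))).val) hinj (by
      intro j hj g hg
      have t3 : ((σ.setReg 4 j).withMem 3 g).reg 3 = 2 ^ s := by
        simp [State.withMem, State.setReg, h.reg3]
      have t4 : ((σ.setReg 4 j).withMem 3 g).reg 4 = j := by
        simp [State.withMem, State.setReg]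
      have t2 : ((σ.setReg 4 j).withMem 3 g).reg 2 = d₃ := by
        simp [State.withMem, State.setReg, h.reg2]
      have m0 : ((σ.setReg 4 j).withMem 3 g).mem 0 = encode A := by
        simp [State.withMem, State.setReg, h.mem0]
      have m16 : ((σ.setReg 4 j).withMem 3 g).mem 16 = σ.mem 16 := by
        simp [State.withMem, State.setReg]
      have m18 : ((σ.setReg 4 j).withMem 3 g).mem 18 = σ.mem 18 := by
        simp [State.withMem, State.setReg]
      generalize (σ.setReg 4 j).withMem 3 g = τ at *
      obtain ⟨x, z, hxz⟩ := exists_cells hj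
      have hb := baseAddr_spec t3 t4 hj hL
      have hlt := row_major_lt (ω.1 x).2 (ω.2.2.1 z).2
      have hlt' := le_trans (Nat.le_add_right ((ω.1 x : ℕ) * d₃) (ω.2.2.1 z)) hlt.le
      have hx := (ω.1 x).2
      have hz := (ω.2.2.1 z).2
      refine ⟨hb.1, ?_, hb.2, ?_⟩
      · simp only [Ex.fits_get, Ex.fits_add, Ex.fits_mul, Ex.fits_div, Ex.fits_mod, Ex.fits_reg,
          Ex.ev_get, Ex.ev_add, Ex.ev_mul, Ex.ev_div, Ex.ev_mod, Ex.ev_reg, eM, eI, t2, t3, t4, m0,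
          m16, m18, hxz, rows_div, rows_mod, h.mem16, h.mem18, encode_apply]
        have hxz' := rows_lt x z
        split_ifs <;> omega
      · simp only [Ex.ev_get, Ex.ev_add, Ex.ev_mul, Ex.ev_div, Ex.ev_mod, Ex.ev_reg, eM, eI, t2,
          t3, t4, m0, m16, m18, hxz, rows_div, rows_mod, h.mem16, h.mem18, encode_apply,
          bitsOf_bval, blowA]
        split_ifs <;> rfl)
  have H₁ : Holds σ₁ 3 (blowA A ω) := fun x z => by
    rw [v₁ _ (rows_lt x z), rows_div, rows_mod, bitsOf_bval, bitsOf_bval]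
  -- the second matrix
  have hsz₁ := size_spec (σ := σ₁) (by rw [r₁]; exact h.reg3) hL
  obtain ⟨σ₂, e₂, r₂, f₂, v₂, _⟩ := exec_fill P (i := 4) (k := 4) (e := eM * eM)
    (ea := eM * eM + eI)
    (ee := .get 1 (.get 18 (eI / eM) * .reg 1 + .get 17 (eI % eM)) * .get 19 eI)
    (by omega) (by simp [eM, Ex.wf_mul, Ex.wf_reg])
    (by simp [eM, eI, Ex.wf_mul, Ex.wf_add, Ex.wf_reg])
    (by simp [eM, eI, Ex.wf_mul, Ex.wf_add, Ex.wf_reg, Ex.wf_get, Ex.wf_div, Ex.wf_mod])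
    (h.clean.of_reg_eq r₁) (by rw [r₁]; exact h.reg4) hsz₁.1 hsz₁.2 (fun j => 2 ^ s * 2 ^ s + j)
    (fun j => (blowB B ω (bitsOf s (j / 2 ^ s)) (bitsOf s (j % 2 ^ s))).val) hinj (by
      intro j hj g hg
      have t3 : ((σ₁.setReg 4 j).withMem 4 g).reg 3 = 2 ^ s := by
        simp [State.withMem, State.setReg, r₁, h.reg3]
      have t4 : ((σ₁.setReg 4 j).withMem 4 g).reg 4 = j := by
        simp [State.withMem, State.setReg]
      have t1 : ((σ₁.setReg 4 j).withMem 4 g).reg 1 = d₂ := by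
        simp [State.withMem, State.setReg, r₁, h.reg1]
      have m1 : ((σ₁.setReg 4 j).withMem 4 g).mem 1 = encode B := by
        simp [State.withMem, State.setReg, h.mem1, f₁ 1]
      have m17 : ((σ₁.setReg 4 j).withMem 4 g).mem 17 = σ.mem 17 := by
        simp [State.withMem, State.setReg, f₁ 17]
      have m18 : ((σ₁.setReg 4 j).withMem 4 g).mem 18 = σ.mem 18 := by
        simp [State.withMem, State.setReg, f₁ 18]
      have m19 : ((σ₁.setReg 4 j).withMem 4 g).mem 19 = σ.mem 19 := by
        simp [State.withMem, State.setReg, f₁ 19]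
      generalize (σ₁.setReg 4 j).withMem 4 g = τ at *
      obtain ⟨z, y, hzy⟩ := exists_cells hj
      have hb := baseAddr_spec t3 t4 hj hL
      have hlt := row_major_lt (ω.2.2.1 z).2 (ω.2.1 y).2
      have hlt' := le_trans (Nat.le_add_right ((ω.2.2.1 z : ℕ) * d₂) (ω.2.1 y)) hlt.le
      have hy := (ω.2.1 y).2
      have hz := (ω.2.2.1 z).2
      have hD := zmod_two_val_le (ω.2.2.2 z y)
      refine ⟨hb.1, ?_, hb.2, ?_⟩
      · simp only [Ex.fits_get, Ex.fits_add, Ex.fits_mul, Ex.fits_div, Ex.fits_mod, Ex.fits_reg,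
          Ex.ev_get, Ex.ev_add, Ex.ev_mul, Ex.ev_div, Ex.ev_mod, Ex.ev_reg, eM, eI, t1, t3, t4, m1,
          m17, m18, m19, hzy, rows_div, rows_mod, h.mem17, h.mem18, h.mem19, encode_apply]
        have hzy' := rows_lt z y
        split_ifs <;> omega
      · simp only [Ex.ev_get, Ex.ev_add, Ex.ev_mul, Ex.ev_div, Ex.ev_mod, Ex.ev_reg, eM, eI, t1,
          t3, t4, m1, m17, m18, m19, hzy, rows_div, rows_mod, h.mem17, h.mem18, h.mem19,
          encode_apply, bitsOf_bval, blowB]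
        split_ifs
        · rw [one_mul, one_mul]
        · rw [zero_mul, zero_mul, ZMod.val_zero])
  have H₂ : Holds σ₂ 4 (blowB B ω) := fun x z => by
    rw [v₂ _ (rows_lt x z), rows_div, rows_mod, bitsOf_bval, bitsOf_bval]
  have H₁' : Holds σ₂ 3 (blowA A ω) := fun x z => by
    rw [f₂ 3 (by omega)]
    exact H₁ x z
  rw [r₁] at r₂
  -- the pseudo-product
  obtain ⟨σ₃, e₃, r₃, H₃, f₃⟩ := mulSpec hP s σ₂ _ _ (h.clean.of_reg_eq r₂)
    (by rw [r₂]; exact h.reg3) (by rw [r₂]; exact h.reg4) (by rw [r₂]; exact h.reg5) H₁' H₂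
  rw [r₂] at r₃
  have f₃' : ∀ k, (k < 3 ∨ 15 < k) → σ₃.mem k = σ.mem k := by
    intro k hk
    have : σ₃.mem k = σ₂.mem k := funext fun a => f₃ k a (by omega) (by omega)
    rw [this, f₂ k (by omega), f₁ k (by omega)]
  -- the output
  have hsz₃ := size_spec (σ := σ₃) (by rw [r₃]; exact h.reg3) hL
  obtain ⟨g, hg, e₄⟩ := exec_sweep P (i := 4) (k := 2) (e := eM * eM) (ea := outAddr)
    (ee := .get 2 outAddr + .get 5 (eM * eM + eI)) (by omega) (by simp [eM, Ex.wf_mul, Ex.wf_reg])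
    (by simp [outAddr, eM, eI, Ex.wf_mul, Ex.wf_add, Ex.wf_reg, Ex.wf_get, Ex.wf_div, Ex.wf_mod])
    (by simp [outAddr, eM, eI, Ex.wf_mul, Ex.wf_add, Ex.wf_reg, Ex.wf_get, Ex.wf_div, Ex.wf_mod])
    (h.clean.of_reg_eq r₃) (by rw [r₃]; exact h.reg4) hsz₃.1
    -- Several entries fall into one output cell, so the disjunction is accumulated as a count, of
    -- which only the vanishing matters. The first clause bounds the count by the number of indices
    -- treated and so keeps it within the word length.
    (fun j g => (∀ a, g a + j ≤ 2 ^ s * 2 ^ s) ∧ ∀ a, g a ≠ 0 ↔ ∃ x y : Bits s,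
      j ≤ bval x * 2 ^ s + bval y ∧ (ω.1 x : ℕ) * d₂ + (ω.2.1 y : ℕ) = a ∧
        pseudoMul (blowA A ω) (blowB B ω) x y = 1)
    (by
      rw [hsz₃.2, f₃' 2 (by omega), h.mem2]
      refine ⟨fun a => by simp, fun a => ?_⟩
      simp only [Pi.zero_apply, ne_eq, not_true_eq_false, false_iff]
      rintro ⟨x, y, hxy, -⟩
      exact absurd (rows_lt x y) (by omega)) (by
      intro j hj g hg
      rw [hsz₃.2] at hj
      have t3 : ((σ₃.setReg 4 j).withMem 2 g).reg 3 = 2 ^ s := by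
        simp [State.withMem, State.setReg, r₃, h.reg3]
      have t4 : ((σ₃.setReg 4 j).withMem 2 g).reg 4 = j := by
        simp [State.withMem, State.setReg]
      have t1 : ((σ₃.setReg 4 j).withMem 2 g).reg 1 = d₂ := by
        simp [State.withMem, State.setReg, r₃, h.reg1]
      have m16 : ((σ₃.setReg 4 j).withMem 2 g).mem 16 = σ.mem 16 := by
        simp [State.withMem, State.setReg, f₃' 16]
      have m17 : ((σ₃.setReg 4 j).withMem 2 g).mem 17 = σ.mem 17 := by
        simp [State.withMem, State.setReg, f₃' 17]
      have m2 : ((σ₃.setReg 4 j).withMem 2 g).mem 2 = g := by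
        simp [State.withMem]
      have m5 : ((σ₃.setReg 4 j).withMem 2 g).mem 5 = σ₃.mem 5 := by
        simp [State.withMem, State.setReg]
      generalize (σ₃.setReg 4 j).withMem 2 g = τ at *
      obtain ⟨x, y, hxy⟩ := exists_cells hj
      have hb := baseAddr_spec t3 t4 hj hL
      have hev : outAddr.ev τ =
          (ω.1 x : ℕ) * d₂ + (ω.2.1 y : ℕ) := by
        simp only [outAddr, Ex.ev_get, Ex.ev_add, Ex.ev_mul, Ex.ev_div, Ex.ev_mod, Ex.ev_reg, eM,
          eI, t1, t3, t4, m16, m17, hxy, rows_div, rows_mod, h.mem16, h.mem17]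
      have hlt := row_major_lt (ω.1 x).2 (ω.2.1 y).2
      have hlt' := le_trans (Nat.le_add_right ((ω.1 x : ℕ) * d₂) (ω.2.1 y)) hlt.le
      have hx := (ω.1 x).2
      have hy := (ω.2.1 y).2
      have hfit : outAddr.Fits τ L := by
        simp only [outAddr, Ex.fits_get, Ex.fits_add, Ex.fits_mul, Ex.fits_div, Ex.fits_mod,
          Ex.fits_reg, Ex.ev_get, Ex.ev_mul, Ex.ev_div, Ex.ev_mod, Ex.ev_reg, eM, eI,
          t1, t3, t4, m16, m17, hxy, rows_div, rows_mod, h.mem16, h.mem17]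
        have hxy' := rows_lt x y
        omega
      have hC := zmod_two_val_le (pseudoMul (blowA A ω) (blowB B ω) x y)
      have hev₂ : (Ex.get 2 outAddr + Ex.get 5 (eM * eM + eI)).ev τ = g ((ω.1 x : ℕ) * d₂ + (ω.2.1 y : ℕ)) +
            (pseudoMul (blowA A ω) (blowB B ω) x y).val := by
        rw [Ex.ev_add, Ex.ev_get, Ex.ev_get, hev, hb.2, m2, m5, hxy, H₃]
      refine ⟨hfit, ?_, ?_⟩
      · rw [Ex.fits_add, Ex.fits_get, Ex.fits_get, Ex.ev_get, Ex.ev_get, hev, hb.2, m2, m5]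
        have h3 := H₃ x y
        rw [← hxy] at h3
        rw [h3]
        have := hg.1 ((ω.1 x : ℕ) * d₂ + (ω.2.1 y : ℕ))
        exact ⟨⟨hfit, by omega⟩, ⟨hb.1, by omega⟩, by omega⟩
      · rw [hev, hev₂]
        constructor
        · intro a
          have := hg.1 a
          have := hg.1 ((ω.1 x : ℕ) * d₂ + (ω.2.1 y : ℕ))
          simp only [Function.update_apply]
          split_ifs <;> omega
        · intro a
          have hsplit : (∃ x' y' : Bits s, j ≤ bval x' * 2 ^ s + bval y' ∧
              (ω.1 x' : ℕ) * d₂ + (ω.2.1 y' : ℕ) = a ∧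
                pseudoMul (blowA A ω) (blowB B ω) x' y' = 1) ↔
              ((ω.1 x : ℕ) * d₂ + (ω.2.1 y : ℕ) = a ∧
                pseudoMul (blowA A ω) (blowB B ω) x y = 1) ∨ g a ≠ 0 := by
            rw [hg.2 a]
            constructor
            · rintro ⟨x', y', h1, h2, h3⟩
              rcases Nat.eq_or_lt_of_le h1 with h1 | h1
              · rw [hxy] at h1
                obtain ⟨h4, h5⟩ := row_major_inj (bval_lt y) (bval_lt y') h1
                rw [bval_injective h4, bval_injective h5]
                exact Or.inl ⟨h2, h3⟩
              · exact Or.inr ⟨x', y', h1, h2, h3⟩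
            · rintro (⟨h2, h3⟩ | ⟨x', y', h1, h2, h3⟩)
              · exact ⟨x, y, hxy.le, h2, h3⟩
              · exact ⟨x', y', by omega, h2, h3⟩
          rw [hsplit]
          have hv : (pseudoMul (blowA A ω) (blowB B ω) x y).val ≠ 0 ↔
              pseudoMul (blowA A ω) (blowB B ω) x y = 1 := by
            generalize pseudoMul (blowA A ω) (blowB B ω) x y = t
            revert t
            decide
          rw [← hv]
          rcases eq_or_ne a ((ω.1 x : ℕ) * d₂ + (ω.2.1 y : ℕ)) with rfl | hne
          · rw [Function.update_self]
            simp only [true_and]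
            omega
          · rw [Function.update_of_ne hne]
            simp [hne.symm])
  refine ⟨_, e₁.then (e₂.then (e₃.then e₄ le_rfl) le_rfl) ?_, ?_⟩
  · rw [hsz₃.2]
    simp only [sweepCost, Ex.nodes, Ex.nodes_add, Ex.nodes_div, outAddr, eM, eI]
    have : 1 ≤ (2 ^ s * 2 ^ s + 1) * (1 + L) ^ 2 := Nat.one_le_iff_ne_zero.2 (by positivity)
    nlinarith
  · intro i j
    rw [estimate_iff]
    simp only [State.withMem, Function.update_self]
    rw [hg.2]
    constructor
    · rintro ⟨x, y, -, h2, h3⟩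
      obtain ⟨h4, h5⟩ := row_major_inj (ω.2.1 y).2 j.2 h2
      exact ⟨x, y, Fin.ext h4, Fin.ext h5, h3⟩
    · rintro ⟨x, y, rfl, rfl, h3⟩
      exact ⟨x, y, Nat.zero_le _, rfl, h3⟩

end BitRAM

/-! ### The random choices, and the law of the output -/

namespace BitRAM
open BMM

/-- The memory determines the sample. This allows the final state to be taken as a function of the
state after the draws, which is the form of continuation that `Exec` composes with. -/
theorem Ready.sample_unique {s d₁ d₂ d₃ : ℕ} {σ : State} {A : Matrix (Fin d₁) (Fin d₃) Bool}
    {B : Matrix (Fin d₃) (Fin d₂) Bool} {ω ω' : Sample s d₁ d₂ d₃} (h : Ready σ A B ω)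
    (h' : Ready σ A B ω') : ω = ω' := by
  refine Prod.ext (funext fun x => Fin.ext ?_) (Prod.ext (funext fun x => Fin.ext ?_)
    (Prod.ext (funext fun x => Fin.ext ?_) (funext fun z => funext fun y =>
      ZMod.val_injective 2 ?_)))
  · rw [← h.mem16, h'.mem16]
  · rw [← h.mem17, h'.mem17]
  · rw [← h.mem18, h'.mem18]
  · rw [← h.mem19, h'.mem19]

/-- The main program: choose the parameter, make the random choices, compute the estimate. -/
def mainCmd (C : ℕ) : Cmd :=
  .seq (prepCmd C) (.seq (randFill 4 eM 5 16 0) (.seq (randFill 4 eM 5 17 1)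
    (.seq (randFill 4 eM 5 18 2) (.seq (randFill 4 (eM * eM) 5 19 12) estimateCmd))))

/-- The program, with its recursive procedure. -/
def opportunistic (C : ℕ) : Program := ⟨[mulCmd], mainCmd C⟩

/-- Random arrays as random functions on bit vectors. -/
noncomputable def tableEquiv (s d : ℕ) : (Fin (2 ^ s) → Fin d) ≃ (Bits s → Fin d) :=
  Equiv.arrowCongr (bitsEquiv s).symm (Equiv.refl _)

/-- A random array as a random binary matrix. -/
noncomputable def tableEquiv₂ (s : ℕ) :
    (Fin (2 ^ s * 2 ^ s) → Fin 2) ≃ (Bits s → Bits s → ZMod 2) :=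
  (Equiv.arrowCongr (((Equiv.prodCongr (bitsEquiv s) (bitsEquiv s)).trans
    finProdFinEquiv).symm) (Equiv.refl (Fin 2))).trans (Equiv.curry _ _ _)

/-- The random arrays as a sample. -/
noncomputable def sampleEquiv (s d₁ d₂ d₃ : ℕ) :
    ((Fin (2 ^ s) → Fin d₁) × (Fin (2 ^ s) → Fin d₂) × (Fin (2 ^ s) → Fin d₃) ×
      (Fin (2 ^ s * 2 ^ s) → Fin 2)) ≃ Sample s d₁ d₂ d₃ :=
  Equiv.prodCongr (tableEquiv s d₁) (Equiv.prodCongr (tableEquiv s d₂)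
    (Equiv.prodCongr (tableEquiv s d₃) (tableEquiv₂ s)))

theorem overlay_table {s d : ℕ} (v : Fin (2 ^ s) → Fin d) (g : ℕ → ℕ) (x : Bits s) :
    overlay v g (bval x) = tableEquiv s d v x := by
  rw [overlay, dif_pos (bval_lt x)]
  rfl

theorem overlay_table₂ {s : ℕ} (v : Fin (2 ^ s * 2 ^ s) → Fin 2) (g : ℕ → ℕ) (z y : Bits s) :
    overlay v g (bval z * 2 ^ s + bval y) = (tableEquiv₂ s v z y).val := by
  rw [overlay, dif_pos (rows_lt z y)]
  have : (⟨bval z * 2 ^ s + bval y, rows_lt z y⟩ : Fin (2 ^ s * 2 ^ s)) =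
      finProdFinEquiv (bitsEquiv s z, bitsEquiv s y) := by
    refine Fin.ext ?_
    simp only [finProdFinEquiv, Equiv.coe_fn_mk, bitsEquiv_val]
    ring
  rw [this]
  rfl

/-- The state after the random choices, starting from `σ`. -/
def drawn (σ : State) {s d₁ d₂ d₃ : ℕ} (v : (Fin (2 ^ s) → Fin d₁) × (Fin (2 ^ s) → Fin d₂) ×
    (Fin (2 ^ s) → Fin d₃) × (Fin (2 ^ s * 2 ^ s) → Fin 2)) : State :=
  (((σ.withMem 16 (overlay v.1 (σ.mem 16))).withMem 17 (overlay v.2.1 (σ.mem 17))).withMem 18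
    (overlay v.2.2.1 (σ.mem 18))).withMem 19 (overlay v.2.2.2 (σ.mem 19))

theorem ready_drawn {σ : State} {s d₁ d₂ d₃ : ℕ} {A : Matrix (Fin d₁) (Fin d₃) Bool}
    {B : Matrix (Fin d₃) (Fin d₂) Bool} (hσ : Clean σ) (h0 : σ.reg 0 = d₁) (h1 : σ.reg 1 = d₂)
    (h2 : σ.reg 2 = d₃) (h3 : σ.reg 3 = 2 ^ s) (h4 : σ.reg 4 = 0) (h5 : σ.reg 5 = 0)
    (m0 : σ.mem 0 = encode A) (m1 : σ.mem 1 = encode B) (m2 : σ.mem 2 = 0)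
    (v : (Fin (2 ^ s) → Fin d₁) × (Fin (2 ^ s) → Fin d₂) ×
      (Fin (2 ^ s) → Fin d₃) × (Fin (2 ^ s * 2 ^ s) → Fin 2)) :
    Ready (drawn σ v) A B (sampleEquiv s d₁ d₂ d₃ v) where
  clean := hσ
  reg0 := h0
  reg1 := h1
  reg2 := h2
  reg3 := h3
  reg4 := h4
  reg5 := h5
  mem0 := by simp [drawn, State.withMem, m0]
  mem1 := by simp [drawn, State.withMem, m1]
  mem2 := by simp [drawn, State.withMem, m2]
  mem16 x := by
    rw [show (drawn σ v).mem 16 = overlay v.1 (σ.mem 16) by simp [drawn, State.withMem],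
      overlay_table]
    rfl
  mem17 x := by
    rw [show (drawn σ v).mem 17 = overlay v.2.1 (σ.mem 17) by simp [drawn, State.withMem],
      overlay_table]
    rfl
  mem18 x := by
    rw [show (drawn σ v).mem 18 = overlay v.2.2.1 (σ.mem 18) by simp [drawn, State.withMem],
      overlay_table]
    rfl
  mem19 z y := by
    rw [show (drawn σ v).mem 19 = overlay v.2.2.2 (σ.mem 19) by simp [drawn, State.withMem],
      overlay_table₂]
    rfl

theorem exec_draw (P : Program) {σ : State} {s d₁ d₂ d₃ L T : ℕ} [NeZero d₁] [NeZero d₂] [NeZero d₃]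
    {q : Cmd} {F : State → State} (hσ : Clean σ) (h0 : σ.reg 0 = d₁) (h1 : σ.reg 1 = d₂)
    (h2 : σ.reg 2 = d₃) (h3 : σ.reg 3 = 2 ^ s) (h4 : σ.reg 4 = 0) (h5 : σ.reg 5 = 0)
    (h12 : σ.reg 12 = 2) (hL : 64 * (2 ^ s * 2 ^ s) ≤ 2 ^ L) (l1 : d₁ < 2 ^ L) (l2 : d₂ < 2 ^ L)
    (l3 : d₃ < 2 ^ L)
    (hq : ∀ v : (Fin (2 ^ s) → Fin d₁) × (Fin (2 ^ s) → Fin d₂) × (Fin (2 ^ s) → Fin d₃) ×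
      (Fin (2 ^ s * 2 ^ s) → Fin 2), DExec P q (drawn σ v) (F (drawn σ v)) T) :
    Exec P (.seq (randFill 4 eM 5 16 0) (.seq (randFill 4 eM 5 17 1)
      (.seq (randFill 4 eM 5 18 2) (.seq (randFill 4 (eM * eM) 5 19 12) q)))) σ
      ((PMF.uniformOfFintype ((Fin (2 ^ s) → Fin d₁) × (Fin (2 ^ s) → Fin d₂) ×
        (Fin (2 ^ s) → Fin d₃) × (Fin (2 ^ s * 2 ^ s) → Fin 2))).map fun v => F (drawn σ v))
      (T + 400 * (2 ^ s * 2 ^ s + 1) * (1 + L) ^ 2) := by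
  have hs0 : 1 ≤ 2 ^ s := Nat.one_le_two_pow
  have e3 : 2 ^ s ≤ 2 ^ s * 2 ^ s := by nlinarith
  have hNL : 2 ^ s * 2 ^ s < 2 ^ L := by omega
  have hML : 2 ^ s < 2 ^ L := lt_of_le_of_lt e3 hNL
  have l0 : 2 < 2 ^ L := by omega
  have hM : ∀ τ : State, τ.reg = σ.reg → Ex.Fits eM τ L := fun τ hτ => by
    simp only [eM, Ex.fits_reg, hτ, h3]
    exact hML
  have hM' : ∀ τ : State, τ.reg = σ.reg → Ex.ev eM τ = 2 ^ s := fun τ hτ => by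
    simp only [eM, Ex.ev_reg, hτ, h3]
  have hwf : eM.Wf := by simp [eM, Ex.wf_reg]
  have e₁ := exec_randFill P (i := 4) (r := 5) (k := 16) (b := 0) (L := L) (d := d₁) (n := 2 ^ s)
    (e := eM) (σ := σ) (by omega) (by omega) (by omega) (by omega) hwf hσ h4 h5 h0 l1 (hM σ rfl)
    (hM' σ rfl)
  have e₂ := fun τ (hτ : τ.reg = σ.reg) => exec_randFill P (i := 4) (r := 5) (k := 17) (b := 1)
    (L := L) (d := d₂) (n := 2 ^ s) (e := eM) (σ := τ) (by omega) (by omega) (by omega) (by omega)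
    hwf (hσ.of_reg_eq hτ) (by rw [hτ]; exact h4) (by rw [hτ]; exact h5) (by rw [hτ]; exact h1) l2
    (hM τ hτ) (hM' τ hτ)
  have e₃ := fun τ (hτ : τ.reg = σ.reg) => exec_randFill P (i := 4) (r := 5) (k := 18) (b := 2)
    (L := L) (d := d₃) (n := 2 ^ s) (e := eM) (σ := τ) (by omega) (by omega) (by omega) (by omega)
    hwf (hσ.of_reg_eq hτ) (by rw [hτ]; exact h4) (by rw [hτ]; exact h5) (by rw [hτ]; exact h2) l3
    (hM τ hτ) (hM' τ hτ)
  have e₄ := fun τ (hτ : τ.reg = σ.reg) => exec_randFill P (i := 4) (r := 5) (k := 19) (b := 12)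
    (L := L) (d := 2) (n := 2 ^ s * 2 ^ s) (e := eM * eM) (σ := τ) (by omega) (by omega) (by omega)
    (by omega) (by simp [Ex.wf_mul, hwf]) (hσ.of_reg_eq hτ) (by rw [hτ]; exact h4)
    (by rw [hτ]; exact h5) (by rw [hτ]; exact h12) l0
    (size_spec (by rw [hτ]; exact h3) hL).1 (size_spec (by rw [hτ]; exact h3) hL).2
  have hcost : 1 ≤ (2 ^ s * 2 ^ s + 1) * (1 + L) ^ 2 := Nat.one_le_iff_ne_zero.2 (by positivity)
  have hcost₂ : (2 ^ s + 1) * (1 + L) ^ 2 ≤ (2 ^ s * 2 ^ s + 1) * (1 + L) ^ 2 :=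
    Nat.mul_le_mul_right _ (by omega)
  -- `K₄`, `K₃`, `K₂` are the laws of the final state when the last one, two or three of the arrays
  -- remain to be drawn; at the end the nested draws merge into one uniform draw from the product.
  let K₄ : State → PMF State := fun τ => ((PMF.uniformOfFintype (Fin (2 ^ s * 2 ^ s) → Fin 2)).map
    fun v => τ.withMem 19 (overlay v (τ.mem 19))).bind fun τ => PMF.pure (F τ)
  let K₃ : State → PMF State := fun τ => ((PMF.uniformOfFintype (Fin (2 ^ s) → Fin d₃)).map
    fun v => τ.withMem 18 (overlay v (τ.mem 18))).bind K₄
  let K₂ : State → PMF State := fun τ => ((PMF.uniformOfFintype (Fin (2 ^ s) → Fin d₂)).map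
    fun v => τ.withMem 17 (overlay v (τ.mem 17))).bind K₃
  have s₄ : ∀ v₁ v₂ v₃, Exec P (.seq (randFill 4 (eM * eM) 5 19 12) q)
      (((σ.withMem 16 (overlay (n := 2 ^ s) (d := d₁) v₁ (σ.mem 16))).withMem 17
        (overlay (n := 2 ^ s) (d := d₂) v₂ (σ.mem 17))).withMem 18
          (overlay (n := 2 ^ s) (d := d₃) v₃ (σ.mem 18))) (K₄ _)
      (T + 100 * (2 ^ s * 2 ^ s + 1) * (1 + L) ^ 2) := fun v₁ v₂ v₃ =>
    (e₄ (((σ.withMem 16 (overlay (n := 2 ^ s) (d := d₁) v₁ (σ.mem 16))).withMem 17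
        (overlay (n := 2 ^ s) (d := d₂) v₂ (σ.mem 17))).withMem 18
          (overlay (n := 2 ^ s) (d := d₃) v₃ (σ.mem 18))) rfl).seq
      (ν := fun τ => PMF.pure (F τ)) (q := q) (T := T + 100 * (2 ^ s * 2 ^ s + 1) * (1 + L) ^ 2)
      (T₂ := T) (fun τ hτ => by
      rw [PMF.support_map] at hτ
      obtain ⟨v₄, -, rfl⟩ := hτ
      exact hq (v₁, v₂, v₃, v₄)) (by
        simp only [Ex.nodes_mul, eM, Ex.nodes_reg]
        nlinarith)
  have s₃ : ∀ v₁ v₂, Exec P (.seq (randFill 4 eM 5 18 2) (.seq (randFill 4 (eM * eM) 5 19 12) q))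
      ((σ.withMem 16 (overlay (n := 2 ^ s) (d := d₁) v₁ (σ.mem 16))).withMem 17
        (overlay (n := 2 ^ s) (d := d₂) v₂ (σ.mem 17))) (K₃ _)
      (T + 200 * (2 ^ s * 2 ^ s + 1) * (1 + L) ^ 2) := fun v₁ v₂ =>
    (e₃ ((σ.withMem 16 (overlay (n := 2 ^ s) (d := d₁) v₁ (σ.mem 16))).withMem 17
        (overlay (n := 2 ^ s) (d := d₂) v₂ (σ.mem 17))) rfl).seq (ν := K₄)
      (T := T + 200 * (2 ^ s * 2 ^ s + 1) * (1 + L) ^ 2)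
      (q := .seq (randFill 4 (eM * eM) 5 19 12) q) (fun τ hτ => by
      rw [PMF.support_map] at hτ
      obtain ⟨v₃, -, rfl⟩ := hτ
      exact s₄ v₁ v₂ v₃) (by
        simp only [eM, Ex.nodes_reg]
        nlinarith)
  have s₂ : ∀ v₁, Exec P (.seq (randFill 4 eM 5 17 1) (.seq (randFill 4 eM 5 18 2)
      (.seq (randFill 4 (eM * eM) 5 19 12) q)))
      (σ.withMem 16 (overlay (n := 2 ^ s) (d := d₁) v₁ (σ.mem 16))) (K₂ _)
      (T + 300 * (2 ^ s * 2 ^ s + 1) * (1 + L) ^ 2) := fun v₁ =>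
    (e₂ (σ.withMem 16 (overlay (n := 2 ^ s) (d := d₁) v₁ (σ.mem 16))) rfl).seq (ν := K₃)
      (T := T + 300 * (2 ^ s * 2 ^ s + 1) * (1 + L) ^ 2)
      (q := .seq (randFill 4 eM 5 18 2) (.seq (randFill 4 (eM * eM) 5 19 12) q)) (fun τ hτ => by
      rw [PMF.support_map] at hτ
      obtain ⟨v₂, -, rfl⟩ := hτ
      exact s₃ v₁ v₂) (by
        simp only [eM, Ex.nodes_reg]
        nlinarith)
  have h := e₁.seq (T := T + 400 * (2 ^ s * 2 ^ s + 1) * (1 + L) ^ 2) (ν := K₂) (fun τ hτ => by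
      rw [PMF.support_map] at hτ
      obtain ⟨v₁, -, rfl⟩ := hτ
      exact s₂ v₁) (by
        simp only [eM, Ex.nodes_reg]
        nlinarith)
  refine (Eq.subst (motive := fun μ => Exec P _ _ μ _) ?_ h)
  have hb : ∀ {α β γ : Type} (p : PMF α) (f : α → β) (g : β → γ),
      (p.map f).bind (fun b => PMF.pure (g b)) = p.map fun a => g (f a) := fun p f g => by
    rw [PMF.bind_map]
    exact PMF.bind_pure_comp _ _
  simp only [K₂, K₃, K₄, hb]
  simp only [PMF.bind_map, Function.comp_def]
  simp only [uniform_bind_map]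
  rfl

/-- The shift 30 makes the cube grow by at most the factor 6/4 from the very first step, so that 4^s
times the cube of the word length is absorbed into 6^s. -/
theorem four_mul_cube_le (t : ℕ) : 4 * (3 * (t + 1) + 30) ^ 3 ≤ 6 * (3 * t + 30) ^ 3 := by
  have : 6 * (3 * t + 30) ^ 3 =
      4 * (3 * (t + 1) + 30) ^ 3 + (54 * t ^ 3 + 1296 * t ^ 2 + 9396 * t + 18252) := by
    ring
  omega

theorem four_pow_mul_cube_le (s : ℕ) : 4 ^ s * (3 * s + 30) ^ 3 ≤ 27000 * 6 ^ s := by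
  induction s with
  | zero => norm_num
  | succ s ih =>
    calc 4 ^ (s + 1) * (3 * (s + 1) + 30) ^ 3 = 4 ^ s * (4 * (3 * (s + 1) + 30) ^ 3) := by ring
      _ ≤ 4 ^ s * (6 * (3 * s + 30) ^ 3) := Nat.mul_le_mul_left _ (four_mul_cube_le s)
      _ = 6 * (4 ^ s * (3 * s + 30) ^ 3) := by ring
      _ ≤ 6 * (27000 * 6 ^ s) := Nat.mul_le_mul_left _ ih
      _ = 27000 * 6 ^ (s + 1) := by ring

/-- The program always halts within time of order `6 ^ s`, and its output has the law of the estimate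
with parameter `s`. -/
theorem opportunistic_spec (C : ℕ) (hC : 1 ≤ C) : ∃ K₀ : ℕ, ∀ (d₁ d₂ d₃ : ℕ) [NeZero d₁] [NeZero d₂]
    [NeZero d₃] (A : Matrix (Fin d₁) (Fin d₃) Bool) (B : Matrix (Fin d₃) (Fin d₂) Bool), ∃ n,
      (∀ x ∈ (run (opportunistic C) n (start (opportunistic C) A B)).support, x.stack = [] ∧
        x.time ≤ K₀ * 6 ^ Nat.clog 7 (C * (d₁ * d₂ * d₃) * (d₁ * d₂ * d₃).size)) ∧
      (run (opportunistic C) n (start (opportunistic C) A B)).map (output d₁ d₂) =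
        estimateLaw (Nat.clog 7 (C * (d₁ * d₂ * d₃) * (d₁ * d₂ * d₃).size)) A B := by
  refine ⟨10 ^ 10, fun d₁ d₂ d₃ _ _ _ A B => ?_⟩
  have hd₁ : 1 ≤ d₁ := NeZero.one_le
  have hd₂ : 1 ≤ d₂ := NeZero.one_le
  have hd₃ : 1 ≤ d₃ := NeZero.one_le
  set Q := C * (d₁ * d₂ * d₃) * (d₁ * d₂ * d₃).size with hQ
  set s := Nat.clog 7 Q with hs
  have hp : 1 ≤ d₁ * d₂ * d₃ := Nat.mul_pos (Nat.mul_pos hd₁ hd₂) hd₃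
  have hpQ : d₁ * d₂ * d₃ ≤ Q := by
    have hsz : 1 ≤ (d₁ * d₂ * d₃).size := Nat.size_pos.2 hp
    exact (Nat.le_mul_of_pos_left _ hC).trans (Nat.le_mul_of_pos_right _ hsz)
  have hQs : Q ≤ 7 ^ s := Nat.le_pow_clog (by norm_num) Q
  have h78 : (7 : ℕ) ^ s ≤ 8 ^ s := Nat.pow_le_pow_left (by norm_num) s
  have h48 : (4 : ℕ) ^ s ≤ 8 ^ s := Nat.pow_le_pow_left (by norm_num) s
  -- One word length for the whole run: since ψ₃ ≤ Q ≤ 7^s ≤ 8^s, 3s + 9 digits hold the dimensions,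
  -- `7 * Q` and every address.
  have hpow : 2 ^ (3 * s + 9) = 512 * 8 ^ s := by
    rw [pow_add, pow_mul]; norm_num; ring
  have h4 : 2 ^ s * 2 ^ s = 4 ^ s := by rw [← mul_pow]; norm_num
  have hL : 64 * (2 ^ s * 2 ^ s) ≤ 2 ^ (3 * s + 9) := by rw [h4, hpow]; omega
  have h8 : 1 ≤ 8 ^ s := Nat.one_le_pow _ _ (by norm_num)
  have hQL : 7 * Q < 2 ^ (3 * s + 9) := by omega
  have k12 : d₁ * d₂ ≤ d₁ * d₂ * d₃ := Nat.le_mul_of_pos_right _ hd₃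
  have k13 : d₁ * d₃ ≤ d₁ * d₂ * d₃ := by
    rw [mul_right_comm]; exact Nat.le_mul_of_pos_right _ hd₂
  have k32 : d₃ * d₂ ≤ d₁ * d₂ * d₃ := by
    rw [mul_assoc, mul_comm d₃]; exact Nat.le_mul_of_pos_left _ hd₁
  have k1 : d₁ ≤ d₁ * d₂ := Nat.le_mul_of_pos_right _ hd₂
  have k2 : d₂ ≤ d₁ * d₂ := Nat.le_mul_of_pos_left _ hd₁
  have k3 : d₃ ≤ d₁ * d₃ := Nat.le_mul_of_pos_left _ hd₁
  set σ₀ := (start (opportunistic C) A B).state with hσ₀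
  obtain ⟨σ, e₁, m, hσ, r0, r1, r2, r3, r4, r5, r12⟩ := exec_prep (opportunistic C) (σ := σ₀)
    (d₁ := d₁) (d₂ := d₂) (d₃ := d₃) (C := C) (L := 3 * s + 9)
    (fun j hj => by
      have h0 : j ≠ 0 := by omega
      have h1 : j ≠ 1 := by omega
      have h2 : j ≠ 2 := by omega
      simp [hσ₀, start, h0, h1, h2])
    rfl rfl rfl rfl hd₁ hd₂ hd₃ hC hQL
  have r4' : σ.reg 4 = 0 := r4
  have r5' : σ.reg 5 = 0 := r5
  have hready : ∀ v, Ready (drawn σ v) A B (sampleEquiv s d₁ d₂ d₃ v) :=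
    ready_drawn hσ r0 r1 r2 r3 r4' r5' (by rw [m]; rfl) (by rw [m]; rfl) (by rw [m]; rfl)
  -- Uniqueness of the sample lets σ' be chosen before ω; states that hold no sample get an
  -- arbitrary value.
  have hex : ∀ τ : State, ∃ σ', ∀ ω : Sample s d₁ d₂ d₃, Ready τ A B ω →
      DExec (opportunistic C) estimateCmd τ σ'
        (mulTime s + 1000 * (2 ^ s * 2 ^ s + 1) * (1 + (3 * s + 9)) ^ 2) ∧
      ∀ (i : Fin d₁) (j : Fin d₂), σ'.mem 2 (i.val * d₂ + j.val) ≠ 0 ↔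
        estimate A B ω i j = true := by
    intro τ
    by_cases h : ∃ ω : Sample s d₁ d₂ d₃, Ready τ A B ω
    · obtain ⟨ω, hω⟩ := h
      obtain ⟨σ', h⟩ := exec_estimate (P := opportunistic C) rfl hω hL (by omega) (by omega)
        (by omega) hd₁ hd₂ hd₃
      exact ⟨σ', fun ω' hω' => by rwa [hω'.sample_unique hω]⟩
    · exact ⟨τ, fun ω hω => absurd ⟨ω, hω⟩ h⟩
  choose F hF using hex
  have e₂ := exec_draw (opportunistic C) (F := F) hσ r0 r1 r2 r3 r4' r5' r12 hL (by omega)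
    (by omega) (by omega) (fun v => (hF _ _ (hready v)).1)
  have e₃ := e₁.then e₂ le_rfl
  -- The output depends on the memory only, so the stack and time in the observable are dummies.
  have e₄ := e₃ _ (fun τ => output d₁ d₂ ⟨[], τ, 0⟩) [] 0 _ (fun τ => PMF.pure (output d₁ d₂ ⟨[], τ, 0⟩))
    (fun τ _ t ht => Reaches.halted ht)
  obtain ⟨n, h₁, h₂⟩ := e₄
  refine ⟨n, fun x hx => ⟨(h₁ x hx).1, (h₁ x hx).2.trans ?_⟩, ?_⟩
  · have hk := four_pow_mul_cube_le s
    have hm := mulTime_le s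
    have h41 : 1 ≤ 4 ^ s := Nat.one_le_pow _ _ (by norm_num)
    have hW : (1 + (3 * s + 9)) ^ 3 ≤ (3 * s + 30) ^ 3 := Nat.pow_le_pow_left (by omega) 3
    have hW₂ : (1 + (3 * s + 9)) ^ 2 ≤ (3 * s + 30) ^ 3 :=
      (Nat.pow_le_pow_left (by omega) 2).trans (Nat.pow_le_pow_right (by omega) (by norm_num))
    have hW₃ : (3 * s + 30) ^ 3 ≤ 4 ^ s * (3 * s + 30) ^ 3 := Nat.le_mul_of_pos_left _ h41
    have hW₄ : (4 ^ s + 1) * (1 + (3 * s + 9)) ^ 2 ≤ 2 * (4 ^ s * (3 * s + 30) ^ 3) := by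
      calc _ ≤ (2 * 4 ^ s) * (3 * s + 30) ^ 3 := Nat.mul_le_mul (by omega) hW₂
        _ = _ := by ring
    have h61 : 1 ≤ 6 ^ s := Nat.one_le_pow _ _ (by norm_num)
    rw [h4]
    simp only [mul_assoc]
    omega
  · change PMF.map (fun x : Config => output d₁ d₂ ⟨[], x.state, 0⟩) _ = _
    have : (start (opportunistic C) A B) = ⟨[mainCmd C], σ₀, 0⟩ := rfl
    rw [this]
    refine h₂.trans ?_
    rw [estimateLaw, ← uniform_map_equiv (sampleEquiv s d₁ d₂ d₃), PMF.bind_map]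
    refine (PMF.bind_pure_comp _ _).trans ?_
    congr 1
    funext v
    have := (hF _ _ (hready v)).2
    ext i j
    simp only [output]
    rw [Bool.eq_iff_iff, decide_eq_true_iff]
    exact this i j

end BitRAM

namespace BMM
open Finset Real

/-! ## Janson's inequality -/

section Janson

variable {Ω τ : Type*} [DistribLattice Ω] [Fintype Ω]

/-- The FKG inequality for the uniform weight, for which the lattice condition is trivial. -/
theorem sum_mul_sum_le_card_mul_sum {f g : Ω → ℝ} (hf₀ : 0 ≤ f) (hg₀ : 0 ≤ g) (hf : Monotone f)
    (hg : Monotone g) : (∑ ω, f ω) * ∑ ω, g ω ≤ Fintype.card Ω * ∑ ω, f ω * g ω := by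
  have h := fkg (μ := fun _ : Ω => (1 : ℝ)) (f := f) (g := g) (fun _ => zero_le_one) hf₀ hg₀ hf hg (by simp)
  simpa using h

variable {T : Finset τ} {I : τ → Ω → ℝ} {o : τ → Ω → Ω} {D : τ → τ → Prop} {p δ : ℝ}

open Classical in
/-- The differential inequality behind Janson's inequality. -/
theorem janson_aux (hp : 0 ≤ p) (hI₀ : ∀ t ω, 0 ≤ I t ω) (hI : ∀ t, Antitone (I t))
    (ho : ∀ t, Monotone (o t)) (h₁ : ∀ t (h : Ω → ℝ), ∑ ω, I t ω * h ω = p * ∑ ω, h (o t ω))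
    (h₂ : ∀ t t', ¬ D t t' → ∀ ω, I t' (o t ω) = I t' ω)
    (hδ : ∀ t ∈ T, ∑ t' ∈ T with D t t', ∑ ω, I t' (o t ω) ≤ δ * Fintype.card Ω) {l : ℝ}
    (hl : 0 ≤ l) :
    #T * p * (1 - l * δ) * ∑ ω, exp (-l * ∑ t ∈ T, I t ω) ≤
      ∑ ω, (∑ t ∈ T, I t ω) * exp (-l * ∑ t ∈ T, I t ω) := by
  rcases isEmpty_or_nonempty Ω with hΩ | hΩ
  · simp
  have hc : (0 : ℝ) < Fintype.card Ω := by exact_mod_cast Fintype.card_pos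
  set X : Ω → ℝ := fun ω => ∑ t ∈ T, I t ω with hX
  have hXa : Antitone X := fun a b hab => sum_le_sum fun t _ => hI t hab
  have hterm : ∀ t ∈ T, p * (1 - l * δ) * ∑ ω, exp (-l * X ω) ≤ ∑ ω, I t ω * exp (-l * X ω) := by
    intro t ht
    -- By `h₁`, conditioning on event `t` amounts to replacing `ω` by `o t ω`. This changes only the
    -- indicators that depend on `t`, so `X` grows by at most `W`. FKG separates exp(-lX) from
    -- exp(-lW), both increasing, and exp(-lW) ≥ 1 - lW has mean at least 1 - lδ.
    rw [h₁ t fun ω => exp (-l * X ω), mul_assoc]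
    refine mul_le_mul_of_nonneg_left ?_ hp
    set W : Ω → ℝ := fun ω => ∑ t' ∈ T with D t t', I t' (o t ω) with hW
    have hWa : Antitone W := fun a b hab => sum_le_sum fun t' _ => hI t' (ho t hab)
    have hXW : ∀ ω, X (o t ω) ≤ X ω + W ω := by
      intro ω
      simp only [hX, hW]
      rw [← sum_filter_add_sum_filter_not T (D t), add_comm]
      refine add_le_add ?_ le_rfl
      calc ∑ t' ∈ T with ¬ D t t', I t' (o t ω) = ∑ t' ∈ T with ¬ D t t', I t' ω :=
            sum_congr rfl fun t' ht' => h₂ t t' (mem_filter.1 ht').2 ω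
        _ ≤ _ := sum_le_sum_of_subset_of_nonneg (filter_subset _ _) fun t' _ _ => hI₀ t' ω
    have hmono : ∀ Y : Ω → ℝ, Antitone Y → Monotone fun ω => exp (-l * Y ω) :=
      fun Y hY a b hab => exp_le_exp.2 (by nlinarith [hY hab])
    have hfkg := sum_mul_sum_le_card_mul_sum (f := fun ω => exp (-l * X ω))
      (g := fun ω => exp (-l * W ω)) (fun ω => (exp_pos _).le) (fun ω => (exp_pos _).le)
      (hmono X hXa) (hmono W hWa)
    have hWs : (1 - l * δ) * Fintype.card Ω ≤ ∑ ω, exp (-l * W ω) := by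
      have h := hδ t ht
      rw [sum_comm] at h
      calc (1 - l * δ) * Fintype.card Ω = Fintype.card Ω - l * (δ * Fintype.card Ω) := by ring
        _ ≤ Fintype.card Ω - l * ∑ ω, W ω := by
            have := mul_le_mul_of_nonneg_left h hl
            linarith
        _ = ∑ ω, (-l * W ω + 1) := by
            rw [sum_add_distrib, ← mul_sum]
            simp
            ring
        _ ≤ _ := sum_le_sum fun ω _ => add_one_le_exp _
    have hF : 0 ≤ ∑ ω, exp (-l * X ω) := sum_nonneg fun ω _ => (exp_pos _).le
    have hlast : ∑ ω, exp (-l * X ω) * exp (-l * W ω) ≤ ∑ ω, exp (-l * X (o t ω)) := by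
      refine sum_le_sum fun ω _ => ?_
      rw [← exp_add]
      exact exp_le_exp.2 (by nlinarith [hXW ω])
    refine le_trans ?_ hlast
    have h3 := (mul_le_mul_of_nonneg_left hWs hF).trans hfkg
    refine le_of_mul_le_mul_left ?_ hc
    linarith
  calc #T * p * (1 - l * δ) * ∑ ω, exp (-l * X ω)
      = ∑ _t ∈ T, p * (1 - l * δ) * ∑ ω, exp (-l * X ω) := by
        rw [sum_const, nsmul_eq_mul]
        ring
    _ ≤ ∑ t ∈ T, ∑ ω, I t ω * exp (-l * X ω) := sum_le_sum hterm
    _ = _ := by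
        rw [sum_comm]
        exact sum_congr rfl fun ω _ => (sum_mul _ _ _).symm

open Classical in
/-- Janson's inequality: if the decreasing events `I t` have probability `p`, and the expected number
of those that occur and depend on a given one, given that one, is at most `δ`, then the probability
that none of them occurs is at most `exp (-|T| p / (2 δ))`. -/
theorem janson (hp : 0 ≤ p) (hδ₀ : 0 < δ) (hI₀ : ∀ t ω, 0 ≤ I t ω) (hI : ∀ t, Antitone (I t))
    (ho : ∀ t, Monotone (o t)) (h₁ : ∀ t (h : Ω → ℝ), ∑ ω, I t ω * h ω = p * ∑ ω, h (o t ω))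
    (h₂ : ∀ t t', ¬ D t t' → ∀ ω, I t' (o t ω) = I t' ω)
    (hδ : ∀ t ∈ T, ∑ t' ∈ T with D t t', ∑ ω, I t' (o t ω) ≤ δ * Fintype.card Ω) :
    (#{ω | ∀ t ∈ T, I t ω = 0} : ℝ) ≤ Fintype.card Ω * exp (-(#T * p / (2 * δ))) := by
  set m : ℝ := #T * p with hm
  set X : Ω → ℝ := fun ω => ∑ t ∈ T, I t ω with hX
  let F : ℝ → ℝ := fun l => ∑ ω, exp (-l * X ω)
  -- The integrating factor for -F' ≥ m(1 - lδ)F, by which `F * E` decreases on l ≥ 0. Comparing l =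
  -- 0 with l = 1/δ, where the exponent is maximal, gives m/(2δ).
  let E : ℝ → ℝ := fun l => exp (m * l - m * δ * l ^ 2 / 2)
  have hF : ∀ l, HasDerivAt F (-∑ ω, X ω * exp (-l * X ω)) l := by
    intro l
    rw [← sum_neg_distrib]
    refine HasDerivAt.fun_sum fun ω _ => ?_
    have := (((hasDerivAt_id l).neg).mul_const (X ω)).exp
    refine this.congr_deriv ?_
    simp
    ring
  have hE : ∀ l, HasDerivAt E ((m - m * δ * l) * E l) l := by
    intro l
    have := (((hasDerivAt_id l).const_mul m).sub
      ((((hasDerivAt_id l).pow 2).const_mul (m * δ)).div_const 2)).exp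
    refine this.congr_deriv ?_
    simp [E]
    ring
  have hG : ∀ l, HasDerivAt (fun l => F l * E l)
      (-(∑ ω, X ω * exp (-l * X ω)) * E l + F l * ((m - m * δ * l) * E l)) l :=
    fun l => (hF l).mul (hE l)
  have hanti : AntitoneOn (fun l => F l * E l) (Set.Ici 0) := by
    refine antitoneOn_of_deriv_nonpos (convex_Ici 0)
      (fun l _ => (hG l).continuousAt.continuousWithinAt)
      (fun l _ => (hG l).differentiableAt.differentiableWithinAt) fun l hl => ?_
    rw [interior_Ici] at hl
    rw [(hG l).deriv]
    have h := janson_aux hp hI₀ hI ho h₁ h₂ hδ (le_of_lt hl)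
    have hEp : 0 < E l := exp_pos _
    have : -(∑ ω, X ω * exp (-l * X ω)) * E l + F l * ((m - m * δ * l) * E l) =
        -(((∑ ω, X ω * exp (-l * X ω)) - m * (1 - l * δ) * F l) * E l) := by ring
    rw [this, neg_nonpos]
    exact mul_nonneg (sub_nonneg.2 h) hEp.le
  have hle := hanti (Set.mem_Ici.2 le_rfl) (Set.mem_Ici.2 (inv_nonneg.2 hδ₀.le))
    (inv_nonneg.2 hδ₀.le)
  have hF0 : F 0 = Fintype.card Ω := by simp [F]
  have hE0 : E 0 = 1 := by simp [E]
  have hE1 : E δ⁻¹ = exp (m / (2 * δ)) := by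
    simp only [E]
    congr 1
    field_simp
    ring
  simp only [hF0, hE0, hE1, mul_one] at hle
  have hcount : (#{ω | ∀ t ∈ T, I t ω = 0} : ℝ) ≤ F δ⁻¹ := by
    rw [card_eq_sum_ones, Nat.cast_sum]
    refine le_trans (sum_le_sum fun ω hω => ?_)
      (sum_le_sum_of_subset_of_nonneg (subset_univ _) fun ω _ _ => (exp_pos _).le)
    have : X ω = 0 := sum_eq_zero (mem_filter.1 hω).2
    simp [this]
  refine hcount.trans ?_
  rw [exp_neg, ← div_eq_mul_inv, le_div_iff₀ (exp_pos _)]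
  exact hle

end Janson

end BMM

namespace BMM
open Finset Real

/-! ### Patterns in products of finite sets -/

section Patterns

variable {ι : Type*} {n : ι → ℕ} [∀ i, NeZero (n i)]

open Classical in
/-- The indicator function of the event that the coordinates in a given set are zero. -/
noncomputable def vanish (S : Finset ι) (ω : ∀ i, Fin (n i)) : ℝ := if ∀ i ∈ S, ω i = 0 then 1 else 0

theorem vanish_nonneg (S : Finset ι) (ω : ∀ i, Fin (n i)) : 0 ≤ vanish S ω := by
  unfold vanish
  split_ifs <;> norm_num

/-- Zero is the least element of each factor, so prescribing zeros is a decreasing event;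
prescribing other values would in general not be monotone. -/
theorem vanish_antitone (S : Finset ι) : Antitone (vanish (n := n) S) := by
  intro a b hab
  unfold vanish
  split_ifs with h h'
  · exact le_rfl
  · exact absurd (fun i hi => le_antisymm ((hab i).trans_eq (h i hi)) (Fin.zero_le _)) h'
  · norm_num
  · exact le_rfl

variable [DecidableEq ι]

/-- Set the coordinates in a given set to zero. -/
def clear (S : Finset ι) (ω : ∀ i, Fin (n i)) : ∀ i, Fin (n i) := fun i => if i ∈ S then 0 else ω i

theorem clear_mono (S : Finset ι) : Monotone (clear (n := n) S) := by
  intro a b hab i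
  unfold clear
  split_ifs
  · exact le_rfl
  · exact hab i

theorem vanish_clear (S S' : Finset ι) (ω : ∀ i, Fin (n i)) :
    vanish S' (clear S ω) = vanish (S' \ S) ω := by
  unfold vanish clear
  congr 1
  refine propext ⟨fun h i hi => ?_, fun h i hi => ?_⟩
  · rw [mem_sdiff] at hi
    simpa [hi.2] using h i hi.1
  · split_ifs with hS
    · rfl
    · exact h i (mem_sdiff.2 ⟨hi, hS⟩)

variable [Fintype ι]

theorem sum_vanish_singleton (i : ι) (h : (∀ i, Fin (n i)) → ℝ) :
    (n i : ℝ) * ∑ ω, vanish {i} ω * h ω = ∑ ω, h (Function.update ω i 0) := by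
  rw [← (Equiv.piSplitAt i fun i => Fin (n i)).symm.sum_comp,
    ← (Equiv.piSplitAt i fun i => Fin (n i)).symm.sum_comp, Fintype.sum_prod_type_right,
    Fintype.sum_prod_type_right, mul_sum]
  refine sum_congr rfl fun r _ => ?_
  have h₁ : ∀ a, Function.update ((Equiv.piSplitAt i fun i => Fin (n i)).symm (a, r)) i 0 =
      (Equiv.piSplitAt i fun i => Fin (n i)).symm (0, r) := by
    intro a
    funext j
    by_cases hj : j = i
    · subst hj
      simp [Equiv.piSplitAt]
    · simp [Equiv.piSplitAt, hj]
  have h₂ : ∀ a, vanish {i} ((Equiv.piSplitAt i fun i => Fin (n i)).symm (a, r)) =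
      if a = 0 then 1 else 0 := by
    intro a
    simp [vanish, Equiv.piSplitAt]
  simp [h₁, h₂]

/-- Given that the coordinates in `S` vanish, the others remain uniform, so conditioning is the same
as overwriting with `clear`. This is the identity `h₁` that `janson` requires. -/
theorem sum_vanish_mul (S : Finset ι) (h : (∀ i, Fin (n i)) → ℝ) :
    (∏ i ∈ S, (n i : ℝ)) * ∑ ω, vanish S ω * h ω = ∑ ω, h (clear S ω) := by
  induction S using Finset.induction_on generalizing h with
  | empty =>
    have : ∀ ω : ∀ i, Fin (n i), clear ∅ ω = ω := fun ω => funext fun i => if_neg (notMem_empty i)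
    simp [vanish, this]
  | insert i S hi ih =>
    have h₁ : ∀ ω : ∀ i, Fin (n i), vanish (insert i S) ω = vanish {i} ω * vanish S ω := by
      intro ω
      simp only [vanish, forall_mem_insert, mem_singleton, forall_eq]
      split_ifs <;> simp_all
    have h₂ : ∀ ω : ∀ i, Fin (n i), vanish S (Function.update ω i 0) = vanish S ω := by
      intro ω
      unfold vanish
      congr 1
      refine propext (forall₂_congr fun j hj => ?_)
      rw [Function.update_of_ne (ne_of_mem_of_not_mem hj hi)]
    have h₃ : ∀ ω : ∀ i, Fin (n i), Function.update (clear S ω) i 0 = clear (insert i S) ω := by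
      intro ω
      funext j
      by_cases hj : j = i
      · subst hj
        simp [clear]
      · simp [clear, hj]
    rw [prod_insert hi, mul_comm (n i : ℝ), mul_assoc]
    simp only [h₁, mul_assoc]
    rw [sum_vanish_singleton i fun ω => vanish S ω * h ω]
    simp only [h₂]
    rw [ih fun ω => h (Function.update ω i 0)]
    simp only [h₃]

theorem sum_vanish (S : Finset ι) :
    ∑ ω, vanish (n := n) S ω = Fintype.card (∀ i, Fin (n i)) * ∏ i ∈ S, (n i : ℝ)⁻¹ := by
  have h := sum_vanish_mul (n := n) S fun _ => 1
  have h0 : (∏ i ∈ S, (n i : ℝ)) ≠ 0 :=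
    prod_ne_zero_iff.2 fun i _ => Nat.cast_ne_zero.2 (NeZero.ne _)
  simp only [mul_one, sum_const, card_univ, nsmul_eq_mul] at h
  rw [prod_inv_distrib, ← h]
  field_simp

open Classical in
/-- The probability that none of certain patterns appears in a random element of a product. -/
theorem card_no_pattern_le {τ : Type*} {T : Finset τ} {S : τ → Finset ι} (a : ∀ i, Fin (n i))
    {N δ : ℝ} (hδ₀ : 0 < δ) (hN : ∀ t, ∏ i ∈ S t, (n i : ℝ) = N)
    (hδ : ∀ t ∈ T, ∑ t' ∈ T with ¬ Disjoint (S t') (S t), ∏ i ∈ S t' \ S t, (n i : ℝ)⁻¹ ≤ δ) :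
    (#{ω : ∀ i, Fin (n i) | ∀ t ∈ T, ¬ ∀ i ∈ S t, ω i = a i} : ℝ) ≤
      Fintype.card (∀ i, Fin (n i)) * exp (-(#T * N⁻¹ / (2 * δ))) := by
  have hpos : ∀ t, 0 < ∏ i ∈ S t, (n i : ℝ) := fun t =>
    prod_pos fun i _ => Nat.cast_pos.2 (Nat.pos_of_ne_zero (NeZero.ne _))
  rcases T.eq_empty_or_nonempty with rfl | ⟨t₀, -⟩
  · simp
  have hN0 : 0 < N := hN t₀ ▸ hpos t₀
  have h := janson (Ω := ∀ i, Fin (n i)) (T := T) (I := fun t => vanish (S t))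
    (o := fun t => clear (S t)) (D := fun t t' => ¬ Disjoint (S t') (S t)) (p := N⁻¹) (δ := δ)
    (inv_nonneg.2 hN0.le) hδ₀ (fun t => vanish_nonneg _) (fun t => vanish_antitone _)
    (fun t => clear_mono _) (fun t h => by
      rw [← sum_vanish_mul, hN, inv_mul_cancel_left₀ hN0.ne'])
    (fun t t' hd ω => by rw [vanish_clear, Finset.sdiff_eq_self_of_disjoint (not_not.1 hd)])
    (fun t ht => by
      simp only [vanish_clear, sum_vanish]
      rw [← mul_sum, mul_comm]
      refine mul_le_mul_of_nonneg_right (le_of_eq_of_le ?_ (hδ t ht)) (Nat.cast_nonneg _)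
      congr)
  refine le_trans (le_of_eq ?_) h
  congr 1
  -- Exchanging `a i` with 0 in each factor preserves the count and turns the prescribed pattern
  -- into the zero pattern, where monotonicity is available.
  refine card_equiv (Equiv.piCongrRight fun i => Equiv.swap (a i) 0) fun ω => ?_
  simp only [mem_filter, mem_univ, true_and, vanish, ite_eq_right_iff, one_ne_zero, imp_false]
  refine forall₂_congr fun t _ => not_congr (forall₂_congr fun i _ => ?_)
  change ω i = a i ↔ Equiv.swap (a i) 0 (ω i) = 0
  rw [Equiv.swap_apply_eq_iff, Equiv.swap_apply_right]

end Patterns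

end BMM

namespace BMM
open Finset Filter

/-! ### Triples of indices entering the pseudo-product -/

/-- The values of a triple of bit vectors at a coordinate. -/
abbrev Pat : Type := Bool × Bool × Bool

/-- The patterns allowed in the pseudo-product. -/
def allowed : Finset Pat := {p | (p.1 || p.2.1 || p.2.2) = true}

/-- The number of coordinates with a given property. -/
def weight (b : Pat → Bool) {s : ℕ} (t : Fin s → Pat) : ℕ := #{i | b (t i) = true}

/-- Triples of bit vectors whose disjunction is the all-ones vector. -/
def triples (s : ℕ) : Finset (Fin s → Pat) := Fintype.piFinset fun _ => allowed

theorem card_triples (s : ℕ) : #(triples s) = 7 ^ s := by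
  rw [triples, Fintype.card_piFinset, prod_const, card_univ, Fintype.card_fin]
  rfl

theorem prod_ite_weight {R : Type*} [CommMonoid R] (b : Pat → Bool) {s : ℕ} (t : Fin s → Pat)
    (u v : R) : ∏ i, (if b (t i) = true then u else v) =
      u ^ weight b t * v ^ (s - weight b t) := by
  rw [prod_ite, prod_const, prod_const, weight]
  congr 2
  have := card_filter_add_card_filter_not (s := (univ : Finset (Fin s))) (fun i => b (t i) = true)
  rw [card_univ, Fintype.card_fin] at this
  omega

theorem weight_le (b : Pat → Bool) {s : ℕ} (t : Fin s → Pat) : weight b t ≤ s :=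
  (card_filter_le _ _).trans (by simp)

/-- The number of triples with a given projection. -/
theorem card_projection {β : Type*} [DecidableEq β] (q : Pat → β) (b : Pat → Bool) {u v : ℕ}
    (h : ∀ p, #{p' ∈ allowed | q p' = q p} = if b p = true then u else v) {s : ℕ}
    (t : Fin s → Pat) :
    #{t' ∈ triples s | ∀ i, q (t' i) = q (t i)} = u ^ weight b t * v ^ (s - weight b t) := by
  rw [← prod_ite_weight]
  simp only [← h]
  rw [← Fintype.card_piFinset]
  congr 1
  ext t'
  simp only [mem_filter, triples, Fintype.mem_piFinset]
  exact ⟨fun h i => ⟨h.1 i, h.2 i⟩, fun h => ⟨fun i => (h i).1, fun i => (h i).2⟩⟩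

/-- A tail bound for the number of coordinates with a given property. -/
theorem card_heavy_le (b : Pat → Bool) {k A B : ℕ} {θ : ℝ} (hθ : 1 ≤ θ)
    (hk : #{p ∈ allowed | b p = true} = k) (s : ℕ) :
    (#{t ∈ triples s | B * s < A * weight b t} : ℝ) * (θ ^ B) ^ s ≤
      (k * θ ^ A + (7 - k)) ^ s := by
  have hsum : ∑ p ∈ allowed, (if b p = true then θ ^ A else 1) = k * θ ^ A + (7 - k) := by
    rw [sum_ite, sum_const, sum_const, hk]
    have := card_filter_add_card_filter_not (s := allowed) (fun p => b p = true)
    rw [hk, show #allowed = 7 from rfl] at this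
    have h7 : (k : ℝ) + (#{p ∈ allowed | ¬ b p = true} : ℝ) = 7 := by exact_mod_cast this
    simp only [nsmul_eq_mul, mul_one]
    linarith
  -- The moment generating function factors over the coordinates; the tail bound is Markov's
  -- inequality applied to it.
  have hmgf : ∑ t ∈ triples s, (θ ^ A) ^ weight b t = (k * θ ^ A + (7 - k)) ^ s := by
    rw [← hsum]
    have := sum_prod_piFinset (ι := Fin s) allowed fun _ p => if b p = true then θ ^ A else 1
    simp only [prod_const, card_univ, Fintype.card_fin] at this
    rw [← this]
    refine sum_congr rfl fun t _ => ?_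
    rw [prod_ite_weight, one_pow, mul_one]
  rw [← hmgf, ← nsmul_eq_mul, ← sum_const]
  refine le_trans (sum_le_sum fun t ht => ?_)
    (sum_le_sum_of_subset_of_nonneg (filter_subset _ _) fun t _ _ => by positivity)
  rw [← pow_mul, ← pow_mul]
  exact pow_le_pow_right₀ hθ (mem_filter.1 ht).2.le

/-- The coordinates in the support of one of the vectors. -/
def single : Fin 3 → Pat → Bool := ![fun p => p.1, fun p => p.2.1, fun p => p.2.2]

/-- The coordinates in the support of one of two vectors. -/
def double : Fin 3 → Pat → Bool :=
  ![fun p => p.2.1 || p.2.2, fun p => p.1 || p.2.2, fun p => p.1 || p.2.1]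

/-- Triples with supports of typical sizes. -/
def typical (s : ℕ) : Finset (Fin s → Pat) :=
  {t ∈ triples s | (∀ i, 40 * weight (single i) t ≤ 23 * s) ∧
    ∀ i, 500 * weight (double i) t ≤ 429 * s}

/-- Four of the seven patterns have a given bit set, and 4/7 < 23/40; as the margin is thin, so is
the tilt 3001/3000 that makes the base less than 1. -/
theorem card_heavy_single_le (i : Fin 3) (s : ℕ) :
    (#{t ∈ triples s | 23 * s < 40 * weight (single i) t} : ℝ) ≤
      7 ^ s * ((4 * (3001 / 3000) ^ 40 + 3) / (7 * (3001 / 3000) ^ 23)) ^ s := by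
  have h := card_heavy_le (single i) (k := 4) (A := 40) (B := 23) (θ := 3001 / 3000) (by norm_num)
    (by revert i; decide) s
  rw [div_pow, mul_pow, ← mul_div_assoc, mul_div_mul_left _ _ (by positivity), le_div_iff₀ (by positivity)]
  refine h.trans (le_of_eq ?_)
  norm_num

/-- Here six of the seven patterns count, and 6/7 < 429/500 by less than 1/1000, hence the still
smaller tilt. -/
theorem card_heavy_double_le (i : Fin 3) (s : ℕ) :
    (#{t ∈ triples s | 429 * s < 500 * weight (double i) t} : ℝ) ≤
      7 ^ s * ((6 * (100001 / 100000) ^ 500 + 1) / (7 * (100001 / 100000) ^ 429)) ^ s := by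
  have h := card_heavy_le (double i) (k := 6) (A := 500) (B := 429) (θ := 100001 / 100000)
    (by norm_num) (by revert i; decide) s
  rw [div_pow, mul_pow, ← mul_div_assoc, mul_div_mul_left _ _ (by positivity),
    le_div_iff₀ (by positivity)]
  refine h.trans (le_of_eq ?_)
  congr 2
  norm_num

set_option exponentiation.threshold 600 in
/-- Most triples are typical. -/
theorem eventually_card_typical : ∀ᶠ s in atTop, (7 : ℝ) ^ s / 2 ≤ #(typical s) := by
  -- There are six exceptional families; a share of at most 1/12 for each leaves half of all
  -- triples.
  have h₁ := (tendsto_pow_atTop_nhds_zero_of_lt_one (r := (4 * (3001 / 3000 : ℝ) ^ 40 + 3) /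
    (7 * (3001 / 3000) ^ 23)) (by positivity) (by norm_num)).eventually_le_const
      (show (0 : ℝ) < 1 / 12 by norm_num)
  have h₂ := (tendsto_pow_atTop_nhds_zero_of_lt_one (r := (6 * (100001 / 100000 : ℝ) ^ 500 + 1) /
    (7 * (100001 / 100000) ^ 429)) (by positivity) (by norm_num)).eventually_le_const
      (show (0 : ℝ) < 1 / 12 by norm_num)
  filter_upwards [h₁, h₂] with s h₁ h₂
  have hcover : triples s ⊆ typical s ∪
      ((univ.biUnion fun i => {t ∈ triples s | 23 * s < 40 * weight (single i) t}) ∪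
        univ.biUnion fun i => {t ∈ triples s | 429 * s < 500 * weight (double i) t}) := by
    intro t ht
    by_contra hn
    simp only [mem_union, mem_biUnion, mem_filter, mem_univ, true_and, not_or, not_exists, ht,
      not_lt, typical] at hn
    exact hn.1 hn.2
  have hcard := card_le_card hcover
  rw [card_triples] at hcard
  have hcard' : 7 ^ s ≤ #(typical s) +
      (∑ i, #{t ∈ triples s | 23 * s < 40 * weight (single i) t} +
        ∑ i, #{t ∈ triples s | 429 * s < 500 * weight (double i) t}) :=
    hcard.trans ((card_union_le _ _).trans (Nat.add_le_add_left ((card_union_le _ _).trans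
      (Nat.add_le_add card_biUnion_le card_biUnion_le)) _))
  have hreal : (7 : ℝ) ^ s ≤ #(typical s) +
      (∑ i, (#{t ∈ triples s | 23 * s < 40 * weight (single i) t} : ℝ) +
        ∑ i, (#{t ∈ triples s | 429 * s < 500 * weight (double i) t} : ℝ)) := by
    exact_mod_cast hcard'
  have h7 : (0 : ℝ) < 7 ^ s := by positivity
  have hs₁ : ∑ i, (#{t ∈ triples s | 23 * s < 40 * weight (single i) t} : ℝ) ≤ 7 ^ s / 4 := by
    refine (sum_le_sum fun i _ => (card_heavy_single_le i s).trans
      (mul_le_mul_of_nonneg_left h₁ h7.le)).trans (le_of_eq ?_)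
    simp
    ring
  have hs₂ : ∑ i, (#{t ∈ triples s | 429 * s < 500 * weight (double i) t} : ℝ) ≤ 7 ^ s / 4 := by
    refine (sum_le_sum fun i _ => (card_heavy_double_le i s).trans
      (mul_le_mul_of_nonneg_left h₂ h7.le)).trans (le_of_eq ?_)
    simp
    ring
  linarith

/-- The number of triples sharing one vector with a typical triple. -/
theorem mul_pow_single_le {s d w : ℕ} {ψ : ℝ} (hψ : ψ ≤ 7 ^ s) (hd : (d : ℝ) ^ 20 ≤ ψ ^ 7) (hψ₀ : 0 ≤ ψ)
    (hws : w ≤ s) (hw : 40 * w ≤ 23 * s) :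
    (d : ℝ) * (4 ^ w * 3 ^ (s - w)) ≤ 7 ^ s * (1999 / 2000) ^ s := by
  -- The 40th power clears the exponents 7/20 = 0.350 and 23/40. As 4^w 3^(s-w) increases with `w`,
  -- the worst case is w = 23s/40, and the claim becomes the numerical inequality 7^14·4^23·3^17 ≤
  -- (7·1999/2000)^40.
  refine le_of_pow_le_pow_left₀ (n := 40) (by norm_num) (by positivity) ?_
  have h₁ : ((d : ℝ) ^ 20) ^ 2 ≤ ((7 ^ s) ^ 7) ^ 2 :=
    pow_le_pow_left₀ (by positivity) (hd.trans (pow_le_pow_left₀ hψ₀ hψ 7)) 2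
  have h₂ : ((4 : ℝ) ^ w * 3 ^ (s - w)) ^ 40 ≤ (4 ^ 23 * 3 ^ 17) ^ s := by
    have e₁ : 23 * s = 40 * w + (23 * s - 40 * w) := by omega
    have e₂ : (s - w) * 40 = 17 * s + (23 * s - 40 * w) := by omega
    calc ((4 : ℝ) ^ w * 3 ^ (s - w)) ^ 40
        = 4 ^ (40 * w) * (3 ^ (17 * s) * 3 ^ (23 * s - 40 * w)) := by
          rw [mul_pow, ← pow_mul, ← pow_mul, e₂, pow_add, mul_comm w]
      _ ≤ 4 ^ (40 * w) * (3 ^ (17 * s) * 4 ^ (23 * s - 40 * w)) := by gcongr; norm_num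
      _ = 4 ^ (40 * w + (23 * s - 40 * w)) * 3 ^ (17 * s) := by rw [pow_add]; ring
      _ = (4 ^ 23 * 3 ^ 17) ^ s := by rw [← e₁, mul_pow, pow_mul, pow_mul]
  calc ((d : ℝ) * (4 ^ w * 3 ^ (s - w))) ^ 40
      = ((d : ℝ) ^ 20) ^ 2 * (4 ^ w * 3 ^ (s - w)) ^ 40 := by ring
    _ ≤ ((7 ^ s) ^ 7) ^ 2 * (4 ^ 23 * 3 ^ 17) ^ s := by gcongr
    _ = (7 ^ 14 * (4 ^ 23 * 3 ^ 17)) ^ s := by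
        rw [← pow_mul, ← pow_mul, mul_pow (7 ^ 14), ← pow_mul 7 14]
        congr 2
        ring
    _ ≤ ((7 * (1999 / 2000)) ^ 40) ^ s := by
        refine pow_le_pow_left₀ (by positivity) ?_ s
        norm_num
    _ = (7 ^ s * (1999 / 2000) ^ s) ^ 40 := by
        rw [← mul_pow, ← pow_mul, ← pow_mul, Nat.mul_comm]

set_option exponentiation.threshold 600 in
/-- The number of triples sharing two vectors with a typical triple. -/
theorem mul_pow_double_le {s d w : ℕ} {ψ : ℝ} (hψ : ψ ≤ 7 ^ s) (hd : (d : ℝ) ^ 500 ≤ ψ ^ 347)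
    (hψ₀ : 0 ≤ ψ) (hw : 500 * w ≤ 429 * s) :
    (d : ℝ) * 2 ^ w ≤ 7 ^ s * (1999 / 2000) ^ s := by
  -- The 500th power clears the exponents 347/500 = 0.694 and 429/500.
  refine le_of_pow_le_pow_left₀ (n := 500) (by norm_num) (by positivity) ?_
  have h₁ : (d : ℝ) ^ 500 ≤ (7 ^ 347) ^ s := by
    rw [pow_right_comm]
    exact hd.trans (pow_le_pow_left₀ hψ₀ hψ _)
  have h₂ : ((2 : ℝ) ^ w) ^ 500 ≤ (2 ^ 429) ^ s := by
    rw [← pow_mul, ← pow_mul]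
    exact pow_le_pow_right₀ (by norm_num) (by omega)
  calc ((d : ℝ) * 2 ^ w) ^ 500 = (d : ℝ) ^ 500 * (2 ^ w) ^ 500 := mul_pow _ _ _
    _ ≤ (7 ^ 347) ^ s * (2 ^ 429) ^ s := by gcongr
    _ = (7 ^ 347 * 2 ^ 429) ^ s := (mul_pow _ _ _).symm
    _ ≤ ((7 * (1999 / 2000)) ^ 500) ^ s := by
        refine pow_le_pow_left₀ (by positivity) ?_ s
        norm_num
    _ = (7 ^ s * (1999 / 2000) ^ s) ^ 500 := by
        rw [← mul_pow, ← pow_mul, ← pow_mul, Nat.mul_comm]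

end BMM

namespace BMM
open Finset Filter

/-! ### Overlaps of typical triples -/

/-- The random choices that decide whether a triple is matched. -/
abbrev Cell (s : ℕ) : Type := Bits s ⊕ Bits s ⊕ Bits s ⊕ Bits s

/-- The numbers of values of the random choices. -/
def dims (s d₁ d₂ d₃ : ℕ) : Cell s → ℕ
  | .inl _ => d₁
  | .inr (.inl _) => d₂
  | .inr (.inr (.inl _)) => d₃
  | .inr (.inr (.inr _)) => 2

instance {s d₁ d₂ d₃ : ℕ} [NeZero d₁] [NeZero d₂] [NeZero d₃] :
    ∀ i, NeZero (dims s d₁ d₂ d₃ i)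
  | .inl _ => inferInstanceAs (NeZero d₁)
  | .inr (.inl _) => inferInstanceAs (NeZero d₂)
  | .inr (.inr (.inl _)) => inferInstanceAs (NeZero d₃)
  | .inr (.inr (.inr _)) => inferInstanceAs (NeZero 2)

/-- The first vector of a triple. -/
def vecX {s : ℕ} (t : Fin s → Pat) : Bits s := fun i => (t i).1

/-- The second vector of a triple. -/
def vecY {s : ℕ} (t : Fin s → Pat) : Bits s := fun i => (t i).2.1

/-- The third vector of a triple. -/
def vecZ {s : ℕ} (t : Fin s → Pat) : Bits s := fun i => (t i).2.2

/-- The random choices on which the matching of a triple depends. -/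
def cells {s : ℕ} (t : Fin s → Pat) : Finset (Cell s) :=
  {.inl (vecX t), .inr (.inl (vecY t)), .inr (.inr (.inl (vecZ t))), .inr (.inr (.inr (vecY t)))}

theorem prod_cells {s : ℕ} {R : Type*} [CommMonoid R] (f : Cell s → R) (t : Fin s → Pat) :
    ∏ i ∈ cells t, f i = f (.inl (vecX t)) * (f (.inr (.inl (vecY t))) *
      (f (.inr (.inr (.inl (vecZ t)))) * f (.inr (.inr (.inr (vecY t)))))) := by
  simp [cells]

/-- The left side is the chance that a second triple is matched, given a first one with which it
shares the vectors marked by `p`, `q`, `r`: each shared vector saves one factor of 1/(uvw). Bounding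
it by a sum over the possible kinds of overlap lets each kind be counted separately. -/
theorem overlap_aux {u v w : ℝ} (hu : 0 < u) (hv : 0 < v) (hw : 0 < w) (p q r : Prop) [Decidable p]
    [Decidable q] [Decidable r] (h : p ∨ q ∨ r) :
    (if p then 1 else u⁻¹) * (if q then 1 else v⁻¹) * (if r then 1 else w⁻¹) ≤
      (u * v * w)⁻¹ * (u * (if p then 1 else 0) + v * (if q then 1 else 0) +
        w * (if r then 1 else 0) + u * v * (if p ∧ q then 1 else 0) +
        u * w * (if p ∧ r then 1 else 0) + v * w * (if q ∧ r then 1 else 0)) +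
        (if p ∧ q ∧ r then 1 else 0) := by
  have hm : (u * v * w)⁻¹ = u⁻¹ * v⁻¹ * w⁻¹ := by rw [mul_inv, mul_inv]
  have hu' : u⁻¹ * u = 1 := inv_mul_cancel₀ hu.ne'
  have hv' : v⁻¹ * v = 1 := inv_mul_cancel₀ hv.ne'
  have hw' : w⁻¹ * w = 1 := inv_mul_cancel₀ hw.ne'
  have h1 : (u * v * w)⁻¹ * (v * w) = u⁻¹ := by rw [hm]; linear_combination u⁻¹ * v⁻¹ * v * hw' + u⁻¹ * hv'
  have h2 : (u * v * w)⁻¹ * (u * w) = v⁻¹ := by rw [hm]; linear_combination v⁻¹ * u⁻¹ * u * hw' + v⁻¹ * hu'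
  have h3 : (u * v * w)⁻¹ * (u * v) = w⁻¹ := by rw [hm]; linear_combination w⁻¹ * u⁻¹ * u * hv' + w⁻¹ * hu'
  have h4 : (u * v * w)⁻¹ * u = v⁻¹ * w⁻¹ := by rw [hm]; linear_combination v⁻¹ * w⁻¹ * hu'
  have h5 : (u * v * w)⁻¹ * v = u⁻¹ * w⁻¹ := by rw [hm]; linear_combination u⁻¹ * w⁻¹ * hv'
  have h6 : (u * v * w)⁻¹ * w = u⁻¹ * v⁻¹ := by rw [hm]; linear_combination u⁻¹ * v⁻¹ * hw'
  have i1 : 0 < u⁻¹ := inv_pos.2 hu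
  have i2 : 0 < v⁻¹ := inv_pos.2 hv
  have i3 : 0 < w⁻¹ := inv_pos.2 hw
  have i4 := mul_pos i1 i2
  have i5 := mul_pos i1 i3
  have i6 := mul_pos i2 i3
  clear hm
  generalize (u * v * w)⁻¹ = M at *
  by_cases hp : p <;> by_cases hq : q <;> by_cases hr : r <;>
    simp only [hp, hq, hr, and_self, and_true, and_false, if_true, if_false,
      mul_one, one_mul, mul_zero, add_zero, zero_add, or_false, or_self] at h ⊢ <;>
    linarith

variable {s d₁ d₂ d₃ : ℕ}

/-- The image of the second vector and the bit of its column are shared or not together, so the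
second dimension enters as `2 * d₂`. -/
theorem prod_cells_sdiff (t t' : Fin s → Pat) :
    ∏ i ∈ cells t' \ cells t, (dims s d₁ d₂ d₃ i : ℝ)⁻¹ =
      (if vecX t' = vecX t then 1 else (d₁ : ℝ)⁻¹) *
        (if vecY t' = vecY t then 1 else ((2 * d₂ : ℕ) : ℝ)⁻¹) *
        (if vecZ t' = vecZ t then 1 else (d₃ : ℝ)⁻¹) := by
  rw [sdiff_eq_filter, prod_filter, prod_cells]
  simp only [cells, mem_insert, mem_singleton, Sum.inl.injEq, Sum.inr.injEq, reduceCtorEq,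
    or_false, false_or, dims, ite_not]
  push_cast
  split_ifs <;> ring

theorem not_disjoint_cells {t t' : Fin s → Pat} (h : ¬ Disjoint (cells t') (cells t)) :
    vecX t' = vecX t ∨ vecY t' = vecY t ∨ vecZ t' = vecZ t := by
  rw [not_disjoint_iff] at h
  obtain ⟨i, h, h'⟩ := h
  simp only [cells, mem_insert, mem_singleton] at h h'
  rcases h with rfl | rfl | rfl | rfl <;> simp at h' <;> simp [h']

theorem card_typical_filter_le {β : Type*} [DecidableEq β] (q : Pat → β) (b : Pat → Bool) {u v : ℕ}
    (h : ∀ p, #{p' ∈ allowed | q p' = q p} = if b p = true then u else v) (t : Fin s → Pat)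
    {P : (Fin s → Pat) → Prop} [DecidablePred P] (hP : ∀ t', P t' → ∀ i, q (t' i) = q (t i)) :
    (#{t' ∈ typical s | P t'} : ℝ) ≤ u ^ weight b t * v ^ (s - weight b t) := by
  rw [← Nat.cast_pow, ← Nat.cast_pow, ← Nat.cast_mul, Nat.cast_le, ← card_projection q b h]
  refine card_le_card fun t' ht' => ?_
  rw [mem_filter] at ht' ⊢
  exact ⟨(mem_filter.1 ht'.1).1, hP t' ht'.2⟩

variable [NeZero d₁] [NeZero d₂] [NeZero d₃]

open Classical in
/-- The conditional expectation of the number of matched triples that overlap a matched one. -/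
theorem sum_overlap_le {ψ : ℝ} (hψ₀ : 0 ≤ ψ) (hψ : ψ ≤ 7 ^ s) (h₁ : (d₁ : ℝ) ^ 20 ≤ ψ ^ 7)
    (h₂ : (d₂ : ℝ) ^ 20 ≤ ψ ^ 7) (h₃ : (d₃ : ℝ) ^ 20 ≤ ψ ^ 7)
    (h₁₂ : ((d₁ * d₂ : ℕ) : ℝ) ^ 500 ≤ ψ ^ 347) (h₁₃ : ((d₁ * d₃ : ℕ) : ℝ) ^ 500 ≤ ψ ^ 347)
    (h₂₃ : ((d₂ * d₃ : ℕ) : ℝ) ^ 500 ≤ ψ ^ 347) {t : Fin s → Pat} (ht : t ∈ typical s) :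
    ∑ t' ∈ typical s with ¬ Disjoint (cells t') (cells t),
        ∏ i ∈ cells t' \ cells t, (dims s d₁ d₂ d₃ i : ℝ)⁻¹ ≤
      1 + 9 * ((d₁ : ℝ) * (2 * d₂ : ℕ) * d₃)⁻¹ * (7 ^ s * (1999 / 2000) ^ s) := by
  have hd₁ : (0 : ℝ) < d₁ := Nat.cast_pos.2 (Nat.pos_of_ne_zero (NeZero.ne _))
  have hd₂ : (0 : ℝ) < (2 * d₂ : ℕ) :=
    Nat.cast_pos.2 (Nat.mul_pos two_pos (Nat.pos_of_ne_zero (NeZero.ne _)))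
  have hd₃ : (0 : ℝ) < d₃ := Nat.cast_pos.2 (Nat.pos_of_ne_zero (NeZero.ne _))
  set W : ℝ := 7 ^ s * (1999 / 2000) ^ s with hW
  set N : ℝ := ((d₁ : ℝ) * (2 * d₂ : ℕ) * d₃)⁻¹ with hN
  have hN0 : 0 < N := by positivity
  have hsingle := (mem_filter.1 ht).2.1
  have hdouble := (mem_filter.1 ht).2.2
  -- A bit 1 leaves four choices for the other two, a bit 0 only three. Below, two fixed bits leave
  -- two choices for the third, or one if both are 0.
  have cX := card_typical_filter_le (fun p : Pat => p.1) (single 0) (u := 4) (v := 3) (by decide) t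
    (P := fun t' => vecX t' = vecX t) fun t' h i => congrFun h i
  have cY := card_typical_filter_le (fun p : Pat => p.2.1) (single 1) (u := 4) (v := 3) (by decide) t
    (P := fun t' => vecY t' = vecY t) fun t' h i => congrFun h i
  have cZ := card_typical_filter_le (fun p : Pat => p.2.2) (single 2) (u := 4) (v := 3) (by decide) t
    (P := fun t' => vecZ t' = vecZ t) fun t' h i => congrFun h i
  have cYZ := card_typical_filter_le (fun p : Pat => p.2) (double 0) (u := 2) (v := 1) (by decide) t
    (P := fun t' => vecY t' = vecY t ∧ vecZ t' = vecZ t)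
    fun t' h i => Prod.ext (congrFun h.1 i) (congrFun h.2 i)
  have cXZ := card_typical_filter_le (fun p : Pat => (p.1, p.2.2)) (double 1) (u := 2) (v := 1)
    (by decide) t (P := fun t' => vecX t' = vecX t ∧ vecZ t' = vecZ t)
    fun t' h i => Prod.ext (congrFun h.1 i) (congrFun h.2 i)
  have cXY := card_typical_filter_le (fun p : Pat => (p.1, p.2.1)) (double 2) (u := 2) (v := 1)
    (by decide) t (P := fun t' => vecX t' = vecX t ∧ vecY t' = vecY t)
    fun t' h i => Prod.ext (congrFun h.1 i) (congrFun h.2 i)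
  have cXYZ : (#{t' ∈ typical s | vecX t' = vecX t ∧ vecY t' = vecY t ∧ vecZ t' = vecZ t} : ℝ) ≤
      1 := by
    rw [Nat.cast_le_one, card_le_one_iff_subset_singleton]
    refine ⟨t, fun t' ht' => mem_singleton.2 (funext fun i => ?_)⟩
    have h := (mem_filter.1 ht').2
    exact Prod.ext (congrFun h.1 i) (Prod.ext (congrFun h.2.1 i) (congrFun h.2.2 i))
  have bX := (mul_le_mul_of_nonneg_left cX hd₁.le).trans
    (mul_pow_single_le hψ h₁ hψ₀ (weight_le _ _) (hsingle 0))
  have bY := (mul_le_mul_of_nonneg_left cY (Nat.cast_nonneg d₂)).trans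
    (mul_pow_single_le hψ h₂ hψ₀ (weight_le _ _) (hsingle 1))
  have bZ := (mul_le_mul_of_nonneg_left cZ hd₃.le).trans
    (mul_pow_single_le hψ h₃ hψ₀ (weight_le _ _) (hsingle 2))
  simp only [Nat.cast_one, one_pow, mul_one] at cYZ cXZ cXY
  have bYZ := (mul_le_mul_of_nonneg_left cYZ (Nat.cast_nonneg (d₂ * d₃))).trans
    (mul_pow_double_le hψ h₂₃ hψ₀ (hdouble 0))
  have bXZ := (mul_le_mul_of_nonneg_left cXZ (Nat.cast_nonneg (d₁ * d₃))).trans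
    (mul_pow_double_le hψ h₁₃ hψ₀ (hdouble 1))
  have bXY := (mul_le_mul_of_nonneg_left cXY (Nat.cast_nonneg (d₁ * d₂))).trans
    (mul_pow_double_le hψ h₁₂ hψ₀ (hdouble 2))
  rw [← hW] at bX bY bZ bXY bXZ bYZ
  calc ∑ t' ∈ typical s with ¬ Disjoint (cells t') (cells t),
        ∏ i ∈ cells t' \ cells t, (dims s d₁ d₂ d₃ i : ℝ)⁻¹
      ≤ ∑ t' ∈ typical s with ¬ Disjoint (cells t') (cells t), _ :=
        sum_le_sum fun t' ht' => (prod_cells_sdiff t t').le.trans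
          (overlap_aux hd₁ hd₂ hd₃ _ _ _ (not_disjoint_cells (mem_filter.1 ht').2))
    _ ≤ ∑ t' ∈ typical s, _ :=
        sum_le_sum_of_subset_of_nonneg (filter_subset _ _) fun t' _ _ => by positivity
    _ ≤ 1 + 9 * N * W := by
        rw [sum_add_distrib, ← mul_sum]
        simp only [sum_add_distrib, ← mul_sum, sum_boole]
        push_cast at *
        -- Each of the six terms is at most `W`, or `2 * W` when it contains the doubled dimension:
        -- 1 + 2 + 1 + 2 + 1 + 2 = 9. The triple itself contributes the separate 1.
        have : (d₁ : ℝ) * #{t' ∈ typical s | vecX t' = vecX t} +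
            2 * d₂ * #{t' ∈ typical s | vecY t' = vecY t} +
            d₃ * #{t' ∈ typical s | vecZ t' = vecZ t} +
            d₁ * (2 * d₂) * #{t' ∈ typical s | vecX t' = vecX t ∧ vecY t' = vecY t} +
            d₁ * d₃ * #{t' ∈ typical s | vecX t' = vecX t ∧ vecZ t' = vecZ t} +
            2 * d₂ * d₃ * #{t' ∈ typical s | vecY t' = vecY t ∧ vecZ t' = vecZ t} ≤ 9 * W := by
          linarith
        have := mul_le_mul_of_nonneg_left this hN0.le
        rw [← hN]
        linarith

end BMM

namespace BMM
open Finset Filter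

/-! ### The probability of an error -/

variable {s d₁ d₂ d₃ : ℕ}

/-- The random functions, and a random bit for every column. -/
abbrev Draw (s d₁ d₂ d₃ : ℕ) : Type :=
  (Bits s → Fin d₁) × (Bits s → Fin d₂) × (Bits s → Fin d₃) × (Bits s → ZMod 2)

/-- The random functions and bits as an element of a product. -/
def drawEquiv (s d₁ d₂ d₃ : ℕ) : Draw s d₁ d₂ d₃ ≃ ∀ i, Fin (dims s d₁ d₂ d₃ i) where
  toFun ω
    | .inl x => ω.1 x
    | .inr (.inl y) => ω.2.1 y
    | .inr (.inr (.inl z)) => ω.2.2.1 z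
    | .inr (.inr (.inr y)) => ω.2.2.2 y
  invFun v := (fun x => v (.inl x), fun y => v (.inr (.inl y)), fun z => v (.inr (.inr (.inl z))),
    fun y => v (.inr (.inr (.inr y))))
  left_inv _ := rfl
  right_inv v := by
    funext i
    rcases i with x | y | z | y <;> rfl

/-- A triple is matched if it is mapped to given indices, and the bit of its column is one. -/
def Matched (i : Fin d₁) (j : Fin d₂) (k : Fin d₃) (ω : Draw s d₁ d₂ d₃) (t : Fin s → Pat) : Prop :=
  ω.1 (vecX t) = i ∧ ω.2.1 (vecY t) = j ∧ ω.2.2.1 (vecZ t) = k ∧ ω.2.2.2 (vecY t) = 1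

open Classical in
theorem card_unmatched_le [NeZero d₁] [NeZero d₂] [NeZero d₃] (i : Fin d₁) (j : Fin d₂) (k : Fin d₃)
    {ψ : ℝ} (hψ₀ : 0 ≤ ψ) (hψ : ψ ≤ 7 ^ s) (h₁ : (d₁ : ℝ) ^ 20 ≤ ψ ^ 7)
    (h₂ : (d₂ : ℝ) ^ 20 ≤ ψ ^ 7) (h₃ : (d₃ : ℝ) ^ 20 ≤ ψ ^ 7)
    (h₁₂ : ((d₁ * d₂ : ℕ) : ℝ) ^ 500 ≤ ψ ^ 347) (h₁₃ : ((d₁ * d₃ : ℕ) : ℝ) ^ 500 ≤ ψ ^ 347)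
    (h₂₃ : ((d₂ * d₃ : ℕ) : ℝ) ^ 500 ≤ ψ ^ 347) :
    (#{ω : Draw s d₁ d₂ d₃ | ∀ t ∈ typical s, ¬ Matched i j k ω t} : ℝ) ≤
      Fintype.card (Draw s d₁ d₂ d₃) * Real.exp (-(#(typical s) * ((d₁ : ℝ) * (2 * d₂ : ℕ) * d₃)⁻¹ /
        (2 * (1 + 9 * ((d₁ : ℝ) * (2 * d₂ : ℕ) * d₃)⁻¹ * (7 ^ s * (1999 / 2000) ^ s))))) := by
  have h := card_no_pattern_le (n := dims s d₁ d₂ d₃) (T := typical s) (S := cells)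
    (drawEquiv s d₁ d₂ d₃ (fun _ => i, fun _ => j, fun _ => k, fun _ => 1))
    (N := (d₁ : ℝ) * (2 * d₂ : ℕ) * d₃)
    (δ := 1 + 9 * ((d₁ : ℝ) * (2 * d₂ : ℕ) * d₃)⁻¹ * (7 ^ s * (1999 / 2000) ^ s))
    (by positivity) (fun t => by
      rw [prod_cells]
      simp only [dims]
      push_cast
      ring)
    (fun t ht => by
      refine le_of_eq_of_le ?_ (sum_overlap_le hψ₀ hψ h₁ h₂ h₃ h₁₂ h₁₃ h₂₃ ht)
      refine sum_congr (filter_congr_decidable _ _ _) fun _ _ => rfl)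
  rw [← Fintype.card_congr (drawEquiv s d₁ d₂ d₃)] at h
  refine le_trans (le_of_eq ?_) h
  congr 1
  refine card_equiv (drawEquiv s d₁ d₂ d₃) fun ω => ?_
  simp only [mem_filter, mem_univ, true_and]
  refine forall₂_congr fun t _ => not_congr ?_
  simp only [cells, forall_mem_insert, mem_singleton, forall_eq]
  rfl

/-! ### From the random matrix to one random bit per column, and the union bound -/

open Classical in
-- All fibres of a surjective homomorphism have the same size, so it carries the uniform
-- distribution to the uniform distribution.
theorem card_filter_surjective {G H : Type*} [AddGroup G] [Fintype G] [AddGroup H] [Fintype H]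
    (φ : G →+ H) (hφ : Function.Surjective φ) (S : H → Prop) :
    #{g | S (φ g)} * Fintype.card H = Fintype.card G * #{h | S h} := by
  have hfib : ∀ U : H → Prop, #{g | U (φ g)} = #{h | U h} * #{g | φ g = 0} := by
    intro U
    rw [card_eq_sum_card_fiberwise (f := φ) (t := {h | U h}) (fun g hg => by simpa using hg),
      ← smul_eq_mul, ← sum_const]
    refine sum_congr rfl fun h hh => ?_
    rw [← AddMonoidHom.card_fiber_eq_of_mem_range φ (hφ h) (hφ 0), filter_filter]
    congr 1
    refine filter_congr fun g _ => ⟨fun h => h.2, fun e => ⟨?_, e⟩⟩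
    rw [e]
    exact (mem_filter.1 hh).2
  have h₁ := hfib S
  have h₂ := hfib fun _ => True
  simp only [filter_true, card_univ] at h₂
  rw [h₁, h₂]
  ring

theorem pseudoMul_blow (A : Matrix (Fin d₁) (Fin d₃) Bool) (B : Matrix (Fin d₃) (Fin d₂) Bool)
    (f₁ : Bits s → Fin d₁) (f₂ : Bits s → Fin d₂) (f₃ : Bits s → Fin d₃)
    (D : Bits s → Bits s → ZMod 2) (x y : Bits s) :
    pseudoMul (BitRAM.blowA A (f₁, f₂, f₃, D)) (BitRAM.blowB B (f₁, f₂, f₃, D)) x y =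
      ∑ z, (if (∀ i, (x i || y i || z i) = true) ∧ A (f₁ x) (f₃ z) = true ∧ B (f₃ z) (f₂ y) = true
        then 1 else 0) * D z y := by
  rw [pseudoMul, sum_filter]
  refine sum_congr rfl fun z _ => ?_
  simp only [BitRAM.blowA, BitRAM.blowB]
  split_ifs <;> simp_all

theorem vec_or {t : Fin s → Pat} (ht : t ∈ typical s) (i : Fin s) :
    (vecX t i || vecY t i || vecZ t i) = true := by
  have := Fintype.mem_piFinset.1 (mem_filter.1 ht).1 i
  exact (mem_filter.1 this).2

/-- If a matched triple has a given column, then some entry of that column of the pseudo-product is a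
nontrivial linear combination of the random bits. -/
theorem exists_coefficients {A : Matrix (Fin d₁) (Fin d₃) Bool} {B : Matrix (Fin d₃) (Fin d₂) Bool}
    {i : Fin d₁} {j : Fin d₂} {k : Fin d₃} (hA : A i k = true) (hB : B k j = true)
    (f₁ : Bits s → Fin d₁) (f₂ : Bits s → Fin d₂) (f₃ : Bits s → Fin d₃) (y : Bits s) :
    ∃ c : Bits s → ZMod 2, (∃ z, c z = 1) ∧
      ((∃ t ∈ typical s, f₁ (vecX t) = i ∧ f₂ (vecY t) = j ∧ f₃ (vecZ t) = k ∧ vecY t = y) →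
        ∃ x, f₁ x = i ∧ f₂ y = j ∧ ∀ D, pseudoMul (BitRAM.blowA A (f₁, f₂, f₃, D))
          (BitRAM.blowB B (f₁, f₂, f₃, D)) x y = ∑ z, c z * D z y) := by
  by_cases h : ∃ t ∈ typical s, f₁ (vecX t) = i ∧ f₂ (vecY t) = j ∧ f₃ (vecZ t) = k ∧ vecY t = y
  · obtain ⟨t, ht, hx, hy, hz, rfl⟩ := h
    have hA' : A (f₁ (vecX t)) (f₃ (vecZ t)) = true := by rw [hx, hz, hA]
    have hB' : B (f₃ (vecZ t)) (f₂ (vecY t)) = true := by rw [hy, hz, hB]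
    exact ⟨fun z => if (∀ i, (vecX t i || vecY t i || z i) = true) ∧
      A (f₁ (vecX t)) (f₃ z) = true ∧ B (f₃ z) (f₂ (vecY t)) = true then 1 else 0,
      ⟨vecZ t, if_pos ⟨vec_or ht, hA', hB'⟩⟩, fun _ => ⟨vecX t, hx, hy, fun D =>
        pseudoMul_blow A B f₁ f₂ f₃ D (vecX t) (vecY t)⟩⟩
  -- A column without a matched triple gets an arbitrary nonzero form, so that the joint map on all
  -- columns is still surjective.
  · exact ⟨fun _ => 1, ⟨fun _ => true, rfl⟩, fun h' => absurd h' h⟩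

/-- Linear combinations of the entries of the columns of a matrix. -/
def columnHom (c : Bits s → Bits s → ZMod 2) : (Bits s → Bits s → ZMod 2) →+ (Bits s → ZMod 2) where
  toFun D y := ∑ z, c y z * D z y
  map_zero' := by
    funext y
    simp
  map_add' D D' := by
    funext y
    simp [mul_add, sum_add_distrib]

/-- The forms for different `y` read disjoint columns, so the values can be prescribed independently
through one nonzero coefficient in each. -/
theorem columnHom_surjective {c : Bits s → Bits s → ZMod 2} (hc : ∀ y, ∃ z, c y z = 1) :
    Function.Surjective (columnHom c) := by
  intro g
  choose z hz using hc
  refine ⟨fun z' y => if z' = z y then g y else 0, funext fun y => ?_⟩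
  change ∑ z', c y z' * (if z' = z y then g y else 0) = g y
  simp [hz]

open Classical in
/-- The matrix of random bits does at least as well as one random bit for every column. -/
theorem card_missed_mul_le {A : Matrix (Fin d₁) (Fin d₃) Bool} {B : Matrix (Fin d₃) (Fin d₂) Bool}
    {i : Fin d₁} {j : Fin d₂} {k : Fin d₃} (hA : A i k = true) (hB : B k j = true)
    (f₁ : Bits s → Fin d₁) (f₂ : Bits s → Fin d₂) (f₃ : Bits s → Fin d₃) :
    #{D : Bits s → Bits s → ZMod 2 | ¬ estimate A B (f₁, f₂, f₃, D) i j = true} *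
        Fintype.card (Bits s → ZMod 2) ≤
      Fintype.card (Bits s → Bits s → ZMod 2) *
        #{g : Bits s → ZMod 2 | ∀ t ∈ typical s, ¬ Matched i j k (f₁, f₂, f₃, g) t} := by
  -- The coefficients depend on the three functions but not on `D`, so for fixed functions the
  -- selected entries are independent fair bits. If the estimate misses the entry, all of them at
  -- matched columns vanish.
  choose c hc₁ hc₂ using exists_coefficients hA hB f₁ f₂ f₃
  have h := card_filter_surjective (columnHom c) (columnHom_surjective hc₁)
    fun g => ∀ t ∈ typical s, ¬ Matched i j k (f₁, f₂, f₃, g) t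
  refine le_of_le_of_eq (Nat.mul_le_mul_right _ (card_le_card fun D hD => ?_)) (h.trans (by congr))
  simp only [mem_filter, mem_univ, true_and] at hD ⊢
  rintro t ht ⟨hx, hy, hz, hg⟩
  obtain ⟨x, h₁, h₂, h₃⟩ := hc₂ (vecY t) ⟨t, ht, hx, hy, hz, rfl⟩
  exact hD ((BitRAM.estimate_iff A B _ i j).2 ⟨x, vecY t, h₁, h₂, (h₃ D).trans hg⟩)

open Classical in
/-- The probability that an entry equal to one is missed. -/
theorem card_missed_le [NeZero d₁] [NeZero d₂] [NeZero d₃] {A : Matrix (Fin d₁) (Fin d₃) Bool}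
    {B : Matrix (Fin d₃) (Fin d₂) Bool} {i : Fin d₁} {j : Fin d₂} {ε : ℝ}
    (hε : ∀ k, (#{ω : Draw s d₁ d₂ d₃ | ∀ t ∈ typical s, ¬ Matched i j k ω t} : ℝ) ≤
      Fintype.card (Draw s d₁ d₂ d₃) * ε) (hC : boolMul A B i j = true) :
    (#{ω : Sample s d₁ d₂ d₃ | ¬ estimate A B ω i j = true} : ℝ) ≤
      Fintype.card (Sample s d₁ d₂ d₃) * ε := by
  obtain ⟨k, hA, hB⟩ := of_decide_eq_true hC
  have hsum : #{ω : Sample s d₁ d₂ d₃ | ¬ estimate A B ω i j = true} *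
        Fintype.card (Bits s → ZMod 2) ≤
      Fintype.card (Bits s → Bits s → ZMod 2) *
        #{ω : Draw s d₁ d₂ d₃ | ∀ t ∈ typical s, ¬ Matched i j k ω t} := by
    have h : ∀ {α : Type} [Fintype α]
        (U : (Bits s → Fin d₁) × (Bits s → Fin d₂) × (Bits s → Fin d₃) × α → Prop) [DecidablePred U],
        #{ω | U ω} = ∑ f₁, ∑ f₂, ∑ f₃, #{a | U (f₁, f₂, f₃, a)} := by
      intro α _ U _
      simp only [card_filter, Fintype.sum_prod_type]
    rw [h, h]
    simp only [sum_mul, mul_sum]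
    refine sum_le_sum fun f₁ _ => sum_le_sum fun f₂ _ => sum_le_sum fun f₃ _ => ?_
    convert card_missed_mul_le hA hB f₁ f₂ f₃
  have hcard : Fintype.card (Sample s d₁ d₂ d₃) * Fintype.card (Bits s → ZMod 2) =
      Fintype.card (Bits s → Bits s → ZMod 2) * Fintype.card (Draw s d₁ d₂ d₃) := by
    simp only [Fintype.card_prod]
    ring
  have hpos : (0 : ℝ) < Fintype.card (Bits s → ZMod 2) := by exact_mod_cast Fintype.card_pos
  refine le_of_mul_le_mul_right ?_ hpos
  calc (#{ω : Sample s d₁ d₂ d₃ | ¬ estimate A B ω i j = true} : ℝ) *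
        Fintype.card (Bits s → ZMod 2)
      ≤ Fintype.card (Bits s → Bits s → ZMod 2) *
        #{ω : Draw s d₁ d₂ d₃ | ∀ t ∈ typical s, ¬ Matched i j k ω t} := by exact_mod_cast hsum
    _ ≤ Fintype.card (Bits s → Bits s → ZMod 2) * (Fintype.card (Draw s d₁ d₂ d₃) * ε) := by
        exact mul_le_mul_of_nonneg_left (hε k) (Nat.cast_nonneg _)
    _ = _ := by
        have : (Fintype.card (Sample s d₁ d₂ d₃) : ℝ) * Fintype.card (Bits s → ZMod 2) =
          Fintype.card (Bits s → Bits s → ZMod 2) * Fintype.card (Draw s d₁ d₂ d₃) := by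
            exact_mod_cast hcard
        linear_combination (-ε) * this

/-- Errors are one-sided. -/
theorem boolMul_of_estimate {A : Matrix (Fin d₁) (Fin d₃) Bool} {B : Matrix (Fin d₃) (Fin d₂) Bool}
    {ω : Sample s d₁ d₂ d₃} {i : Fin d₁} {j : Fin d₂} (h : estimate A B ω i j = true) :
    boolMul A B i j = true := by
  obtain ⟨f₁, f₂, f₃, D⟩ := ω
  obtain ⟨x, y, rfl, rfl, h'⟩ := (BitRAM.estimate_iff A B _ i j).1 h
  replace h' := (pseudoMul_blow A B f₁ f₂ f₃ D x y).symm.trans h'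
  obtain ⟨z, -, hz⟩ := exists_ne_zero_of_sum_ne_zero (h'.trans_ne one_ne_zero)
  have := (ite_ne_right_iff.1 (left_ne_zero_of_mul hz)).1
  exact decide_eq_true ⟨f₃ z, this.2.1, this.2.2⟩

open Classical in
/-- The probability that the estimate is wrong. -/
theorem card_wrong_le [NeZero d₁] [NeZero d₂] [NeZero d₃] (A : Matrix (Fin d₁) (Fin d₃) Bool)
    (B : Matrix (Fin d₃) (Fin d₂) Bool) {ε : ℝ} (hε₀ : 0 ≤ ε)
    (hε : ∀ i j k, (#{ω : Draw s d₁ d₂ d₃ | ∀ t ∈ typical s, ¬ Matched i j k ω t} : ℝ) ≤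
      Fintype.card (Draw s d₁ d₂ d₃) * ε) :
    (#{ω : Sample s d₁ d₂ d₃ | estimate A B ω ≠ boolMul A B} : ℝ) ≤
      d₁ * d₂ * (Fintype.card (Sample s d₁ d₂ d₃) * ε) := by
  have hcover : ({ω : Sample s d₁ d₂ d₃ | estimate A B ω ≠ boolMul A B} : Finset _) ⊆
      univ.biUnion fun ij : Fin d₁ × Fin d₂ =>
        {ω | boolMul A B ij.1 ij.2 = true ∧ ¬ estimate A B ω ij.1 ij.2 = true} := by
    intro ω hω
    rw [mem_filter] at hω
    by_contra hn
    simp only [mem_biUnion, mem_filter, mem_univ, true_and, not_exists, not_and, not_not] at hn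
    refine hω.2 (funext fun i => funext fun j => Bool.eq_iff_iff.2 ⟨boolMul_of_estimate, hn (i, j)⟩)
  have h := (card_le_card hcover).trans card_biUnion_le
  have hreal : (#{ω : Sample s d₁ d₂ d₃ | estimate A B ω ≠ boolMul A B} : ℝ) ≤
      ∑ ij : Fin d₁ × Fin d₂, (#{ω : Sample s d₁ d₂ d₃ | boolMul A B ij.1 ij.2 = true ∧
        ¬ estimate A B ω ij.1 ij.2 = true} : ℝ) := by exact_mod_cast h
  refine hreal.trans ((sum_le_card_nsmul _ _ (Fintype.card (Sample s d₁ d₂ d₃) * ε)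
    fun ij _ => ?_).trans (le_of_eq ?_))
  · by_cases hC : boolMul A B ij.1 ij.2 = true
    · exact (Nat.cast_le.2 (card_le_card fun ω hω => mem_filter.2 ⟨mem_univ _,
        (mem_filter.1 hω).2.2⟩)).trans (card_missed_le (hε ij.1 ij.2) hC)
    · rw [filter_false_of_mem fun ω _ h => hC h.1, card_empty, Nat.cast_zero]
      exact mul_nonneg (Nat.cast_nonneg _) hε₀
  · simp

open Classical in
theorem one_sub_le_estimateLaw [NeZero d₁] [NeZero d₂] [NeZero d₃]
    (A : Matrix (Fin d₁) (Fin d₃) Bool) (B : Matrix (Fin d₃) (Fin d₂) Bool) {ε : ℝ}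
    (hε : (#{ω : Sample s d₁ d₂ d₃ | estimate A B ω ≠ boolMul A B} : ℝ) ≤
      Fintype.card (Sample s d₁ d₂ d₃) * ε) :
    1 - ε ≤ (estimateLaw s A B (boolMul A B)).toReal := by
  have hpos : (0 : ℝ) < Fintype.card (Sample s d₁ d₂ d₃) := by exact_mod_cast Fintype.card_pos
  have h : (estimateLaw s A B (boolMul A B)).toReal =
      #{ω : Sample s d₁ d₂ d₃ | estimate A B ω = boolMul A B} /
        (Fintype.card (Sample s d₁ d₂ d₃) : ℝ) := by
    rw [estimateLaw, PMF.map_apply, tsum_fintype]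
    simp only [PMF.uniformOfFintype_apply]
    rw [← sum_filter, sum_const, nsmul_eq_mul, ENNReal.toReal_mul, ENNReal.toReal_inv,
      ENNReal.toReal_natCast, ENNReal.toReal_natCast, div_eq_mul_inv]
    congr 3
    refine filter_congr fun ω _ => eq_comm
  rw [h, le_div_iff₀ hpos]
  have hc := card_filter_add_card_filter_not (s := (univ : Finset (Sample s d₁ d₂ d₃)))
    (fun ω => estimate A B ω = boolMul A B)
  rw [card_univ] at hc
  have hc' : (#{ω : Sample s d₁ d₂ d₃ | estimate A B ω = boolMul A B} : ℝ) +
    #{ω : Sample s d₁ d₂ d₃ | estimate A B ω ≠ boolMul A B} =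
      Fintype.card (Sample s d₁ d₂ d₃) := by exact_mod_cast hc
  linarith

end BMM

namespace BMM
open Filter Real

/-! ### The choice of the parameter -/

theorem log_le_size {n : ℕ} (hn : 1 ≤ n) : log n ≤ n.size := by
  have h : (n : ℝ) ≤ 2 ^ n.size := by exact_mod_cast (Nat.lt_size_self n).le
  calc log n ≤ log (2 ^ n.size) := log_le_log (by exact_mod_cast hn) h
    _ = n.size * log 2 := by rw [log_pow]
    _ ≤ n.size * 1 := mul_le_mul_of_nonneg_left (log_two_lt_d9.le.trans (by norm_num))
        (Nat.cast_nonneg _)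
    _ = n.size := mul_one _

theorem size_le_four_mul_log {n : ℕ} (hn : 2 ≤ n) : (n.size : ℝ) ≤ 4 * log n := by
  have hs : 0 < n.size := Nat.size_pos.2 (by omega)
  have h : 2 ^ (n.size - 1) ≤ n := Nat.lt_size.1 (by omega)
  have h' : ((n.size - 1 : ℕ) : ℝ) * log 2 ≤ log n := by
    rw [← log_pow]
    exact log_le_log (by positivity) (by exact_mod_cast h)
  rw [Nat.cast_sub hs, Nat.cast_one] at h'
  have h₂ : log 2 ≤ log n := log_le_log (by norm_num) (by exact_mod_cast hn)
  have h₃ := log_two_gt_d9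
  have h₄ : (1 : ℝ) ≤ n.size := by exact_mod_cast hs
  nlinarith

theorem pow_clog_le {b n : ℕ} (hb : 1 < b) (hn : 1 ≤ n) : b ^ Nat.clog b n ≤ b * n := by
  rcases Nat.eq_or_lt_of_le hn with rfl | hn
  · simp
    omega
  · have h := Nat.pow_pred_clog_lt_self hb hn
    have hpos : 0 < Nat.clog b n := Nat.clog_pos hb hn
    calc b ^ Nat.clog b n = b * b ^ (Nat.clog b n).pred := by
          rw [← pow_succ', ← Nat.succ_eq_add_one, Nat.succ_pred_eq_of_pos hpos]
      _ ≤ b * n := Nat.mul_le_mul_left _ h.le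

/-- The time bound in terms of the size of the problem. -/
theorem six_pow_le {s : ℕ} {x : ℝ} (h : (7 : ℝ) ^ s ≤ x) :
    (6 : ℝ) ^ s ≤ x ^ (log 6 / log 7) := by
  have h7 : 0 < log 7 := log_pos (by norm_num)
  have h6 : 0 < log 6 := log_pos (by norm_num)
  calc (6 : ℝ) ^ s = ((7 : ℝ) ^ s) ^ (log 6 / log 7) := by
        rw [← rpow_natCast 7 s, ← rpow_mul (by norm_num), mul_comm, rpow_mul (by norm_num),
          rpow_natCast]
        congr 1
        rw [rpow_def_of_pos (by norm_num), mul_div_cancel₀ _ h7.ne', exp_log (by norm_num)]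
    _ ≤ x ^ (log 6 / log 7) := rpow_le_rpow (by positivity) h (by positivity)

theorem eventually_mul_pow_le (a : ℝ) :
    ∀ᶠ s : ℕ in atTop, a * s * (1999 / 2000 : ℝ) ^ s ≤ 1 / 2 := by
  have h := (tendsto_self_mul_const_pow_of_lt_one (r := (1999 / 2000 : ℝ)) (by norm_num)
    (by norm_num)).const_mul a
  rw [mul_zero] at h
  filter_upwards [h.eventually_le_const (show (0 : ℝ) < 1 / 2 by norm_num)] with s hs
  rw [mul_assoc]
  exact hs

/-- Both parts of the denominator are controlled separately: 2aL ≤ v/8 by `h₁` and 18aLvr ≤ v/4 by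
`h₂`, together less than v/2. -/
theorem le_exponent {v w T a L r : ℝ} (hv : 0 < v) (hr : 0 ≤ r) (hT : v / 2 ≤ T) (hw : w = v * r)
    (h₁ : 16 * (a * L) ≤ v) (h₂ : 36 * (a * L) * r ≤ 1 / 2) :
    a * L ≤ T / (2 * (1 + 9 * w)) := by
  subst hw
  rw [le_div_iff₀ (by positivity)]
  nlinarith

/-- With a suitable parameter, errors are unlikely. -/
theorem exists_parameter (c : ℝ) : ∃ C : ℕ, 1 ≤ C ∧ ∀ (d₁ d₂ d₃ : ℕ) [NeZero d₁] [NeZero d₂]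
    [NeZero d₃], (psi1 d₁ d₂ d₃ : ℝ) ≤ (psi3 d₁ d₂ d₃ : ℝ) ^ (0.350 : ℝ) →
    (psi2 d₁ d₂ d₃ : ℝ) ≤ (psi3 d₁ d₂ d₃ : ℝ) ^ (0.694 : ℝ) →
    ∀ (A : Matrix (Fin d₁) (Fin d₃) Bool) (B : Matrix (Fin d₃) (Fin d₂) Bool),
      1 - (psi3 d₁ d₂ d₃ : ℝ) ^ (-c) ≤
        (estimateLaw (Nat.clog 7 (C * (d₁ * d₂ * d₃) * (d₁ * d₂ * d₃).size)) A B
          (boolMul A B)).toReal := by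
  -- The union bound over at most ψ₃ entries costs one power of ψ₃; the maximum keeps `a` positive
  -- for negative `c`.
  obtain ⟨a, ha⟩ : ∃ a, a = max c 0 + 1 := ⟨_, rfl⟩
  have ha₁ : 1 ≤ a := by rw [ha]; linarith [le_max_right c 0]
  obtain ⟨s₁, hs₁⟩ := eventually_atTop.1
    (eventually_card_typical.and (eventually_mul_pow_le (36 * a * log 7)))
  -- The first factor forces s ≥ s₁, so the asymptotic estimates hold for every input. The second
  -- gives 7^s ≥ 32aψ₃ log ψ₃, hence the required 7^s/(2ψ₃) ≥ 16a log ψ₃.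
  refine ⟨7 ^ s₁ * ⌈32 * a⌉₊, Nat.mul_pos (by positivity) (Nat.ceil_pos.2 (by positivity)),
    fun d₁ d₂ d₃ _ _ _ hψ₁ hψ₂ A B => ?_⟩
  have hd₁ : 1 ≤ d₁ := NeZero.one_le
  have hd₂ : 1 ≤ d₂ := NeZero.one_le
  have hd₃ : 1 ≤ d₃ := NeZero.one_le
  rw [show psi3 d₁ d₂ d₃ = d₁ * d₂ * d₃ from rfl] at *
  have hψ : 1 ≤ d₁ * d₂ * d₃ := Nat.mul_pos (Nat.mul_pos hd₁ hd₂) hd₃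
  have hprod : (d₁ : ℝ) * (2 * d₂ : ℕ) * d₃ = 2 * (d₁ * d₂ * d₃ : ℕ) := by
    push_cast
    ring
  have hdd : (d₁ : ℝ) * d₂ ≤ (d₁ * d₂ * d₃ : ℕ) := by
    exact_mod_cast Nat.le_mul_of_pos_right _ hd₃
  set n := d₁ * d₂ * d₃ with hn
  set s := Nat.clog 7 (7 ^ s₁ * ⌈32 * a⌉₊ * n * n.size) with hs
  have hn₀ : (0 : ℝ) < n := by exact_mod_cast hψ
  have hn₁ : (1 : ℝ) ≤ n := by exact_mod_cast hψ
  have hL₀ : 0 ≤ log n := log_nonneg hn₁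
  have hsize : 1 ≤ n.size := Nat.size_pos.2 hψ
  have hceil : 1 ≤ ⌈32 * a⌉₊ := Nat.ceil_pos.2 (by positivity)
  have h7 : 7 ^ s₁ * ⌈32 * a⌉₊ * n * n.size ≤ 7 ^ s := Nat.le_pow_clog (by norm_num) _
  have hs₁s : s₁ ≤ s := by
    refine (Nat.pow_le_pow_iff_right (a := 7) (by norm_num)).1 (le_trans ?_ h7)
    exact ((Nat.le_mul_of_pos_right _ hceil).trans (Nat.le_mul_of_pos_right _ hψ)).trans
      (Nat.le_mul_of_pos_right _ hsize)
  have h7' : 32 * a * n * log n ≤ 7 ^ s := by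
    have h : ⌈32 * a⌉₊ * n * n.size ≤ 7 ^ s := by
      refine le_trans ?_ h7
      simp only [mul_assoc]
      exact Nat.le_mul_of_pos_left _ (by positivity)
    calc 32 * a * n * log n ≤ ⌈32 * a⌉₊ * n * n.size :=
          mul_le_mul (mul_le_mul_of_nonneg_right (Nat.le_ceil _) hn₀.le) (log_le_size hψ) hL₀
            (by positivity)
      _ ≤ 7 ^ s := by exact_mod_cast h
  have hn7 : (n : ℝ) ≤ 7 ^ s := by
    have h : n ≤ 7 ^ s := by
      refine le_trans ?_ h7
      exact (Nat.le_mul_of_pos_left _ (Nat.mul_pos (by positivity) hceil)).trans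
        (Nat.le_mul_of_pos_right _ hsize)
    exact_mod_cast h
  obtain ⟨hT, hρ⟩ := hs₁ s hs₁s
  -- the dimensions
  have hone : ∀ d : ℕ, d ≤ psi1 d₁ d₂ d₃ → (d : ℝ) ^ 20 ≤ (n : ℝ) ^ 7 := by
    intro d hd
    have h : (d : ℝ) ≤ (n : ℝ) ^ (0.350 : ℝ) := le_trans (by exact_mod_cast hd) hψ₁
    refine (pow_le_pow_left₀ (Nat.cast_nonneg d) h 20).trans (le_of_eq ?_)
    rw [← rpow_mul_natCast hn₀.le, ← rpow_natCast]
    norm_num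
  have htwo : ∀ d : ℕ, d ≤ psi2 d₁ d₂ d₃ → (d : ℝ) ^ 500 ≤ (n : ℝ) ^ 347 := by
    intro d hd
    have h : (d : ℝ) ≤ (n : ℝ) ^ (0.694 : ℝ) := le_trans (by exact_mod_cast hd) hψ₂
    refine (pow_le_pow_left₀ (Nat.cast_nonneg d) h 500).trans (le_of_eq ?_)
    rw [← rpow_mul_natCast hn₀.le, ← rpow_natCast]
    norm_num
  have hun := fun i j k => card_unmatched_le (s := s) (d₁ := d₁) (d₂ := d₂) (d₃ := d₃) i j k hn₀.le
    hn7 (hone _ (by unfold psi1; omega)) (hone _ (by unfold psi1; omega))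
    (hone _ (by unfold psi1; omega)) (htwo _ (by unfold psi2; omega)) (htwo _ (by unfold psi2; omega))
    (htwo _ (by unfold psi2; omega))
  rw [hprod] at hun
  refine one_sub_le_estimateLaw A B ((card_wrong_le A B (exp_pos _).le hun).trans ?_)
  have hexp : a * log n ≤ (typical s).card * (2 * (n : ℝ))⁻¹ /
      (2 * (1 + 9 * (2 * (n : ℝ))⁻¹ * (7 ^ s * (1999 / 2000) ^ s))) := by
    rw [mul_assoc 9]
    refine le_exponent (v := (2 * (n : ℝ))⁻¹ * 7 ^ s) (r := (1999 / 2000) ^ s) (by positivity)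
      (by positivity) ?_ (by ring) ?_ ?_
    · rw [mul_comm _ ((2 * (n : ℝ))⁻¹), mul_div_assoc]
      exact mul_le_mul_of_nonneg_left hT (by positivity)
    · rw [← div_eq_inv_mul, le_div_iff₀ (by positivity)]
      linarith
    · have hlog : log n ≤ s * log 7 := by
        rw [← log_pow]
        exact log_le_log hn₀ hn7
      refine le_trans ?_ hρ
      refine mul_le_mul_of_nonneg_right ?_ (by positivity)
      nlinarith
  have hfinal : exp (-((typical s).card * (2 * (n : ℝ))⁻¹ /
      (2 * (1 + 9 * (2 * (n : ℝ))⁻¹ * (7 ^ s * (1999 / 2000) ^ s))))) ≤ (n : ℝ) ^ (-a) := by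
    rw [rpow_def_of_pos hn₀]
    exact exp_le_exp.2 (by linarith)
  calc (d₁ : ℝ) * d₂ * (Fintype.card (Sample s d₁ d₂ d₃) * exp (-((typical s).card *
        (2 * (n : ℝ))⁻¹ / (2 * (1 + 9 * (2 * (n : ℝ))⁻¹ * (7 ^ s * (1999 / 2000) ^ s))))))
      ≤ n * (Fintype.card (Sample s d₁ d₂ d₃) * (n : ℝ) ^ (-a)) := by gcongr
    _ = Fintype.card (Sample s d₁ d₂ d₃) * ((n : ℝ) ^ (1 : ℝ) * (n : ℝ) ^ (-a)) := by
        rw [rpow_one]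
        ring
    _ ≤ Fintype.card (Sample s d₁ d₂ d₃) * (n : ℝ) ^ (-c) := by
        rw [← rpow_add hn₀]
        refine mul_le_mul_of_nonneg_left (rpow_le_rpow_of_exponent_le hn₁ ?_) (Nat.cast_nonneg _)
        rw [ha]
        linarith [le_max_left c 0]

end BMM

/-! ### The time bound in terms of ψ₃, and the theorem -/

theorem mainTheorem4 (c : ℝ) :
    ∃ (P : BitRAM.Program) (s : ℕ → ℕ → ℕ → ℕ) (K : ℝ),
      ∀ (d₁ d₂ d₃ : ℕ) [NeZero d₁] [NeZero d₂] [NeZero d₃],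
        (BMM.psi1 d₁ d₂ d₃ : ℝ) ≤ (BMM.psi3 d₁ d₂ d₃ : ℝ) ^ (0.350 : ℝ) →
        (BMM.psi2 d₁ d₂ d₃ : ℝ) ≤ (BMM.psi3 d₁ d₂ d₃ : ℝ) ^ (0.694 : ℝ) →
        ∀ (A : Matrix (Fin d₁) (Fin d₃) Bool) (B : Matrix (Fin d₃) (Fin d₂) Bool),
          ∃ n : ℕ,
            (∀ x ∈ (BitRAM.run P n (BitRAM.start P A B)).support,
              x.stack = [] ∧
              (x.time : ℝ) ≤
                K * ((BMM.psi3 d₁ d₂ d₃ : ℝ) * Real.log (BMM.psi3 d₁ d₂ d₃ : ℝ)) ^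
                  (Real.log 6 / Real.log 7)) ∧
            (BitRAM.run P n (BitRAM.start P A B)).map (BitRAM.output d₁ d₂) =
              BMM.estimateLaw (s d₁ d₂ d₃) A B ∧
            1 - (BMM.psi3 d₁ d₂ d₃ : ℝ) ^ (-c) ≤
              ((BitRAM.run P n (BitRAM.start P A B)).map (BitRAM.output d₁ d₂)
                (BMM.boolMul A B)).toReal := by
  obtain ⟨C, hC, hprob⟩ := BMM.exists_parameter c
  obtain ⟨K₀, hrun⟩ := BitRAM.opportunistic_spec C hC
  refine ⟨BitRAM.opportunistic C,
    fun d₁ d₂ d₃ => Nat.clog 7 (C * (d₁ * d₂ * d₃) * (d₁ * d₂ * d₃).size),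
    K₀ * (28 * C : ℝ) ^ (Real.log 6 / Real.log 7), fun d₁ d₂ d₃ _ _ _ h₁ h₂ A B => ?_⟩
  obtain ⟨n, htime, hlaw⟩ := hrun d₁ d₂ d₃ A B
  refine ⟨n, fun x hx => ⟨(htime x hx).1, ?_⟩, hlaw, hlaw ▸ hprob d₁ d₂ d₃ h₁ h₂ A B⟩
  have hd₁ : 1 ≤ d₁ := NeZero.one_le
  have hd₂ : 1 ≤ d₂ := NeZero.one_le
  have hd₃ : 1 ≤ d₃ := NeZero.one_le
  have hp : 1 ≤ d₁ * d₂ * d₃ := Nat.mul_pos (Nat.mul_pos hd₁ hd₂) hd₃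
  -- For ψ₃ = 1 the claimed time would be zero; that case is excluded by the hypothesis on ψ₁, which
  -- is at least 3.
  have hp₂ : 2 ≤ d₁ * d₂ * d₃ := by
    by_contra hlt
    have h1 : BMM.psi3 d₁ d₂ d₃ = 1 := by unfold BMM.psi3; omega
    rw [h1, Nat.cast_one, Real.one_rpow] at h₁
    have : BMM.psi1 d₁ d₂ d₃ ≤ 1 := by exact_mod_cast h₁
    unfold BMM.psi1 at this
    omega
  have ht := (htime x hx).2
  rw [show BMM.psi3 d₁ d₂ d₃ = d₁ * d₂ * d₃ from rfl]
  set m := d₁ * d₂ * d₃ with hm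
  have hlog : 0 ≤ Real.log m := Real.log_nonneg (by exact_mod_cast hp)
  -- In the constant 28, the factor 7 pays for rounding `s` up and the factor 4 for replacing the
  -- logarithm by the binary length.
  have h7 : (7 : ℝ) ^ Nat.clog 7 (C * m * m.size) ≤ 28 * C * (m * Real.log m) := by
    have h := BMM.pow_clog_le (b := 7) (n := C * m * m.size) (by norm_num)
      (Nat.mul_pos (Nat.mul_pos hC hp) (Nat.size_pos.2 hp))
    calc (7 : ℝ) ^ Nat.clog 7 (C * m * m.size) ≤ 7 * (C * m * m.size) := by exact_mod_cast h
      _ ≤ 7 * (C * m * (4 * Real.log m)) := by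
          gcongr
          exact BMM.size_le_four_mul_log hp₂
      _ = 28 * C * (m * Real.log m) := by ring
  calc (x.time : ℝ) ≤ K₀ * 6 ^ Nat.clog 7 (C * m * m.size) := by exact_mod_cast ht
    _ ≤ K₀ * (28 * C * (m * Real.log m)) ^ (Real.log 6 / Real.log 7) :=
        mul_le_mul_of_nonneg_left (BMM.six_pow_le h7) (Nat.cast_nonneg _)
    _ = K₀ * (28 * C : ℝ) ^ (Real.log 6 / Real.log 7) *
        (m * Real.log m) ^ (Real.log 6 / Real.log 7) := by
        rw [Real.mul_rpow (by positivity) (by positivity), mul_assoc]
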